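/- **Theorem (Giraud's theorem in Mac Lane type theory).** Mac Lane type theory (MTT) has sets, classes of sets, and collections of classes. Its axioms are those of Mac Lane set theory for sets (extensionality, empty set, pairing, union, power set, infinity, choice, and separation for bounded ($\Delta_0$) formulas of the language of sets; neither replacement nor foundation), together with comprehension: every formula that quantifies only over sets, with arbitrary set, class and collection parameters, defines a class of sets and a collection of classes. The following is provable in MTT, i.e. it holds in every model of MTT. Let $\mathcal E$ be a class category (five classes: objects, arrows, and graphs of domain, codomain and composition, satisfying the category axioms) which is a $\mathcal U$-category (locally small): for every set of objects of $\mathcal E$ there is a set of all arrows between them, so that these objects span a small full subcategory, i.e. one all of whose five classes are sets. Suppose that a) $\mathcal E$ has a limit for every finite diagram; b) every set-indexed family $(A_i)_{i\in I}$ of objects of $\mathcal E$ has a coproduct, and coproducts are stable disjoint unions: the injections $A_i\to\coprod_i A_i$ are monic, the pullback of two injections with distinct indices is initial, and for every arrow $Y\to \coprod_i A_i$ the object $Y$ is the coproduct of a set-indexed family of pullbacks $Y\times_{\coprod_i A_i} A_i$; c) every equivalence relation $R\rightrightarrows A$ in $\mathcal E$ has a stable quotient: it is the kernel pair of its coequalizer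 $A\to B$, and every pullback of $A\to B$ is the coequalizer of its own kernel pair; d) there is a set $\{G_i\mid i\in I\}$ of generators: whenever $u\neq v\colon X\to Y$ there are an $i$ and an arrow $h\colon G_i\to X$ with $uh\neq vh$. Then $\mathcal E$ is a Grothendieck topos: there are a small category $\mathcal C$ (a set of objects and a set of arrows), a Grothendieck topology $J$ on $\mathcal C$ (a set), and a fully faithful and essentially surjective class functor from $\mathcal E$ to the class category $\widetilde{\mathcal C}_J$ of $J$-sheaves of sets on $\mathcal C$. Here a presheaf on $\mathcal C$ is a set $F_0$ with a function $\gamma_0\colon F_0\to \mathcal C_0$, whose fibre over $A$ is the value at $A$, and an action of the arrows of $\mathcal C$. -/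

import Mathlib

open CategoryTheory CategoryTheory.Limits

universe u v w

set_option linter.checkUnivs false

/-! ## Formulas -/

/-- Bounded (`Δ₀`) formulas of the language of sets; variables are named by natural numbers.
The other connectives are defined from `falsum`, `imp` as usual. -/
inductive BoundedSetFormula : Type
  | eq (i j : ℕ)
  | mem (i j : ℕ)
  | falsum
  | imp (φ ψ : BoundedSetFormula)
  /-- `∀ xᵢ ∈ xⱼ, φ`, where the bound `xⱼ` is evaluated outside of the quantifier. -/
  | ball (i j : ℕ) (φ : BoundedSetFormula)

/-- Set theoretic formulas: they may contain set, class and collection variables, but they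
quantify only over sets. -/
inductive SetTheoreticFormula : Type
  /-- `xᵢ = xⱼ` for set variables -/
  | eq (i j : ℕ)
  /-- `xᵢ ∈ xⱼ` for set variables -/
  | mem (i j : ℕ)
  /-- `xᵢ ∈₁ Xⱼ` for a set variable and a class variable -/
  | memCls (i j : ℕ)
  /-- `Xᵢ ∈₂ 𝔛ⱼ` for a class variable and a collection variable -/
  | memColl (i j : ℕ)
  | falsum
  | imp (φ ψ : SetTheoreticFormula)
  /-- `∀ xᵢ, φ`, quantification over all sets -/
  | all (i : ℕ) (φ : SetTheoreticFormula)

/-! ## Models of Mac Lane type theory -/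

/-- A structure for the language of Mac Lane type theory: sets, classes of sets,
collections of classes, and the three membership relations `∈`, `∈₁`, `∈₂`. -/
structure MTTStructure where
  V : Type u
  Cls : Type v
  Coll : Type w
  mem : V → V → Prop
  memCls : V → Cls → Prop
  memColl : Cls → Coll → Prop
  nonempty_Cls : Nonempty Cls
  nonempty_Coll : Nonempty Coll

/-- Satisfaction of a bounded formula under an assignment of the set variables. -/
def BoundedSetFormula.Sat (M : MTTStructure.{u, v, w}) : BoundedSetFormula → (ℕ → M.V) → Prop
  | .eq i j, s => s i = s j
  | .mem i j, s => M.mem (s i) (s j)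
  | .falsum, _ => False
  | .imp φ ψ, s => φ.Sat M s → ψ.Sat M s
  | .ball i j φ, s => ∀ x, M.mem x (s j) → φ.Sat M (Function.update s i x)

/-- Satisfaction of a set theoretic formula under assignments of the set, class and collection
variables. -/
def SetTheoreticFormula.Sat (M : MTTStructure.{u, v, w}) (c : ℕ → M.Cls) (k : ℕ → M.Coll) :
    SetTheoreticFormula → (ℕ → M.V) → Prop
  | .eq i j, s => s i = s j
  | .mem i j, s => M.mem (s i) (s j)
  | .memCls i j, s => M.memCls (s i) (c j)
  | .memColl i j, _ => M.memColl (c i) (k j)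
  | .falsum, _ => False
  | .imp φ ψ, s => φ.Sat M c k s → ψ.Sat M c k s
  | .all i φ, s => ∀ x, φ.Sat M c k (Function.update s i x)

/-- A model of Mac Lane type theory (MTT). The sets satisfy Mac Lane set theory: extensionality,
empty set, pairing, union, power set, infinity, choice, and separation for bounded formulas;
neither replacement nor foundation nor unbounded separation is assumed, and separation does not
apply to formulas with class variables. Every set theoretic formula, with set, class and
collection parameters, defines a class and a collection. Classes and collections need not be
extensional. -/
structure MTTModel extends MTTStructure.{u, v, w} where
  extensionality : ∀ x y, (∀ z, mem z x ↔ mem z y) → x = y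
  emptySet : ∃ x, ∀ z, ¬ mem z x
  pairing : ∀ x y, ∃ p, ∀ z, mem z p ↔ z = x ∨ z = y
  union : ∀ x, ∃ y, ∀ z, mem z y ↔ ∃ t, mem t x ∧ mem z t
  powerSet : ∀ x, ∃ y, ∀ z, mem z y ↔ ∀ t, mem t z → mem t x
  infinity : ∃ x, (∀ e, (∀ z, ¬ mem z e) → mem e x) ∧
    ∀ n, mem n x → ∀ m, (∀ z, mem z m ↔ mem z n ∨ z = n) → mem m x
  choice : ∀ x, (∀ y, mem y x → ∃ z, mem z y) →
    (∀ y y' z, mem y x → mem y' x → mem z y → mem z y' → y = y') →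
    ∃ t, ∀ y, mem y x → ∃! z, mem z y ∧ mem z t
  boundedSeparation : ∀ (φ : BoundedSetFormula) (s : ℕ → V) (x : V),
    ∃ y, ∀ z, mem z y ↔ mem z x ∧ φ.Sat toMTTStructure (Function.update s 0 z)
  classComprehension : ∀ (φ : SetTheoreticFormula) (s : ℕ → V) (c : ℕ → Cls) (k : ℕ → Coll),
    ∃ X, ∀ z, memCls z X ↔ φ.Sat toMTTStructure c k (Function.update s 0 z)
  collComprehension : ∀ (φ : SetTheoreticFormula) (s : ℕ → V) (c : ℕ → Cls) (k : ℕ → Coll),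
    ∃ K, ∀ Z, memColl Z K ↔ φ.Sat toMTTStructure (Function.update c 0 Z) k s

namespace MTTModel

variable (M : MTTModel.{u, v, w})

/-- The members of a set of the model. -/
def elts (x : M.V) : Set M.V := {z | M.mem z x}

/-- The members of a class of the model. -/
def members (X : M.Cls) : Set M.V := {z | M.memCls z X}

/-- The unordered pair `{x, y}` in the model. -/
noncomputable def upair (x y : M.V) : M.V := Classical.choose (M.pairing x y)

theorem mem_upair (x y z : M.V) : M.mem z (M.upair x y) ↔ z = x ∨ z = y :=
  Classical.choose_spec (M.pairing x y) z

/-- The (Kuratowski) ordered pair `⟨x, y⟩ = {{x}, {x, y}}` in the model. -/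
noncomputable def opair (x y : M.V) : M.V := M.upair (M.upair x x) (M.upair x y)

theorem upair_inj_left {x y z : M.V} (h : M.upair x y = M.upair x z) : y = z := by
  have h1 : y = x ∨ y = z := (M.mem_upair x z y).1 (h ▸ (M.mem_upair x y y).2 (Or.inr rfl))
  have h2 : z = x ∨ z = y := (M.mem_upair x y z).1 (h ▸ (M.mem_upair x z z).2 (Or.inr rfl))
  grind

theorem opair_inj {x y x' y' : M.V} : M.opair x y = M.opair x' y' ↔ x = x' ∧ y = y' := by
  refine ⟨fun h => ?_, by rintro ⟨rfl, rfl⟩; rfl⟩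
  have hx : x = x' := by
    have h1 : M.mem (M.upair x x) (M.opair x' y') :=
      h ▸ (M.mem_upair _ _ _).2 (Or.inl rfl)
    have h2 : M.mem x' (M.upair x x) := by
      rcases (M.mem_upair _ _ _).1 h1 with h3 | h3 <;>
        exact h3 ▸ (M.mem_upair _ _ _).2 (Or.inl rfl)
    rcases (M.mem_upair _ _ _).1 h2 with h3 | h3 <;> exact h3.symm
  subst hx
  exact ⟨rfl, M.upair_inj_left (M.upair_inj_left h)⟩

variable {M} in
/-- `F` is (the graph of) a function from `A` to `B`. Applied to the members of sets or classes
of the model this is the notion of a function of sets, or of a class function. -/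
def IsFun (F A B : Set M.V) : Prop :=
  (∀ p ∈ F, ∃ a ∈ A, ∃ b ∈ B, p = M.opair a b) ∧ ∀ a ∈ A, ∃! b, M.opair a b ∈ F

/-! ## Categories in the model -/

/-- The category axioms for objects `Ob`, arrows `Ar`, graphs `Dom`, `Cod` of the domain and
codomain functions, and graph `Mul` of the composition `⟨g, f⟩ ↦ g ∘ f`, which is defined on the
composable pairs. -/
structure CatLaws (Ob Ar Dom Cod Mul : Set M.V) : Prop where
  dom : IsFun Dom Ar Ob
  cod : IsFun Cod Ar Ob
  mul : IsFun Mul {p | ∃ g ∈ Ar, ∃ f ∈ Ar, p = M.opair g f ∧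
    ∃ b, M.opair g b ∈ Dom ∧ M.opair f b ∈ Cod} Ar
  dom_mul : ∀ g f h a, M.opair (M.opair g f) h ∈ Mul → M.opair f a ∈ Dom → M.opair h a ∈ Dom
  cod_mul : ∀ g f h c, M.opair (M.opair g f) h ∈ Mul → M.opair g c ∈ Cod → M.opair h c ∈ Cod
  assoc : ∀ f g h gf hg k, M.opair (M.opair g f) gf ∈ Mul → M.opair (M.opair h g) hg ∈ Mul →
    M.opair (M.opair h gf) k ∈ Mul → M.opair (M.opair hg f) k ∈ Mul
  id : ∀ a ∈ Ob, ∃ i ∈ Ar, M.opair i a ∈ Dom ∧ M.opair i a ∈ Cod ∧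
    (∀ f, M.opair f a ∈ Cod → M.opair (M.opair i f) f ∈ Mul) ∧
    (∀ f, M.opair f a ∈ Dom → M.opair (M.opair f i) f ∈ Mul)

/-- A class category: five classes satisfying the category axioms. -/
structure ClassCat where
  ob : M.Cls
  ar : M.Cls
  dom : M.Cls
  cod : M.Cls
  mul : M.Cls
  laws : M.CatLaws (M.members ob) (M.members ar) (M.members dom) (M.members cod) (M.members mul)

/-- A small category: five sets satisfying the category axioms. -/
structure SmallCat where
  ob : M.V
  ar : M.V
  dom : M.V
  cod : M.V
  mul : M.V
  laws : M.CatLaws (M.elts ob) (M.elts ar) (M.elts dom) (M.elts cod) (M.elts mul)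

variable {M}

namespace ClassCat

/-- The objects of a class category, as a type. -/
def Obj (E : M.ClassCat) : Type u := {a : M.V // a ∈ M.members E.ob}

/-- The arrows from `X` to `Y` in a class category, as a type. -/
def Hom (E : M.ClassCat) (X Y : E.Obj) : Type u :=
  {f : M.V // M.opair f X.1 ∈ M.members E.dom ∧ M.opair f Y.1 ∈ M.members E.cod}

theorem mem_ar (E : M.ClassCat) {X Y : E.Obj} (f : E.Hom X Y) : f.1 ∈ M.members E.ar := by
  obtain ⟨a, ha, b, _, h⟩ := E.laws.dom.1 _ f.2.1
  rw [opair_inj] at h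
  exact h.1 ▸ ha

theorem exists_id (E : M.ClassCat) (X : E.Obj) : ∃ i : E.Hom X X,
    (∀ f, M.opair f X.1 ∈ M.members E.cod →
      M.opair (M.opair i.1 f) f ∈ M.members E.mul) ∧
    (∀ f, M.opair f X.1 ∈ M.members E.dom →
      M.opair (M.opair f i.1) f ∈ M.members E.mul) := by
  obtain ⟨i, _, h1, h2, h3, h4⟩ := E.laws.id X.1 X.2
  exact ⟨⟨i, h1, h2⟩, h3, h4⟩

theorem exists_comp (E : M.ClassCat) {X Y Z : E.Obj} (f : E.Hom X Y) (g : E.Hom Y Z) :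
    ∃ h : E.Hom X Z, M.opair (M.opair g.1 f.1) h.1 ∈ M.members E.mul := by
  obtain ⟨h, hh, _⟩ := E.laws.mul.2 (M.opair g.1 f.1)
    ⟨g.1, E.mem_ar g, f.1, E.mem_ar f, rfl, Y.1, g.2.1, f.2.2⟩
  exact ⟨⟨h, E.laws.dom_mul _ _ _ _ hh f.2.1, E.laws.cod_mul _ _ _ _ hh g.2.2⟩, hh⟩

theorem mul_unique (E : M.ClassCat) {g f h h' : M.V}
    (H : M.opair (M.opair g f) h ∈ M.members E.mul)
    (H' : M.opair (M.opair g f) h' ∈ M.members E.mul) : h = h' := by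
  obtain ⟨p, hp, b, _, e⟩ := E.laws.mul.1 _ H
  rw [opair_inj] at e
  exact (E.laws.mul.2 _ (e.1 ▸ hp)).unique H H'

/-- The identity arrow of an object. -/
noncomputable def idHom (E : M.ClassCat) (X : E.Obj) : E.Hom X X :=
  Classical.choose (E.exists_id X)

theorem idHom_spec (E : M.ClassCat) (X : E.Obj) :
    (∀ f, M.opair f X.1 ∈ M.members E.cod →
      M.opair (M.opair (E.idHom X).1 f) f ∈ M.members E.mul) ∧
    (∀ f, M.opair f X.1 ∈ M.members E.dom →
      M.opair (M.opair f (E.idHom X).1) f ∈ M.members E.mul) :=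
  Classical.choose_spec (E.exists_id X)

/-- The composite of `f` and `g`. -/
noncomputable def compHom (E : M.ClassCat) {X Y Z : E.Obj} (f : E.Hom X Y) (g : E.Hom Y Z) :
    E.Hom X Z :=
  Classical.choose (E.exists_comp f g)

theorem compHom_spec (E : M.ClassCat) {X Y Z : E.Obj} (f : E.Hom X Y) (g : E.Hom Y Z) :
    M.opair (M.opair g.1 f.1) (E.compHom f g).1 ∈ M.members E.mul :=
  Classical.choose_spec (E.exists_comp f g)

theorem compHom_eq (E : M.ClassCat) {X Y Z : E.Obj} {f : E.Hom X Y} {g : E.Hom Y Z}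
    {h : E.Hom X Z} (H : M.opair (M.opair g.1 f.1) h.1 ∈ M.members E.mul) :
    E.compHom f g = h :=
  Subtype.ext (E.mul_unique (E.compHom_spec f g) H)

/-- A class category as a category: its objects and arrows are the members of the classes of
objects and arrows, and `f ≫ g` is given by the composition class. -/
noncomputable instance (E : M.ClassCat) : Category.{u} E.Obj where
  Hom X Y := E.Hom X Y
  id X := E.idHom X
  comp f g := E.compHom f g
  id_comp {X _} f := E.compHom_eq ((E.idHom_spec X).2 _ f.2.1)
  comp_id {_ Y} f := E.compHom_eq ((E.idHom_spec Y).1 _ f.2.2)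
  assoc f g h := (E.compHom_eq (E.laws.assoc _ _ _ _ _ _ (E.compHom_spec f g)
    (E.compHom_spec g h) (E.compHom_spec (E.compHom f g) h))).symm

/-! ### Local smallness, coproducts, quotients, generators -/

/-- `D` is the full subcategory of `E` on the set of objects `x`. -/
structure IsFullSubcategory (E : M.ClassCat) (x : M.V) (D : M.SmallCat) : Prop where
  ob : D.ob = x
  ar : ∀ f, f ∈ M.elts D.ar ↔ ∃ X Y : E.Obj, X.1 ∈ M.elts x ∧ Y.1 ∈ M.elts x ∧
    M.opair f X.1 ∈ M.members E.dom ∧ M.opair f Y.1 ∈ M.members E.cod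
  dom : ∀ f a, f ∈ M.elts D.ar →
    (M.opair f a ∈ M.elts D.dom ↔ M.opair f a ∈ M.members E.dom)
  cod : ∀ f a, f ∈ M.elts D.ar →
    (M.opair f a ∈ M.elts D.cod ↔ M.opair f a ∈ M.members E.cod)
  mul : ∀ g f h, g ∈ M.elts D.ar → f ∈ M.elts D.ar →
    (M.opair (M.opair g f) h ∈ M.elts D.mul ↔ M.opair (M.opair g f) h ∈ M.members E.mul)

/-- A locally small category (`𝒰`-category): every set of objects has a set of all arrows between
them, that is, it spans a small full subcategory. -/
def IsLocallySmall (E : M.ClassCat) : Prop :=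
  ∀ x : M.V, (∀ a ∈ M.elts x, a ∈ M.members E.ob) → ∃ D : M.SmallCat, E.IsFullSubcategory x D

/-- The set `ι` is an `I`-indexed cocone with vertex `S` on the `I`-indexed family `A` of objects:
a function sending each `i` in `I` to an arrow `A i ⟶ S`. -/
def IsCocone (E : M.ClassCat) (I A ι : M.V) (S : E.Obj) : Prop :=
  IsFun (M.elts ι) (M.elts I) (M.members E.ar) ∧
  ∀ i f, M.opair i f ∈ M.elts ι → M.opair f S.1 ∈ M.members E.cod ∧
    ∃ a, M.opair i a ∈ M.elts A ∧ M.opair f a ∈ M.members E.dom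

/-- `S` with injections `ι` is a coproduct of the set-indexed family `A` of objects. -/
def IsCoproduct (E : M.ClassCat) (I A ι : M.V) (S : E.Obj) : Prop :=
  E.IsCocone I A ι S ∧
  ∀ (Z : E.Obj) (τ : M.V), E.IsCocone I A τ Z → ∃! h : S ⟶ Z,
    ∀ (i : M.V) (X : E.Obj) (a : X ⟶ S) (b : X ⟶ Z),
      M.opair i a.1 ∈ M.elts ι → M.opair i b.1 ∈ M.elts τ → a ≫ h = b

/-- Each set-indexed family of objects has a coproduct, and coproducts are stable disjoint unions:
the injections are monic, the pullback of two distinct injections is initial, and for each arrow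
`f` into the coproduct, the domain of `f` is a coproduct of a set-indexed family of pullbacks of
the injections along `f`. -/
structure HasStableDisjointCoproducts (E : M.ClassCat) : Prop where
  exists_coproduct : ∀ I A : M.V, IsFun (M.elts A) (M.elts I) (M.members E.ob) →
    ∃ (ι : M.V) (S : E.Obj), E.IsCoproduct I A ι S
  mono : ∀ (I A ι : M.V) (S : E.Obj), IsFun (M.elts A) (M.elts I) (M.members E.ob) →
    E.IsCoproduct I A ι S →
    ∀ (i : M.V) (X : E.Obj) (a : X ⟶ S), M.opair i a.1 ∈ M.elts ι → Mono a
  disjoint : ∀ (I A ι : M.V) (S : E.Obj), IsFun (M.elts A) (M.elts I) (M.members E.ob) →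
    E.IsCoproduct I A ι S →
    ∀ (i j : M.V) (X Y P : E.Obj) (a : X ⟶ S) (b : Y ⟶ S) (p : P ⟶ X) (q : P ⟶ Y), i ≠ j →
      M.opair i a.1 ∈ M.elts ι → M.opair j b.1 ∈ M.elts ι → IsPullback p q a b →
      Nonempty (IsInitial P)
  stable : ∀ (I A ι : M.V) (S : E.Obj), IsFun (M.elts A) (M.elts I) (M.members E.ob) →
    E.IsCoproduct I A ι S → ∀ (Y : E.Obj) (f : Y ⟶ S), ∃ B π : M.V,
      IsFun (M.elts B) (M.elts I) (M.members E.ob) ∧ E.IsCoproduct I B π Y ∧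
      ∀ (i : M.V) (X P : E.Obj) (a : X ⟶ S) (p : P ⟶ Y),
        M.opair i a.1 ∈ M.elts ι → M.opair i p.1 ∈ M.elts π → ∃ q : P ⟶ X, IsPullback p q f a

/-- Every equivalence relation `p₁, p₂ : R ⟶ A` has a stable quotient: there is `π : A ⟶ B` which
is the coequalizer of `p₁, p₂` and whose kernel pair is `p₁, p₂`, and every pullback of `π` is an
effective epimorphism, i.e. the quotient of its kernel pair. -/
def HasStableQuotients (E : M.ClassCat) : Prop :=
  ∀ (R A : E.Obj) (p₁ p₂ : R ⟶ A), IsEquivalenceRelation p₁ p₂ →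
    IsUniversallyEffectiveEquivalenceRelation p₁ p₂

/-- There is a set of objects which separates parallel arrows. -/
def HasSetOfGenerators (E : M.ClassCat) : Prop :=
  ∃ G : M.V, (∀ a ∈ M.elts G, a ∈ M.members E.ob) ∧
    ∀ (X Y : E.Obj) (u v : X ⟶ Y),
      (∀ (D : E.Obj) (h : D ⟶ X), D.1 ∈ M.elts G → h ≫ u = h ≫ v) → u = v

end ClassCat

/-! ## Functors and equivalences of class categories -/

/-- A functor of class categories: a class function on objects and a class function on arrows
which preserve domains, codomains, identities and composition. -/
structure ClassFunctor (E S : M.ClassCat) where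
  onOb : M.Cls
  onAr : M.Cls
  isFun_ob : IsFun (M.members onOb) (M.members E.ob) (M.members S.ob)
  isFun_ar : IsFun (M.members onAr) (M.members E.ar) (M.members S.ar)
  dom : ∀ f f' a a', M.opair f f' ∈ M.members onAr → M.opair a a' ∈ M.members onOb →
    M.opair f a ∈ M.members E.dom → M.opair f' a' ∈ M.members S.dom
  cod : ∀ f f' a a', M.opair f f' ∈ M.members onAr → M.opair a a' ∈ M.members onOb →
    M.opair f a ∈ M.members E.cod → M.opair f' a' ∈ M.members S.cod
  map_id : ∀ (X : E.Obj) (Y : S.Obj), M.opair X.1 Y.1 ∈ M.members onOb →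
    M.opair (E.idHom X).1 (S.idHom Y).1 ∈ M.members onAr
  map_mul : ∀ g f h g' f' h', M.opair g g' ∈ M.members onAr → M.opair f f' ∈ M.members onAr →
    M.opair h h' ∈ M.members onAr → M.opair (M.opair g f) h ∈ M.members E.mul →
    M.opair (M.opair g' f') h' ∈ M.members S.mul

namespace ClassFunctor

variable {E S : M.ClassCat}

theorem exists_obj (F : ClassFunctor E S) (X : E.Obj) :
    ∃ Y : S.Obj, M.opair X.1 Y.1 ∈ M.members F.onOb := by
  obtain ⟨b, hb, _⟩ := F.isFun_ob.2 X.1 X.2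
  obtain ⟨a', _, b', hb', e⟩ := F.isFun_ob.1 _ hb
  rw [opair_inj] at e
  exact ⟨⟨b, e.2 ▸ hb'⟩, hb⟩

/-- The action of a class functor on objects. -/
noncomputable def obj (F : ClassFunctor E S) (X : E.Obj) : S.Obj :=
  Classical.choose (F.exists_obj X)

theorem obj_spec (F : ClassFunctor E S) (X : E.Obj) :
    M.opair X.1 (F.obj X).1 ∈ M.members F.onOb :=
  Classical.choose_spec (F.exists_obj X)

theorem exists_map (F : ClassFunctor E S) {X Y : E.Obj} (f : E.Hom X Y) :
    ∃ g : S.Hom (F.obj X) (F.obj Y), M.opair f.1 g.1 ∈ M.members F.onAr := by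
  obtain ⟨g, hg, _⟩ := F.isFun_ar.2 f.1 (E.mem_ar f)
  exact ⟨⟨g, F.dom _ _ _ _ hg (F.obj_spec X) f.2.1, F.cod _ _ _ _ hg (F.obj_spec Y) f.2.2⟩, hg⟩

/-- The action of a class functor on arrows. -/
noncomputable def map (F : ClassFunctor E S) {X Y : E.Obj} (f : E.Hom X Y) :
    S.Hom (F.obj X) (F.obj Y) :=
  Classical.choose (F.exists_map f)

theorem map_spec (F : ClassFunctor E S) {X Y : E.Obj} (f : E.Hom X Y) :
    M.opair f.1 (F.map f).1 ∈ M.members F.onAr :=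
  Classical.choose_spec (F.exists_map f)

/-- A class functor as a functor. -/
noncomputable def toFunctor (F : ClassFunctor E S) : E.Obj ⥤ S.Obj where
  obj X := F.obj X
  map {X Y} f := F.map (X := X) (Y := Y) f
  map_id X := Subtype.ext ((F.isFun_ar.2 _ (E.mem_ar (E.idHom X))).unique
    (F.map_spec (E.idHom X)) (F.map_id X _ (F.obj_spec X)))
  map_comp {_ _ _} f g := (S.compHom_eq (F.map_mul _ _ _ _ _ _ (F.map_spec g) (F.map_spec f)
    (F.map_spec (E.compHom f g)) (E.compHom_spec f g))).symm

end ClassFunctor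

/-- `E` is equivalent to `S`: there is a fully faithful and essentially surjective class functor
from `E` to `S`. (`Functor.IsEquivalence` means fully faithful and essentially surjective.) -/
def ClassCat.IsEquivalentTo (E S : M.ClassCat) : Prop :=
  ∃ F : ClassFunctor E S, F.toFunctor.IsEquivalence

/-! ## Sheaves on small sites -/

/-- `η` is a natural transformation of presheaves `⟨F, ⟨γ, e⟩⟩ → ⟨F', ⟨γ', e'⟩⟩`: a function over
`C₀` commuting with the actions. -/
def IsTransform (X Y η : M.V) : Prop :=
  ∃ F γ e F' γ' e', X = M.opair F (M.opair γ e) ∧ Y = M.opair F' (M.opair γ' e') ∧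
    IsFun (M.elts η) (M.elts F) (M.elts F') ∧
    (∀ s t A, M.opair s t ∈ M.elts η → M.opair s A ∈ M.elts γ → M.opair t A ∈ M.elts γ') ∧
    ∀ s t f r q, M.opair s t ∈ M.elts η → M.opair (M.opair s f) r ∈ M.elts e →
      M.opair r q ∈ M.elts η → M.opair (M.opair t f) q ∈ M.elts e'

namespace SmallCat

variable (C : M.SmallCat)

/-- The set `R` of arrows is a sieve on the object `A`. -/
def IsSieve (A R : M.V) : Prop :=
  (∀ f ∈ M.elts R, M.opair f A ∈ M.elts C.cod) ∧
  ∀ f g h, f ∈ M.elts R → M.opair (M.opair f g) h ∈ M.elts C.mul → h ∈ M.elts R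

/-- `T` is the pullback `{h | g ∘ h ∈ R}` of the sieve `R` along the arrow `g`. -/
def IsPullbackSieve (g R T : M.V) : Prop :=
  ∀ h, h ∈ M.elts T ↔ ∃ k ∈ M.elts R, M.opair (M.opair g h) k ∈ M.elts C.mul

/-- The set `J` is a Grothendieck topology on `C`: a set of pairs `⟨A, R⟩` with `R` a (covering)
sieve on the object `A`, satisfying the maximality, stability and transitivity axioms. -/
structure IsTopology (J : M.V) : Prop where
  isSieve : ∀ p ∈ M.elts J, ∃ A R, p = M.opair A R ∧ A ∈ M.elts C.ob ∧ C.IsSieve A R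
  maximal : ∀ A R, A ∈ M.elts C.ob → (∀ f, f ∈ M.elts R ↔ M.opair f A ∈ M.elts C.cod) →
    M.opair A R ∈ M.elts J
  stable : ∀ A B R T g, M.opair A R ∈ M.elts J → M.opair g A ∈ M.elts C.cod →
    M.opair g B ∈ M.elts C.dom → C.IsPullbackSieve g R T → M.opair B T ∈ M.elts J
  transitive : ∀ A R R', M.opair A R ∈ M.elts J → C.IsSieve A R' →
    (∀ f ∈ M.elts R, ∃ B T, M.opair f B ∈ M.elts C.dom ∧ C.IsPullbackSieve f R' T ∧
      M.opair B T ∈ M.elts J) → M.opair A R' ∈ M.elts J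

/-- A presheaf on `C`, as a `C₀`-indexed set of sets `γ : F → C₀` (with value `{s ∈ F | γ s = A}` at
`A`) and an action `e`, a function sending `⟨s, f⟩` with `γ s` the codomain of `f` to the
restriction `s · f` in `F`. -/
structure PresheafLaws (F γ e : M.V) : Prop where
  isFun_proj : IsFun (M.elts γ) (M.elts F) (M.elts C.ob)
  isFun_act : IsFun (M.elts e) {p | ∃ s ∈ M.elts F, ∃ f ∈ M.elts C.ar, p = M.opair s f ∧
    ∃ A, M.opair s A ∈ M.elts γ ∧ M.opair f A ∈ M.elts C.cod} (M.elts F)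
  proj_act : ∀ s g t B, M.opair (M.opair s g) t ∈ M.elts e → M.opair g B ∈ M.elts C.dom →
    M.opair t B ∈ M.elts γ
  act_mul : ∀ s g h gh t r, M.opair (M.opair g h) gh ∈ M.elts C.mul →
    M.opair (M.opair s g) t ∈ M.elts e → M.opair (M.opair t h) r ∈ M.elts e →
    M.opair (M.opair s gh) r ∈ M.elts e
  act_id : ∀ s A i, M.opair s A ∈ M.elts γ → M.opair i A ∈ M.elts C.dom →
    (∀ f, M.opair f A ∈ M.elts C.cod → M.opair (M.opair i f) f ∈ M.elts C.mul) →
    M.opair (M.opair s i) s ∈ M.elts e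

/-- The set `x` is a matching family for the sieve `R` in the presheaf `(F, γ, e)`: a function
on `R` with `x f` in the value of the presheaf at the domain of `f`, and
`x (f ∘ g) = (x f) · g`. -/
def IsMatchingFamily (F γ e R x : M.V) : Prop :=
  IsFun (M.elts x) (M.elts R) (M.elts F) ∧
  (∀ f s B, M.opair f s ∈ M.elts x → M.opair f B ∈ M.elts C.dom → M.opair s B ∈ M.elts γ) ∧
  ∀ f g h s t, M.opair (M.opair f g) h ∈ M.elts C.mul → M.opair f s ∈ M.elts x →
    M.opair h t ∈ M.elts x → M.opair (M.opair s g) t ∈ M.elts e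

/-- `X` is a sheaf for `J`: it is a presheaf `⟨F, ⟨γ, e⟩⟩` in which every matching family for a
covering sieve has exactly one amalgamation. -/
def IsSheaf (J X : M.V) : Prop :=
  ∃ F γ e, X = M.opair F (M.opair γ e) ∧ C.PresheafLaws F γ e ∧
    ∀ A R x, M.opair A R ∈ M.elts J → C.IsMatchingFamily F γ e R x →
      ∃! s, M.opair s A ∈ M.elts γ ∧
        ∀ f t, M.opair f t ∈ M.elts x → M.opair (M.opair s f) t ∈ M.elts e

/-- `S` is the class category of sheaves on the site `(C, J)`: its objects are the sheaves, its
arrows `X → Y` are the triples `⟨⟨X, Y⟩, η⟩` with `η` a natural transformation, and composition is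
composition of functions. -/
structure IsSheafCategory (J : M.V) (S : M.ClassCat) : Prop where
  ob : ∀ X, X ∈ M.members S.ob ↔ C.IsSheaf J X
  ar : ∀ t, t ∈ M.members S.ar ↔ ∃ X Y η, t = M.opair (M.opair X Y) η ∧
    C.IsSheaf J X ∧ C.IsSheaf J Y ∧ IsTransform X Y η
  dom : ∀ X Y η, M.opair (M.opair X Y) η ∈ M.members S.ar →
    M.opair (M.opair (M.opair X Y) η) X ∈ M.members S.dom
  cod : ∀ X Y η, M.opair (M.opair X Y) η ∈ M.members S.ar →
    M.opair (M.opair (M.opair X Y) η) Y ∈ M.members S.cod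
  mul : ∀ X Y Z η θ ζ, M.opair (M.opair (M.opair (M.opair Y Z) θ) (M.opair (M.opair X Y) η))
    (M.opair (M.opair X Z) ζ) ∈ M.members S.mul →
    ∀ s t r, M.opair s t ∈ M.elts η → M.opair t r ∈ M.elts θ → M.opair s r ∈ M.elts ζ

end SmallCat

/-- A Grothendieck topos: a class category equivalent to the class category of sheaves on some
small site. -/
def ClassCat.IsGrothendieckTopos (E : M.ClassCat) : Prop :=
  ∃ (C : M.SmallCat) (J : M.V) (S : M.ClassCat),
    C.IsTopology J ∧ C.IsSheafCategory J S ∧ E.IsEquivalentTo S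

end MTTModel

/-! The category is recovered from its generators. Let `C` be the small full subcategory on the set
`G` of generators and `J` the set of sieves that are jointly epimorphic in `E`. An object `X` yields
the sheaf of arrows from generators to `X`, and postcomposition makes this a class functor
(`yoneda`). Faithfulness is what generation means. Fullness holds because a natural transformation
assigns compatible arrows to the covering family of all arrows from generators to `X`, and such data
glue (`existsUnique_glue`). For essential surjectivity a sheaf `F` is realized by gluing: take the
coproduct `S` of the objects on which its sections live, one copy for each section, and divide by
the relation that identifies points with a common restriction (`exists_relation`, `exists_gluing`).
Sending a section to its injection followed by `S ⟶ X` is then a bijection onto the arrows from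
generators to `X` (`exists_isIso`): injective because `F` is separated, surjective because such
arrows lift locally to `S` and the resulting sections of `F` match.

These arguments need every epimorphism, and not only a given quotient map, to be effective and
stable under pullback. A monic epimorphism `B ⟶ X` is an isomorphism, as one sees on the amalgamated
sum of two copies of `X` over `B` (`isIso_of_mono_epi`); with image factorizations it follows that
every epimorphism is universally effective (`uEpi_of_epi`).

What is special to Mac Lane type theory is the existence of sets. There is no replacement, and
separation admits only bounded formulas with set parameters. Local smallness provides the
parameters: statements about arrows between a set of objects become statements about the five sets
of a small full subcategory (`IsLocallySmall.exists_span`). The topology is the hard case, because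
being jointly epimorphic quantifies over all objects of `E`. In `exists_topology` all families are
tested at once: with `Q` the coproduct of one copy of `X` for each pair of a generator `X` and a set
`R` of arrows of `C` into `X`, and `B` the image in `Q` of the coproduct of all the domains, `R`
covers `X` exactly when the injection of that copy factors through `B`, which is a bounded
condition. That predicates are given by formulas is left to instance search (`Var`, `Term`,
`Definable`). -/

namespace MTTModel

variable {M : MTTModel.{u, v, w}}

/-! ## Definability -/

/-- A class of predicates of assignments closed under the connectives and bounded quantifiers. -/
structure Fragment (M : MTTModel.{u, v, w}) where
  carrier : Set ((ℕ → M.V) → Prop)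
  eq : ∀ i j, (fun s => s i = s j) ∈ carrier
  falsum : (fun _ => False) ∈ carrier
  imp : ∀ φ ∈ carrier, ∀ ψ ∈ carrier, (fun s => φ s → ψ s) ∈ carrier
  ball : ∀ i j, ∀ φ ∈ carrier, i ≠ j →
    (fun s => ∀ x, M.mem x (s j) → φ (Function.update s i x)) ∈ carrier

/-- The predicates given by bounded formulas. -/
def bounded (M : MTTModel.{u, v, w}) : Fragment M where
  carrier := Set.range (BoundedSetFormula.Sat M.toMTTStructure)
  eq i j := ⟨.eq i j, rfl⟩
  falsum := ⟨.falsum, rfl⟩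
  imp := by rintro _ ⟨φ, rfl⟩ _ ⟨ψ, rfl⟩; exact ⟨.imp φ ψ, rfl⟩
  ball := by rintro i j _ ⟨φ, rfl⟩ _; exact ⟨.ball i j φ, rfl⟩

/-- The predicates given by set theoretic formulas with class parameters `c`. -/
def setTheoretic (M : MTTModel.{u, v, w}) (c : ℕ → M.Cls) : Fragment M where
  carrier := Set.range (SetTheoreticFormula.Sat M.toMTTStructure c
    fun _ => Classical.choice M.nonempty_Coll)
  eq i j := ⟨.eq i j, rfl⟩
  falsum := ⟨.falsum, rfl⟩
  imp := by rintro _ ⟨φ, rfl⟩ _ ⟨ψ, rfl⟩; exact ⟨.imp φ ψ, rfl⟩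
  ball := by
    rintro i j _ ⟨φ, rfl⟩ h
    refine ⟨.all i (.imp (.mem i j) φ), ?_⟩
    funext s
    simp [SetTheoreticFormula.Sat, Function.update_of_ne h.symm]

/-- Contexts: the type `M.V` of one free variable, and its extensions by further variables. -/
class Context (M : MTTModel.{u, v, w}) (Γ : Type u) where
  depth : ℕ
  /-- The assignment given by a list of parameters and values of the variables. -/
  env : List M.V → Γ → ℕ → M.V

/-- The empty set. -/
noncomputable def empty (M : MTTModel.{u, v, w}) : M.V := Classical.choose M.emptySet

noncomputable instance : Context M M.V where
  depth := 0
  -- Slot 0 is the variable abstracted by separation and comprehension. The parameters fill the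
  -- slots 1, …, `L.length`, hence the shift `i - 1`; `M.empty` only fills the slots beyond the
  -- list.
  env L z := Function.update (fun i => L.getD (i - 1) M.empty) 0 z

noncomputable instance {Γ : Type u} [Context M Γ] : Context M (Γ × M.V) where
  depth := Context.depth M Γ + 1
  -- A new variable takes the first slot past the parameters and the variables already in the
  -- context.
  env L p := Function.update (Context.env L p.1) (L.length + 1 + Context.depth M Γ) p.2

/-- `f` is a variable or a parameter. -/
class Var {Γ : Type u} [Context M Γ] (f : Γ → M.V) : Prop where
  out : ∃ L : List M.V, ∀ L', L ⊆ L' → ∃ i < L'.length + 1 + Context.depth M Γ,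
    ∀ g, Context.env L' g i = f g

/-- `h` is the projection of an extension of a context. -/
class Extension (M : MTTModel.{u, v, w}) {Γ Δ : Type u} [Context M Γ] [Context M Δ]
    (h : Δ → Γ) : Prop where
  out : ∀ L : List M.V, ∀ i < L.length + 1 + Context.depth M Γ,
    i < L.length + 1 + Context.depth M Δ ∧ ∀ d, Context.env L d i = Context.env L (h d) i

/-- `P` is defined by a formula of the fragment `K`, with set parameters. -/
class Definable (K : Fragment M) {Γ : Type u} [Context M Γ] (P : Γ → Prop) : Prop where
  out : ∃ L : List M.V, ∀ L', L ⊆ L' → ∃ φ ∈ K.carrier, ∀ g, φ (Context.env L' g) ↔ P g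

/-- `t` is a term whose graph is definable in all extensions of the context. -/
class Term (K : Fragment M) {Γ : Type u} [Context M Γ] (t : Γ → M.V) : Prop where
  out : ∀ {Δ : Type u} [Context M Δ] (h : Δ → Γ) [Extension M h] (x : Δ → M.V) [Var x],
    Definable K (fun d => x d = t (h d))

section Instances

variable {Γ Δ : Type u} [Context M Γ] [Context M Δ] {K : Fragment M}

instance : Extension M (fun g : Γ => g) := ⟨fun _ _ hi => ⟨hi, fun _ => rfl⟩⟩

instance (h : Δ → Γ × M.V) [hh : Extension M h] : Extension M (fun d => (h d).1) := by
  refine ⟨fun L i hi => ?_⟩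
  obtain ⟨h1, h2⟩ := hh.out L i (by simp only [Context.depth]; omega)
  refine ⟨h1, fun d => (h2 d).trans ?_⟩
  exact Function.update_of_ne (by omega) _ _

instance (h : Γ → Δ × M.V) [hh : Extension M h] : Var (fun d => (h d).2) := by
  refine ⟨[], fun L _ => ?_⟩
  obtain ⟨h1, h2⟩ := hh.out L (L.length + 1 + Context.depth M Δ)
    (by simp only [Context.depth]; omega)
  exact ⟨_, h1, fun d => (h2 d).trans (Function.update_self ..)⟩

instance (h : Γ → M.V) [hh : Extension M h] : Var h := by
  refine ⟨[], fun L _ => ?_⟩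
  obtain ⟨h1, h2⟩ := hh.out L 0 (by omega)
  exact ⟨_, h1, fun d => (h2 d).trans (Function.update_self ..)⟩

theorem Extension.env_le (i : ℕ) (L : List M.V) (hi : i < L.length) :
    i + 1 < L.length + 1 + Context.depth M M.V ∧
    ∀ g : M.V, Context.env L g (i + 1) = L[i] := by
  refine ⟨by omega, fun g => ?_⟩
  simp [Context.env, hi]

theorem Var.comp {f : Γ → M.V} (hf : Var f) (h : Δ → Γ) [hh : Extension M h] :
    Var (fun d => f (h d)) := by
  obtain ⟨L, hL⟩ := hf.out
  refine ⟨L, fun L' hL' => ?_⟩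
  obtain ⟨i, hi, hi'⟩ := hL L' hL'
  obtain ⟨h1, h2⟩ := hh.out L' i hi
  exact ⟨i, h1, fun d => (h2 d).trans (hi' _)⟩

theorem Extension.comp {Θ : Type u} [Context M Θ] {h : Δ → Γ} (hh : Extension M h) {k : Θ → Δ}
    (hk : Extension M k) : Extension M (fun d => h (k d)) := by
  refine ⟨fun L i hi => ?_⟩
  obtain ⟨h1, h2⟩ := hh.out L i hi
  obtain ⟨h3, h4⟩ := hk.out L i h1
  exact ⟨h3, fun d => (h4 d).trans (h2 _)⟩

/-- Contexts which extend the one-variable context. -/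
class Rooted (M : MTTModel.{u, v, w}) (Γ : Type u) [Context M Γ] : Prop where
  out : ∃ h : Γ → M.V, Extension M h

instance : Rooted M M.V := ⟨fun g => g, inferInstance⟩

instance [hΓ : Rooted M Γ] : Rooted M (Γ × M.V) := by
  obtain ⟨h, hh⟩ := hΓ.out
  exact ⟨fun p => h p.1, hh.comp inferInstance⟩

/-- Constants are handled as parameters: the list only has to contain `a`. `Rooted` reduces an
arbitrary context to the one-variable context. -/
instance (priority := 2000) [hΓ : Rooted M Γ] (a : M.V) : Var (fun _ : Γ => a) := by
  obtain ⟨h, hh⟩ := hΓ.out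
  suffices Var (fun _ : M.V => a) from this.comp h
  refine ⟨[a], fun L hL => ?_⟩
  obtain ⟨i, hi, rfl⟩ := List.mem_iff_getElem.1 (hL (List.mem_singleton_self a))
  exact ⟨i + 1, Extension.env_le i L hi⟩

theorem Definable.congr {P Q : Γ → Prop} (hP : Definable K P) (h : ∀ g, Q g ↔ P g) :
    Definable K Q := by
  rwa [show Q = P from funext fun g => propext (h g)]

/-- The two sides may need different parameters, and the lists are concatenated. This is why `Var`
and `Definable` speak of all lists that contain a given one. -/
instance (f g : Γ → M.V) [hf : Var f] [hg : Var g] : Definable K (fun s => f s = g s) := by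
  obtain ⟨L₁, h₁⟩ := hf.out
  obtain ⟨L₂, h₂⟩ := hg.out
  refine ⟨L₁ ++ L₂, fun L hL => ?_⟩
  obtain ⟨i, _, hi⟩ := h₁ L (List.append_subset.1 hL).1
  obtain ⟨j, _, hj⟩ := h₂ L (List.append_subset.1 hL).2
  exact ⟨_, K.eq i j, fun s => by simp only [hi, hj]⟩

instance Definable.imp (P Q : Γ → Prop) [hP : Definable K P] [hQ : Definable K Q] :
    Definable K (fun s => P s → Q s) := by
  obtain ⟨L₁, h₁⟩ := hP.out
  obtain ⟨L₂, h₂⟩ := hQ.out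
  refine ⟨L₁ ++ L₂, fun L hL => ?_⟩
  obtain ⟨φ, hφ, hφ'⟩ := h₁ L (List.append_subset.1 hL).1
  obtain ⟨ψ, hψ, hψ'⟩ := h₂ L (List.append_subset.1 hL).2
  exact ⟨_, K.imp φ hφ ψ hψ, fun s => by simp only [hφ', hψ']⟩

instance Definable.const (p : Prop) : Definable K (fun _ : Γ => p) := by
  refine ⟨[], fun L _ => ?_⟩
  by_cases hp : p
  · exact ⟨_, K.imp _ K.falsum _ K.falsum, fun s => by simp [hp]⟩
  · exact ⟨_, K.falsum, fun s => by simp [hp]⟩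

instance Definable.not (P : Γ → Prop) [Definable K P] : Definable K (fun s => ¬ P s) :=
  inferInstanceAs (Definable K fun s => P s → False)

instance Definable.and (P Q : Γ → Prop) [Definable K P] [Definable K Q] :
    Definable K (fun s => P s ∧ Q s) :=
  (inferInstance : Definable K fun s => ¬ (P s → ¬ Q s)).congr fun _ => by simp

instance Definable.or (P Q : Γ → Prop) [Definable K P] [Definable K Q] :
    Definable K (fun s => P s ∨ Q s) :=
  (inferInstance : Definable K fun s => ¬ P s → Q s).congr fun _ => or_iff_not_imp_left

instance Definable.iff (P Q : Γ → Prop) [Definable K P] [Definable K Q] :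
    Definable K (fun s => P s ↔ Q s) :=
  (inferInstance : Definable K fun s => (P s → Q s) ∧ (Q s → P s)).congr fun _ =>
    iff_iff_implies_and_implies

/-- The quantified variable gets the first unused slot. The upper bound on indices in `Var` makes it
different from the slot of the bounding set, as `Fragment.ball` requires. -/
instance Definable.ball (b : Γ → M.V) [hb : Var b] (P : Γ → M.V → Prop)
    [hP : Definable K (fun p : Γ × M.V => P p.1 p.2)] :
    Definable K (fun g => ∀ x ∈ M.elts (b g), P g x) := by
  obtain ⟨L₁, h₁⟩ := hb.out
  obtain ⟨L₂, h₂⟩ := hP.out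
  refine ⟨L₁ ++ L₂, fun L hL => ?_⟩
  obtain ⟨j, hj, hj'⟩ := h₁ L (List.append_subset.1 hL).1
  obtain ⟨φ, hφ, hφ'⟩ := h₂ L (List.append_subset.1 hL).2
  refine ⟨_, K.ball (L.length + 1 + Context.depth M Γ) j φ hφ hj.ne', fun g => ?_⟩
  rw [hj']
  exact forall₂_congr fun x _ => hφ' (g, x)

instance Definable.bex (b : Γ → M.V) [Var b] (P : Γ → M.V → Prop)
    [Definable K (fun p : Γ × M.V => P p.1 p.2)] :
    Definable K (fun g => ∃ x ∈ M.elts (b g), P g x) :=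
  (inferInstance : Definable K fun g => ¬ ∀ x ∈ M.elts (b g), ¬ P g x).congr fun _ => by
    push Not; rfl

instance Term.of_var (f : Γ → M.V) [hf : Var f] : Term K f :=
  ⟨fun h _ _ _ => have := hf.comp h; inferInstance⟩

instance Definable.var_eq_term (f t : Γ → M.V) [Var f] [ht : Term K t] :
    Definable K (fun g => f g = t g) :=
  ht.out (fun g => g) f

instance Definable.term_eq_var (f t : Γ → M.V) [Var f] [ht : Term K t] :
    Definable K (fun g => t g = f g) :=
  (ht.out (fun g => g) f).congr fun _ => eq_comm

instance Definable.term_mem (t b : Γ → M.V) [ht : Term K t] [Var b] :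
    Definable K (fun g => t g ∈ M.elts (b g)) :=
  have : Definable K (fun p : Γ × M.V => p.2 = t p.1) := ht.out (fun p : Γ × M.V => p.1) (fun p => p.2)
  (inferInstance : Definable K fun g => ∃ z ∈ M.elts (b g), z = t g).congr fun _ => by simp

theorem eq_of_elts {x y : M.V} (h : ∀ z, z ∈ M.elts x ↔ z ∈ M.elts y) : x = y :=
  M.extensionality x y h

theorem mem_elts_upair {x y z : M.V} : z ∈ M.elts (M.upair x y) ↔ z = x ∨ z = y :=
  M.mem_upair x y z

/-- A bounded form of the Kuratowski pair: `u` is the singleton, `v` the unordered pair, and each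
quantifier is bounded by `z`, `u` or `v`. The components `a` and `b` occur only in the atoms `x = a`
and `y = b`, so that they may be replaced by terms. -/
theorem eq_opair_iff {z a b : M.V} : z = M.opair a b ↔
    ∃ u ∈ M.elts z, ∃ v ∈ M.elts z, ∃ x ∈ M.elts u, ∃ y ∈ M.elts v, x = a ∧ y = b ∧
      x ∈ M.elts v ∧ (∀ t ∈ M.elts u, t = x) ∧ (∀ t ∈ M.elts v, t = x ∨ t = y) ∧
      ∀ t ∈ M.elts z, t = u ∨ t = v := by
  constructor
  · rintro rfl
    refine ⟨_, mem_elts_upair.2 (.inl rfl), _, mem_elts_upair.2 (.inr rfl), _,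
      mem_elts_upair.2 (.inl rfl), _, mem_elts_upair.2 (.inr rfl), rfl, rfl,
      mem_elts_upair.2 (.inl rfl), ?_, ?_, ?_⟩
    · intro t ht; simpa using mem_elts_upair.1 ht
    · intro t ht; exact mem_elts_upair.1 ht
    · intro t ht; exact mem_elts_upair.1 ht
  · rintro ⟨u, hu, v, hv, x, hx, y, hy, rfl, rfl, hxv, h1, h2, h3⟩
    have hu' : u = M.upair x x := eq_of_elts fun t => by
      rw [mem_elts_upair, or_self]; exact ⟨h1 t, fun h => h ▸ hx⟩
    have hv' : v = M.upair x y := eq_of_elts fun t => by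
      rw [mem_elts_upair]; exact ⟨h2 t, by rintro (rfl | rfl) <;> assumption⟩
    refine eq_of_elts fun t => ?_
    rw [opair, mem_elts_upair, ← hu', ← hv']
    exact ⟨h3 t, by rintro (rfl | rfl) <;> assumption⟩

-- The formula of `eq_opair_iff` mentions `a` and `b` below four quantifiers, that is, in a context
-- with four more variables. Definability of the graph of a subterm is therefore needed in
-- extensions of the context, which is what `Term` provides.
set_option synthInstance.maxSize 2000 in
instance Term.opair (a b : Γ → M.V) [ha : Term K a] [hb : Term K b] :
    Term K (fun g => M.opair (a g) (b g)) := by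
  refine ⟨fun {Δ} _ h _ z hz => ?_⟩
  have := hz.comp (fun p : Δ × M.V => p.1)
  have := hz.comp (fun p : (Δ × M.V) × M.V => p.1.1)
  have := hz.comp (fun p : ((Δ × M.V) × M.V) × M.V => p.1.1.1)
  have := hz.comp (fun p : (((Δ × M.V) × M.V) × M.V) × M.V => p.1.1.1.1)
  have hh : Extension M (fun p : (((Δ × M.V) × M.V) × M.V) × M.V => h p.1.1.1.1) :=
    Extension.comp (k := fun p : (((Δ × M.V) × M.V) × M.V) × M.V => p.1.1.1.1) ‹_› inferInstance
  have := ha.out (fun p : (((Δ × M.V) × M.V) × M.V) × M.V => h p.1.1.1.1) (fun p => p.1.2)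
  have := hb.out (fun p : (((Δ × M.V) × M.V) × M.V) × M.V => h p.1.1.1.1) (fun p => p.2)
  refine Definable.congr ?_ fun d => eq_opair_iff
  infer_instance

end Instances

/-! ### Unbounded set quantifiers and class parameters -/

section SetTheoretic

variable {Γ Δ : Type u} [Context M Γ] [Context M Δ] {c : ℕ → M.Cls}

instance Definable.all (P : Γ → M.V → Prop)
    [hP : Definable (M.setTheoretic c) (fun p : Γ × M.V => P p.1 p.2)] :
    Definable (M.setTheoretic c) (fun g => ∀ x, P g x) := by
  obtain ⟨L, h⟩ := hP.out
  refine ⟨L, fun L' hL => ?_⟩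
  obtain ⟨_, ⟨φ, rfl⟩, hφ⟩ := h L' hL
  exact ⟨_, ⟨.all (L'.length + 1 + Context.depth M Γ) φ, rfl⟩,
    fun g => forall_congr' fun x => hφ (g, x)⟩

instance Definable.ex (P : Γ → M.V → Prop)
    [Definable (M.setTheoretic c) (fun p : Γ × M.V => P p.1 p.2)] :
    Definable (M.setTheoretic c) (fun g => ∃ x, P g x) :=
  (inferInstance : Definable (M.setTheoretic c) fun g => ¬ ∀ x, ¬ P g x).congr fun _ => by
    push Not; rfl

instance Definable.existsUnique (P : Γ → M.V → Prop)
    [Definable (M.setTheoretic c) (fun p : Γ × M.V => P p.1 p.2)]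
    [Definable (M.setTheoretic c) (fun p : (Γ × M.V) × M.V => P p.1.1 p.2)] :
    Definable (M.setTheoretic c) (fun g => ∃! x, P g x) :=
  (inferInstance : Definable (M.setTheoretic c) fun g => ∃ x, P g x ∧ ∀ y, P g y → y = x)

/-- `X` is one of the class parameters `c`. -/
class IsParameter (c : ℕ → M.Cls) (X : M.Cls) : Prop where
  out : ∃ i, c i = X

instance Definable.memCls (t : Γ → M.V) (X : M.Cls) [ht : Term (M.setTheoretic c) t]
    [hX : IsParameter c X] : Definable (M.setTheoretic c) (fun g => t g ∈ M.members X) := by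
  obtain ⟨j, rfl⟩ := hX.out
  have : Definable (M.setTheoretic c) (fun p : Γ × M.V => p.2 = t p.1) :=
    ht.out (fun p : Γ × M.V => p.1) (fun p => p.2)
  have : Definable (M.setTheoretic c) (fun p : Γ × M.V => M.memCls p.2 (c j)) := by
    refine ⟨[], fun L _ => ⟨_, ⟨.memCls (L.length + 1 + Context.depth M Γ) j, rfl⟩, fun g => ?_⟩⟩
    simp [SetTheoreticFormula.Sat, Context.env]
  exact (inferInstance : Definable (M.setTheoretic c) fun g => ∃ x, x = t g ∧ M.memCls x (c j)).congr
    fun g => by simp [members]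

instance Definable.isFun (F A B : Γ → M.V) [hF : Var F] [hA : Var A] [hB : Var B] :
    Definable (M.setTheoretic c)
      (fun g => IsFun (M.elts (F g)) (M.elts (A g)) (M.elts (B g))) := by
  have := hF.comp (fun p : (Γ × M.V) × M.V => p.1.1)
  have := hF.comp (fun p : ((Γ × M.V) × M.V) × M.V => p.1.1.1)
  have := hA.comp (fun p : Γ × M.V => p.1)
  have := hB.comp (fun p : (Γ × M.V) × M.V => p.1.1)
  unfold IsFun
  infer_instance

theorem exists_class (c : ℕ → M.Cls) (P : M.V → Prop) [hP : Definable (M.setTheoretic c) P] :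
    ∃ X, ∀ z, z ∈ M.members X ↔ P z := by
  obtain ⟨L, hL⟩ := hP.out
  obtain ⟨_, ⟨φ, rfl⟩, hφ⟩ := hL L (List.Subset.refl L)
  obtain ⟨X, hX⟩ := M.classComprehension φ (fun i => L.getD (i - 1) M.empty) c
    fun _ => Classical.choice M.nonempty_Coll
  exact ⟨X, fun z => (hX z).trans (hφ z)⟩

/-- The class of all `z` with `P z`, for a set theoretic formula `P` with class parameters `c`. -/
noncomputable def classOf (c : ℕ → M.Cls) (P : M.V → Prop) [Definable (M.setTheoretic c) P] :
    M.Cls :=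
  Classical.choose (exists_class c P)

@[simp]
theorem mem_classOf {c : ℕ → M.Cls} {P : M.V → Prop} {_ : Definable (M.setTheoretic c) P} {z : M.V} :
    z ∈ M.members (classOf c P) ↔ P z :=
  Classical.choose_spec (exists_class c P) z

end SetTheoretic

/-! ## Sets -/

theorem exists_sep (x : M.V) (P : M.V → Prop) [hP : Definable M.bounded P] :
    ∃ y, ∀ z, z ∈ M.elts y ↔ z ∈ M.elts x ∧ P z := by
  obtain ⟨L, hL⟩ := hP.out
  obtain ⟨_, ⟨φ, rfl⟩, hφ⟩ := hL L (List.Subset.refl L)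
  obtain ⟨y, hy⟩ := M.boundedSeparation φ (fun i => L.getD (i - 1) M.empty) x
  exact ⟨y, fun z => (hy z).trans (and_congr Iff.rfl (hφ z))⟩

/-- The set of all `z` in `x` with `P z`, for a bounded formula `P`. -/
noncomputable def sep (x : M.V) (P : M.V → Prop) [Definable M.bounded P] : M.V :=
  Classical.choose (exists_sep x P)

@[simp]
theorem mem_sep {x : M.V} {P : M.V → Prop} [Definable M.bounded P] {z : M.V} :
    z ∈ M.elts (sep x P) ↔ z ∈ M.elts x ∧ P z :=
  Classical.choose_spec (exists_sep x P) z

@[simp]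
theorem not_mem_empty {z : M.V} : z ∉ M.elts M.empty := Classical.choose_spec M.emptySet z

/-- The union of a set of sets. -/
noncomputable def sUnion (x : M.V) : M.V := Classical.choose (M.union x)

@[simp]
theorem mem_sUnion {x z : M.V} : z ∈ M.elts (sUnion x) ↔ ∃ t ∈ M.elts x, z ∈ M.elts t :=
  Classical.choose_spec (M.union x) z

/-- The power set. -/
noncomputable def power (x : M.V) : M.V := Classical.choose (M.powerSet x)

@[simp]
theorem mem_power {x z : M.V} : z ∈ M.elts (power x) ↔ ∀ t ∈ M.elts z, t ∈ M.elts x :=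
  Classical.choose_spec (M.powerSet x) z

/-- The union of two sets. -/
noncomputable def union₂ (x y : M.V) : M.V := sUnion (M.upair x y)

@[simp]
theorem mem_union₂ {x y z : M.V} : z ∈ M.elts (union₂ x y) ↔ z ∈ M.elts x ∨ z ∈ M.elts y := by
  simp [union₂, mem_elts_upair]

/-- A pair of members of `x` is a set of subsets of `x`. So products and graphs are cut out of a
double power set by bounded separation, without replacement. -/
theorem opair_mem_power {a b x : M.V} (ha : a ∈ M.elts x) (hb : b ∈ M.elts x) :
    M.opair a b ∈ M.elts (power (power x)) := by
  simp only [mem_power, opair, mem_elts_upair]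
  rintro t (rfl | rfl) s hs <;> rw [mem_elts_upair] at hs <;> rcases hs with rfl | rfl <;> assumption

/-- The set of all pairs `⟨a, b⟩` with `a` in `x`, `b` in `y` and `P a b`. -/
noncomputable def rel (x y : M.V) (P : M.V → M.V → Prop)
    [Definable M.bounded fun q : (M.V × M.V) × M.V => P q.1.2 q.2] : M.V :=
  sep (power (power (union₂ x y))) fun z => ∃ a ∈ M.elts x, ∃ b ∈ M.elts y, z = M.opair a b ∧ P a b

theorem mem_rel {x y : M.V} {P : M.V → M.V → Prop}
    [Definable M.bounded fun q : (M.V × M.V) × M.V => P q.1.2 q.2] {z : M.V} :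
    z ∈ M.elts (rel x y P) ↔ ∃ a ∈ M.elts x, ∃ b ∈ M.elts y, z = M.opair a b ∧ P a b := by
  simp only [rel, mem_sep, and_iff_right_iff_imp]
  rintro ⟨a, ha, b, hb, rfl, _⟩
  exact opair_mem_power (mem_union₂.2 (.inl ha)) (mem_union₂.2 (.inr hb))

@[simp]
theorem opair_mem_rel {x y : M.V} {P : M.V → M.V → Prop}
    [Definable M.bounded fun q : (M.V × M.V) × M.V => P q.1.2 q.2] {a b : M.V} :
    M.opair a b ∈ M.elts (rel x y P) ↔ a ∈ M.elts x ∧ b ∈ M.elts y ∧ P a b := by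
  rw [mem_rel]
  constructor
  · rintro ⟨a', ha, b', hb, e, h⟩
    obtain ⟨rfl, rfl⟩ := (opair_inj _).1 e
    exact ⟨ha, hb, h⟩
  · rintro ⟨ha, hb, h⟩
    exact ⟨a, ha, b, hb, rfl, h⟩

theorem isFun_rel {x y : M.V} {P : M.V → M.V → Prop}
    [Definable M.bounded fun q : (M.V × M.V) × M.V => P q.1.2 q.2]
    (h : ∀ a ∈ M.elts x, ∃ b ∈ M.elts y, P a b ∧ ∀ b' ∈ M.elts y, P a b' → b' = b) :
    IsFun (M.elts (rel x y P)) (M.elts x) (M.elts y) := by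
  constructor
  · intro p hp
    obtain ⟨a, ha, b, hb, rfl, _⟩ := mem_rel.1 hp
    exact ⟨a, ha, b, hb, rfl⟩
  · intro a ha
    obtain ⟨b, hb, hab, h'⟩ := h a ha
    exact ⟨b, opair_mem_rel.2 ⟨ha, hb, hab⟩, fun b' hb' =>
      h' b' (opair_mem_rel.1 hb').2.1 (opair_mem_rel.1 hb').2.2⟩

/-- The set of pairs. -/
noncomputable def prod (x y : M.V) : M.V := rel x y fun _ _ => True

@[simp]
theorem opair_mem_prod {x y a b : M.V} :
    M.opair a b ∈ M.elts (prod x y) ↔ a ∈ M.elts x ∧ b ∈ M.elts y := by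
  simp [prod]

theorem mem_prod {x y z : M.V} :
    z ∈ M.elts (prod x y) ↔ ∃ a ∈ M.elts x, ∃ b ∈ M.elts y, z = M.opair a b := by
  simp [prod, mem_rel]

theorem IsFun.mem_left {F A B : Set M.V} (h : IsFun F A B) {a b : M.V} (hab : M.opair a b ∈ F) :
    a ∈ A := by
  obtain ⟨a', ha, b', hb, e⟩ := h.1 _ hab
  exact ((opair_inj _).1 e).1 ▸ ha

theorem IsFun.mem_right {F A B : Set M.V} (h : IsFun F A B) {a b : M.V} (hab : M.opair a b ∈ F) :
    b ∈ B := by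
  obtain ⟨a', ha, b', hb, e⟩ := h.1 _ hab
  exact ((opair_inj _).1 e).2 ▸ hb

theorem IsFun.unique {F A B : Set M.V} (h : IsFun F A B) {a b b' : M.V} (hb : M.opair a b ∈ F)
    (hb' : M.opair a b' ∈ F) : b = b' :=
  (h.2 a (h.mem_left hb)).unique hb hb'

theorem IsFun.exists {F A B : Set M.V} (h : IsFun F A B) {a : M.V} (ha : a ∈ A) :
    ∃ b ∈ B, M.opair a b ∈ F := by
  obtain ⟨b, hb, _⟩ := h.2 a ha
  exact ⟨b, h.mem_right hb, hb⟩

end MTTModel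

/-! ### Exact categories: images, quotients by equivalence relations, balancedness -/

namespace CategoryTheory

variable {C : Type*} [Category* C]

/-- Universal effective epimorphisms. -/
abbrev UEpi {A B : C} (f : A ⟶ B) : Prop :=
  MorphismProperty.universally (fun _ _ f => EffectiveEpi f) f

namespace UEpi

theorem effectiveEpi {A B : C} {f : A ⟶ B} (h : UEpi f) : EffectiveEpi f :=
  MorphismProperty.universally_le _ _ h

theorem epi {A B : C} {f : A ⟶ B} (h : UEpi f) : Epi f :=
  have := h.effectiveEpi
  inferInstance

theorem exists_desc {A B Z : C} {f : A ⟶ B} (h : UEpi f) (k : A ⟶ Z)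
    (hk : ∀ (T : C) (a b : T ⟶ A), a ≫ f = b ≫ f → a ≫ k = b ≫ k) : ∃ l : B ⟶ Z, f ≫ l = k :=
  have := h.effectiveEpi
  ⟨EffectiveEpi.desc f k fun a b => hk _ a b, EffectiveEpi.fac ..⟩

/-- Since `m` is monic, `k` respects the kernel pair of `f` and descends to a section of `m`; a
monomorphism with a section is invertible. -/
theorem isIso_of_factor {A B X : C} {f : A ⟶ X} (h : UEpi f) (m : B ⟶ X) [Mono m] (k : A ⟶ B)
    (hk : k ≫ m = f) : IsIso m := by
  obtain ⟨l, hl⟩ := h.exists_desc k fun T a b hab => by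
    rw [← cancel_mono m, Category.assoc, Category.assoc, hk, hab]
  have := h.epi
  have h1 : l ≫ m = 𝟙 X := by rw [← cancel_epi f, ← Category.assoc, hl, hk, Category.comp_id]
  exact ⟨l, by rw [← cancel_mono m, Category.assoc, h1, Category.comp_id, Category.id_comp], h1⟩

theorem of_isPullback {P A B Y : C} {f' : P ⟶ Y} {g' : P ⟶ A} {f : A ⟶ B} {g : Y ⟶ B}
    (h : UEpi f) (sq : IsPullback g' f' f g) : UEpi f' :=
  (MorphismProperty.universally_isStableUnderBaseChange _).of_isPullback sq h

/-- The substitute for choosing preimages: a generalized element of `B` comes from `A` after passage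
to a cover. -/
theorem exists_lift [HasFiniteLimits C] {A B T : C} {f : A ⟶ B} (h : UEpi f) (t : T ⟶ B) :
    ∃ (V : C) (p : V ⟶ T) (s : V ⟶ A), UEpi p ∧ s ≫ f = p ≫ t :=
  ⟨_, _, _, h.of_isPullback (.of_hasPullback f t), pullback.condition⟩

end UEpi

/-- The pair `x, y` factors through the pair `r₁, r₂`. -/
def Related {R S : C} (r₁ r₂ : R ⟶ S) {T : C} (x y : T ⟶ S) : Prop :=
  ∃ s : T ⟶ R, s ≫ r₁ = x ∧ s ≫ r₂ = y

theorem Related.comp {R S : C} {r₁ r₂ : R ⟶ S} {T : C} {x y : T ⟶ S} (h : Related r₁ r₂ x y)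
    {U : C} (t : U ⟶ T) : Related r₁ r₂ (t ≫ x) (t ≫ y) := by
  obtain ⟨s, rfl, rfl⟩ := h
  exact ⟨t ≫ s, by simp, by simp⟩

/-- Because `r₁, r₂` are jointly monic the factorization through `R` is unique, hence compatible on
the kernel pair of the cover `p`, and it descends. -/
theorem Related.descend {R S : C} {r₁ r₂ : R ⟶ S} [JointlyMono₂ r₁ r₂] {T V : C} {x y : T ⟶ S}
    {p : V ⟶ T} (hp : UEpi p) (h : Related r₁ r₂ (p ≫ x) (p ≫ y)) : Related r₁ r₂ x y := by
  obtain ⟨s, h1, h2⟩ := h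
  have := hp.epi
  obtain ⟨l, rfl⟩ := hp.exists_desc s fun U a b hab =>
    JointlyMono₂.right_cancellation (p₁ := r₁) (p₂ := r₂) _ _
      (by rw [Category.assoc, Category.assoc, h1, reassoc_of% hab])
      (by rw [Category.assoc, Category.assoc, h2, reassoc_of% hab])
  exact ⟨l, by rw [← cancel_epi p, ← h1, Category.assoc],
    by rw [← cancel_epi p, ← h2, Category.assoc]⟩

section

variable [HasFiniteLimits C]
  (hq : ∀ (R A : C) (p₁ p₂ : R ⟶ A), IsEquivalenceRelation p₁ p₂ →
    IsUniversallyEffectiveEquivalenceRelation p₁ p₂)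

include hq

/-- The image is the quotient of `A` by the kernel pair of `f`. -/
theorem exists_image {A B : C} (f : A ⟶ B) :
    ∃ (I : C) (q : A ⟶ I) (m : I ⟶ B), UEpi q ∧ Mono m ∧ q ≫ m = f := by
  have hk : IsKernelPair f (pullback.fst f f) (pullback.snd f f) := .of_hasPullback f
  obtain ⟨⟨e⟩⟩ := hq _ _ _ _ (IsKernelPair.equivalenceRelation f _ _
    (pullbackIsPullback (pullback.snd f f) (pullback.fst f f)) hk).isEquivalenceRelation
  have he := e.universally_effectiveEpi_π
  obtain ⟨m, hm⟩ := UEpi.exists_desc he f fun T a b hab => by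
    obtain ⟨l, rfl, rfl⟩ := e.isKernelPair.exists_lift a b hab
    simp [pullback.condition]
  refine ⟨_, e.π, m, he, ⟨fun {T} u v huv => ?_⟩, hm⟩
  -- The two elements of the quotient lift to `A` on a common cover. The lifts have the same value
  -- under `f`, so they lie in the kernel pair and are equal in the quotient.
  obtain ⟨V, p, a, hp, ha⟩ := UEpi.exists_lift he u
  obtain ⟨U, p', b, hp', hb⟩ := UEpi.exists_lift he (p ≫ v)
  have := hp.epi
  have := hp'.epi
  obtain ⟨l, h1, h2⟩ := hk.exists_lift (p' ≫ a) b (by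
    rw [← hm, Category.assoc, reassoc_of% ha, reassoc_of% hb, huv])
  rw [← cancel_epi p, ← cancel_epi p', ← ha, ← hb, ← h2, ← Category.assoc, ← h1, Category.assoc,
    Category.assoc, e.isKernelPair.w]

theorem exists_image_pair {W S : C} (w₁ w₂ : W ⟶ S) :
    ∃ (R : C) (r₁ r₂ : R ⟶ S) (e : W ⟶ R), UEpi e ∧ JointlyMono₂ r₁ r₂ ∧ e ≫ r₁ = w₁ ∧
      e ≫ r₂ = w₂ := by
  obtain ⟨R, e, m, he, hm, h⟩ := exists_image hq (prod.lift w₁ w₂)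
  refine ⟨R, m ≫ prod.fst, m ≫ prod.snd, e, he, ⟨fun T a b h1 h2 => ?_⟩, ?_, ?_⟩
  · rw [← cancel_mono m]
    ext <;> simpa
  · rw [reassoc_of% h, prod.lift_fst]
  · rw [reassoc_of% h, prod.lift_snd]

/-- The relation `R` is the image of `W`, and symmetry and transitivity are only asked for elements
coming from `W`: elements of `R` lift to `W` locally, and being related is local by
`Related.descend`. -/
theorem exists_quotient {W R S : C} {r₁ r₂ : R ⟶ S} [JointlyMono₂ r₁ r₂] {e : W ⟶ R}
    (he : UEpi e) (hrefl : Related r₁ r₂ (𝟙 S) (𝟙 S))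
    (hsymm : Related r₁ r₂ (e ≫ r₂) (e ≫ r₁))
    (htrans : ∀ (T : C) (a b : T ⟶ W), a ≫ e ≫ r₂ = b ≫ e ≫ r₁ →
      Related r₁ r₂ (a ≫ e ≫ r₁) (b ≫ e ≫ r₂)) :
    ∃ (X : C) (π : S ⟶ X), UEpi π ∧
      ∀ (T : C) (x y : T ⟶ S), x ≫ π = y ≫ π ↔ Related r₁ r₂ x y := by
  obtain ⟨r, h1, h2⟩ := hrefl
  obtain ⟨s, h3, h4⟩ := hsymm.descend he
  have ht : Related r₁ r₂ (pullback.fst r₂ r₁ ≫ r₁) (pullback.snd r₂ r₁ ≫ r₂) := by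
    obtain ⟨V, p, a, hp, ha⟩ := he.exists_lift (pullback.fst r₂ r₁)
    obtain ⟨U, p', b, hp', hb⟩ := he.exists_lift (p ≫ pullback.snd r₂ r₁)
    refine .descend hp (.descend hp' ?_)
    have := htrans _ (p' ≫ a) b (by
      rw [Category.assoc, reassoc_of% ha, reassoc_of% hb, pullback.condition])
    rwa [Category.assoc, reassoc_of% ha, reassoc_of% hb] at this
  obtain ⟨t, h5, h6⟩ := ht
  obtain ⟨⟨d⟩⟩ := hq R S r₁ r₂ ⟨⟨
    { right_cancellation := JointlyMono₂.right_cancellation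
      r := r
      reflexivity₁ := h1
      reflexivity₂ := h2
      s := s
      symmetry₁ := h3
      symmetry₂ := h4
      c := _
      isLimit := pullbackIsPullback r₂ r₁
      t := t
      transitivity₁ := h5
      transitivity₂ := h6 }⟩⟩
  refine ⟨d.B, d.π, d.universally_effectiveEpi_π, fun T x y => ⟨d.isKernelPair.exists_lift x y, ?_⟩⟩
  rintro ⟨l, rfl, rfl⟩
  simp [d.isKernelPair.w]

/-- In the image factorization of an epimorphism the monic part is also epic, hence invertible in a
balanced category. -/
theorem uEpi_of_epi (hb : ∀ (X Y : C) (f : X ⟶ Y), Mono f → Epi f → IsIso f) {A B : C} (f : A ⟶ B)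
    [Epi f] : UEpi f := by
  obtain ⟨I, q, m, h, hm, rfl⟩ := exists_image hq f
  have : IsIso m := hb _ _ m hm (epi_of_epi q m)
  have := MorphismProperty.universally_respectsIso fun (X Y : C) (f : X ⟶ Y) => EffectiveEpi f
  exact (MorphismProperty.cancel_right_of_respectsIso _ q m).2 h

end

/-- A family of arrows to `X` is jointly epimorphic. -/
def JointlyEpi {X : C} (P : ∀ {D : C}, (D ⟶ X) → Prop) : Prop :=
  ∀ (Z : C) (a b : X ⟶ Z), (∀ (D : C) (h : D ⟶ X), P h → h ≫ a = h ≫ b) → a = b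

theorem JointlyEpi.mono {X : C} {P Q : ∀ {D : C}, (D ⟶ X) → Prop} (hP : JointlyEpi P)
    (h : ∀ {D : C} (f : D ⟶ X), P f → Q f) : JointlyEpi Q :=
  fun Z a b hab => hP Z a b fun D f hf => hab D f (h f hf)

/-- Pull back the subobject `R` of `S ⨯ S` along `(x, y)`. The result is a subobject of `T` through
which a jointly epimorphic family factors, so its inclusion is monic and epic, hence invertible. The
family need not be a set. -/
theorem Related.of_jointlyEpi [HasFiniteLimits C]
    (hb : ∀ (X Y : C) (f : X ⟶ Y), Mono f → Epi f → IsIso f)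
    {R S : C} {r₁ r₂ : R ⟶ S} [hr : JointlyMono₂ r₁ r₂] {T : C} {x y : T ⟶ S}
    {P : ∀ {D : C}, (D ⟶ T) → Prop} (hP : JointlyEpi P)
    (h : ∀ (D : C) (g : D ⟶ T), P g → Related r₁ r₂ (g ≫ x) (g ≫ y)) : Related r₁ r₂ x y := by
  have : Mono (prod.lift r₁ r₂) := ⟨fun a b hab => by
    refine hr.right_cancellation _ _ ?_ ?_
    · rw [← prod.lift_fst r₁ r₂, reassoc_of% hab]
    · rw [← prod.lift_snd r₁ r₂, reassoc_of% hab]⟩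
  have he : Epi (pullback.snd (prod.lift r₁ r₂) (prod.lift x y)) := ⟨fun a b hab => hP _ _ _ fun D g hg => by
    obtain ⟨s, h1, h2⟩ := h D g hg
    rw [← pullback.lift_snd (f := prod.lift r₁ r₂) (g := prod.lift x y) s g
      (by rw [prod.comp_lift, prod.comp_lift, h1, h2]), Category.assoc, hab, Category.assoc]⟩
  have := hb _ _ _ inferInstance he
  refine ⟨inv (pullback.snd (prod.lift r₁ r₂) (prod.lift x y)) ≫ pullback.fst _ _, ?_, ?_⟩
  · have := congr($(pullback.condition (f := prod.lift r₁ r₂) (g := prod.lift x y)) ≫ prod.fst)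
    simp only [Category.assoc, prod.lift_fst] at this
    simp [this]
  · have := congr($(pullback.condition (f := prod.lift r₁ r₂) (g := prod.lift x y)) ≫ prod.snd)
    simp only [Category.assoc, prod.lift_snd] at this
    simp [this]

/-- `i, j` is a coproduct cocone. -/
structure IsBinaryCoproduct {X Y S : C} (i : X ⟶ S) (j : Y ⟶ S) : Prop where
  hom_ext : ∀ {Z : C} (a b : S ⟶ Z), i ≫ a = i ≫ b → j ≫ a = j ≫ b → a = b
  exists_desc : ∀ {Z : C} (a : X ⟶ Z) (b : Y ⟶ Z), ∃ c : S ⟶ Z, i ≫ c = a ∧ j ≫ c = b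

theorem IsBinaryCoproduct.related {T₁ T₂ T R S : C} {k : T₁ ⟶ T} {l : T₂ ⟶ T}
    (h : IsBinaryCoproduct k l) {r₁ r₂ : R ⟶ S} {x y : T ⟶ S}
    (h1 : Related r₁ r₂ (k ≫ x) (k ≫ y)) (h2 : Related r₁ r₂ (l ≫ x) (l ≫ y)) :
    Related r₁ r₂ x y := by
  obtain ⟨s, hs1, hs2⟩ := h1
  obtain ⟨t, ht1, ht2⟩ := h2
  obtain ⟨c, hc1, hc2⟩ := h.exists_desc s t
  exact ⟨c, h.hom_ext _ _ (by rw [reassoc_of% hc1, hs1]) (by rw [reassoc_of% hc2, ht1]),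
    h.hom_ext _ _ (by rw [reassoc_of% hc1, hs2]) (by rw [reassoc_of% hc2, ht2])⟩

theorem IsBinaryCoproduct.of_isInitial {T₁ T₂ T : C} {k : T₁ ⟶ T} {l : T₂ ⟶ T}
    (h : IsBinaryCoproduct k l) (h₁ : IsInitial T₁) {B X : C} {m : B ⟶ X} {f : T ⟶ X} {g : T₂ ⟶ B}
    (hg : g ≫ m = l ≫ f) : ∃ t : T ⟶ B, t ≫ m = f := by
  obtain ⟨t, _, ht⟩ := h.exists_desc (h₁.to B) g
  exact ⟨t, h.hom_ext _ _ (h₁.hom_ext _ _) (by rw [reassoc_of% ht, hg])⟩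

variable (C) in
/-- Binary coproducts exist, and are stable and disjoint. -/
def HasStableDisjointBinaryCoproducts : Prop :=
  ∀ X Y : C, ∃ (S : C) (i : X ⟶ S) (j : Y ⟶ S), IsBinaryCoproduct i j ∧
    (∀ (T : C) (t : T ⟶ S), ∃ (T₁ T₂ : C) (k : T₁ ⟶ T) (l : T₂ ⟶ T) (x : T₁ ⟶ X) (y : T₂ ⟶ Y),
      IsBinaryCoproduct k l ∧ k ≫ t = x ≫ i ∧ l ≫ t = y ≫ j) ∧
    ∀ (P : C) (p : P ⟶ X) (q : P ⟶ Y), p ≫ i = q ≫ j → Nonempty (IsInitial P)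

/-- The amalgamated sum of two copies of `X` over `B` is built as a quotient of `S = X + X`,
identifying elements that lie over the same element of `B`. As `m` is epic, the two copies of `X`
become equal in the quotient. By effectiveness the two injections are then related, and by
disjointness they can only be related over `B`; so `X` is locally, hence globally, contained in `B`.
-/
theorem isIso_of_mono_epi [HasFiniteLimits C]
    (hq : ∀ (R A : C) (p₁ p₂ : R ⟶ A), IsEquivalenceRelation p₁ p₂ →
      IsUniversallyEffectiveEquivalenceRelation p₁ p₂)
    (hc : HasStableDisjointBinaryCoproducts C) {B X : C} (m : B ⟶ X) [Mono m] [Epi m] :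
    IsIso m := by
  obtain ⟨S, i, j, hS, -, hSd⟩ := hc X X
  obtain ⟨d, hid, hjd⟩ := hS.exists_desc (𝟙 X) (𝟙 X)
  -- pairs of elements of `S` over the same element of `B`
  let K := pullback (pullback.fst d d ≫ d) m
  let k₁ : K ⟶ S := pullback.fst _ _ ≫ pullback.fst d d
  let k₂ : K ⟶ S := pullback.fst _ _ ≫ pullback.snd d d
  let kB : K ⟶ B := pullback.snd _ _
  have hk₁ : k₁ ≫ d = kB ≫ m := by
    simp only [k₁, kB, Category.assoc]
    exact pullback.condition
  have hk₂ : k₂ ≫ d = kB ≫ m := by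
    rw [← hk₁]
    simp only [k₁, k₂, Category.assoc, pullback.condition]
  have hK : ∀ {T : C} (x y : T ⟶ S) (b : T ⟶ B), x ≫ d = b ≫ m → y ≫ d = b ≫ m →
      ∃ t : T ⟶ K, t ≫ k₁ = x ∧ t ≫ k₂ = y := fun x y b hx hy =>
    ⟨pullback.lift (pullback.lift x y (hx.trans hy.symm)) b
        (by rw [pullback.lift_fst_assoc, hx]),
      by simp only [k₁, pullback.lift_fst_assoc, pullback.lift_fst],
      by simp only [k₂, pullback.lift_fst_assoc, pullback.lift_snd]⟩
  -- The summand `S` contributes the diagonal and `K` the pairs over `B`; the equivalence relation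
  -- is the image of `S + K` in `S ⨯ S`.
  obtain ⟨W, wS, wK, hW, hWs, -⟩ := hc S K
  obtain ⟨w₁, hS₁, hK₁⟩ := hW.exists_desc (𝟙 S) k₁
  obtain ⟨w₂, hS₂, hK₂⟩ := hW.exists_desc (𝟙 S) k₂
  obtain ⟨R, r₁, r₂, e, he, hR, rfl, rfl⟩ := exists_image_pair hq w₁ w₂
  have hRK : ∀ {T : C} (x y : T ⟶ S) (b : T ⟶ B), x ≫ d = b ≫ m → y ≫ d = b ≫ m →
      Related r₁ r₂ x y := fun x y b hx hy => by
    obtain ⟨t, rfl, rfl⟩ := hK x y b hx hy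
    exact ⟨t ≫ wK ≫ e, by simp [hK₁], by simp [hK₂]⟩
  have hRe : ∀ {T : C} (a : T ⟶ W), Related r₁ r₂ (a ≫ e ≫ r₁) (a ≫ e ≫ r₂) := fun a =>
    ⟨a ≫ e, by simp, by simp⟩
  obtain ⟨Q, π, -, hπ⟩ := exists_quotient hq (r₁ := r₁) (r₂ := r₂) he ⟨wS ≫ e, by simp [hS₁], by simp [hS₂]⟩
    (by
      refine hW.related ?_ ?_
      · rw [hS₁, hS₂]
        exact ⟨wS ≫ e, by simp [hS₁], by simp [hS₂]⟩
      · rw [hK₁, hK₂]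
        exact hRK _ _ _ hk₂ hk₁)
    (by
      intro T a b hab
      -- Split the test object by the summand containing `a`, and then by the one containing `b`. On
      -- the summand `S` the two ends of a pair are equal; only the case of two pairs over `B` needs
      -- an argument.
      obtain ⟨T₁, T₂, k, l, x, y, hT, hk, hl⟩ := hWs T a
      refine hT.related ?_ ?_
      · have : k ≫ a ≫ e ≫ r₁ = k ≫ a ≫ e ≫ r₂ := by
          rw [reassoc_of% hk, reassoc_of% hk, hS₁, hS₂]
        rw [this, hab, ← Category.assoc, ← Category.assoc k b]
        exact hRe _
      · obtain ⟨U₁, U₂, k', l', x', y', hU, hk', hl'⟩ := hWs _ (l ≫ b)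
        refine hU.related ?_ ?_
        · have : k' ≫ l ≫ b ≫ e ≫ r₁ = k' ≫ l ≫ b ≫ e ≫ r₂ := by
            rw [reassoc_of% hk', reassoc_of% hk', hS₁, hS₂]
          rw [← this, ← hab]
          simpa using hRe (k' ≫ l ≫ a)
        · have h1 : l' ≫ l ≫ a ≫ e ≫ r₁ = l' ≫ y ≫ k₁ := by rw [reassoc_of% hl, hK₁]
          have h2 : l' ≫ l ≫ a ≫ e ≫ r₂ = l' ≫ y ≫ k₂ := by rw [reassoc_of% hl, hK₂]
          have h3 : l' ≫ l ≫ b ≫ e ≫ r₁ = y' ≫ k₁ := by rw [reassoc_of% hl', hK₁]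
          have h4 : l' ≫ l ≫ b ≫ e ≫ r₂ = y' ≫ k₂ := by rw [reassoc_of% hl', hK₂]
          rw [h1, h4]
          -- The element of `B` under the second pair also lies under the first, because the pairs
          -- share their middle entry.
          refine hRK _ _ (y' ≫ kB) ?_ (by simp [hk₂])
          have h5 : l' ≫ y ≫ k₂ = y' ≫ k₁ := by rw [← h2, hab, h3]
          rw [Category.assoc, Category.assoc, hk₁, ← hk₂, ← Category.assoc, ← Category.assoc,
            Category.assoc l', h5, Category.assoc, hk₁, Category.assoc])
  have hij : i ≫ π = j ≫ π := by
    rw [← cancel_epi m, ← Category.assoc, ← Category.assoc, hπ]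
    exact hRK _ _ (𝟙 B) (by simp [hid]) (by simp [hjd])
  obtain ⟨s, hs1, hs2⟩ := (hπ _ _ _).1 hij
  -- Lift the relation between the two injections to `S + K` on a cover `V` of `X`. Over the summand
  -- `S` the injections would agree, so that part of `V` is initial; over `K` there is an element of
  -- `B`.
  obtain ⟨V, f, g, hf, hg⟩ := he.exists_lift s
  have hg1 : g ≫ e ≫ r₁ = f ≫ i := by rw [reassoc_of% hg, hs1]
  have hg2 : g ≫ e ≫ r₂ = f ≫ j := by rw [reassoc_of% hg, hs2]
  obtain ⟨V₁, V₂, k, l, x, y, hV, hk, hl⟩ := hWs V g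
  obtain ⟨hV₁⟩ := hSd V₁ (k ≫ f) (k ≫ f) (by
    rw [Category.assoc, Category.assoc, ← hg1, ← hg2, reassoc_of% hk, reassoc_of% hk, hS₁, hS₂])
  obtain ⟨t, ht⟩ := hV.of_isInitial hV₁ (f := f) (m := m) (g := y ≫ kB) (by
    have := congr(l ≫ $hg1 ≫ d)
    simp only [Category.assoc, hid, Category.comp_id] at this
    rw [← this, reassoc_of% hl, reassoc_of% hK₁, hk₁, Category.assoc])
  exact hf.isIso_of_factor m t ht

end CategoryTheory

/-! ### Finite functions and ranges; arrows of class categories as members of classes -/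

namespace MTTModel

variable {M : MTTModel.{u, v, w}}

theorem isFun_empty {B : Set M.V} : IsFun (M.elts M.empty) (M.elts M.empty) B :=
  ⟨fun _ h => (not_mem_empty h).elim, fun _ h => (not_mem_empty h).elim⟩

theorem opair_mem_upair {i j a b k c : M.V} :
    M.opair k c ∈ M.elts (M.upair (M.opair i a) (M.opair j b)) ↔
      k = i ∧ c = a ∨ k = j ∧ c = b := by
  rw [mem_elts_upair, opair_inj, opair_inj]

theorem isFun_upair {B : Set M.V} {i j a b : M.V} (hij : i ≠ j) (ha : a ∈ B) (hb : b ∈ B) :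
    IsFun (M.elts (M.upair (M.opair i a) (M.opair j b))) (M.elts (M.upair i j)) B := by
  constructor
  · intro p hp
    rcases mem_elts_upair.1 hp with rfl | rfl
    · exact ⟨i, mem_elts_upair.2 (.inl rfl), a, ha, rfl⟩
    · exact ⟨j, mem_elts_upair.2 (.inr rfl), b, hb, rfl⟩
  · intro k hk
    simp only [opair_mem_upair]
    rcases mem_elts_upair.1 hk with rfl | rfl
    · exact ⟨a, .inl ⟨rfl, rfl⟩, by rintro c (⟨_, rfl⟩ | ⟨h, _⟩); exacts [rfl, (hij h).elim]⟩
    · exact ⟨b, .inr ⟨rfl, rfl⟩, by rintro c (⟨h, _⟩ | ⟨_, rfl⟩); exacts [(hij h.symm).elim, rfl]⟩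

theorem exists_ne (M : MTTModel.{u, v, w}) : ∃ i j : M.V, i ≠ j :=
  ⟨M.empty, M.upair M.empty M.empty, fun h => by
    have : M.empty ∈ M.elts (M.upair M.empty M.empty) := mem_elts_upair.2 (.inl rfl)
    rw [← h] at this
    exact not_mem_empty this⟩

/-- The range of a function. -/
noncomputable def range (A : M.V) : M.V :=
  sep (sUnion (sUnion A)) fun b => ∃ p ∈ M.elts A, ∃ t ∈ M.elts p, ∃ i ∈ M.elts t, p = M.opair i b

/-- The value `b` is a member of `{i, b}`, which is a member of `⟨i, b⟩`; thus the range lies in the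
double union of `A` and exists without replacement. -/
theorem mem_range {A b : M.V} : b ∈ M.elts (range A) ↔ ∃ i, M.opair i b ∈ M.elts A := by
  simp only [range, mem_sep, mem_sUnion]
  constructor
  · rintro ⟨_, p, hp, t, ht, i, hi, rfl⟩
    exact ⟨i, hp⟩
  · rintro ⟨i, h⟩
    exact ⟨⟨M.upair i b, ⟨_, h, mem_elts_upair.2 (.inr rfl)⟩, mem_elts_upair.2 (.inr rfl)⟩,
      _, h, _, mem_elts_upair.2 (.inr rfl), i, mem_elts_upair.2 (.inl rfl), rfl⟩

namespace ClassCat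

variable {E : M.ClassCat}

theorem opair_mem_mul {X Y Z : E.Obj} {f : X ⟶ Y} {g : Y ⟶ Z} {h : M.V} :
    M.opair (M.opair g.1 f.1) h ∈ M.members E.mul ↔ h = (f ≫ g).1 :=
  ⟨fun H => E.mul_unique H (E.compHom_spec f g), by rintro rfl; exact E.compHom_spec f g⟩

theorem opair_mem_dom {X Y : E.Obj} {f : X ⟶ Y} {a : M.V} :
    M.opair f.1 a ∈ M.members E.dom ↔ a = X.1 :=
  ⟨fun H => E.laws.dom.unique H f.2.1, by rintro rfl; exact f.2.1⟩

theorem opair_mem_cod {X Y : E.Obj} {f : X ⟶ Y} {a : M.V} :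
    M.opair f.1 a ∈ M.members E.cod ↔ a = Y.1 :=
  ⟨fun H => E.laws.cod.unique H f.2.2, by rintro rfl; exact f.2.2⟩

theorem exists_hom {f : M.V} (hf : f ∈ M.members E.ar) :
    ∃ (X Y : E.Obj) (f' : X ⟶ Y), f'.1 = f := by
  obtain ⟨a, ha, h1⟩ := E.laws.dom.exists hf
  obtain ⟨b, hb, h2⟩ := E.laws.cod.exists hf
  exact ⟨⟨a, ha⟩, ⟨b, hb⟩, ⟨f, h1, h2⟩, rfl⟩

theorem exists_hom_of_mul {g f h : M.V} (H : M.opair (M.opair g f) h ∈ M.members E.mul) :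
    ∃ (X Y Z : E.Obj) (f' : X ⟶ Y) (g' : Y ⟶ Z), f'.1 = f ∧ g'.1 = g ∧ (f' ≫ g').1 = h := by
  obtain ⟨g₁, hg, f₁, hf, e, b, h1, h2⟩ := E.laws.mul.mem_left H
  obtain ⟨rfl, rfl⟩ := (opair_inj _).1 e
  obtain ⟨X, Y, f', rfl⟩ := exists_hom hf
  obtain ⟨Y', Z, g', rfl⟩ := exists_hom hg
  rw [opair_mem_dom] at h1
  rw [opair_mem_cod] at h2
  obtain rfl : Y' = Y := Subtype.ext (h1.symm.trans h2)
  exact ⟨X, Y', Z, f', g', rfl, rfl, (opair_mem_mul.1 H).symm⟩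

theorem hom_ext {X Y : E.Obj} {f g : X ⟶ Y} (h : f.1 = g.1) : f = g := Subtype.ext h

theorem obj_eq_of_hom_eq {X Y X' Y' : E.Obj} {f : X ⟶ Y} {g : X' ⟶ Y'} (h : f.1 = g.1) :
    X = X' ∧ Y = Y' := by
  have hd := g.2.1
  have hc := g.2.2
  rw [← h, opair_mem_dom] at hd
  rw [← h, opair_mem_cod] at hc
  exact ⟨Subtype.ext hd.symm, Subtype.ext hc.symm⟩

/-! ### Small full subcategories -/

namespace IsFullSubcategory

variable {x : M.V} {D : M.SmallCat} (hD : E.IsFullSubcategory x D)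

include hD

theorem hom_mem {X Y : E.Obj} (hX : X.1 ∈ M.elts x) (hY : Y.1 ∈ M.elts x) (f : X ⟶ Y) :
    f.1 ∈ M.elts D.ar :=
  (hD.ar _).2 ⟨X, Y, hX, hY, f.2.1, f.2.2⟩

theorem hom_mem_iff {X Y : E.Obj} {f : X ⟶ Y} :
    f.1 ∈ M.elts D.ar ↔ X.1 ∈ M.elts x ∧ Y.1 ∈ M.elts x := by
  refine ⟨fun h => ?_, fun h => hD.hom_mem h.1 h.2 f⟩
  obtain ⟨X', Y', hX', hY', h1, h2⟩ := (hD.ar _).1 h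
  rw [← opair_mem_dom.1 h1, ← opair_mem_cod.1 h2]
  exact ⟨hX', hY'⟩

theorem exists_hom {f : M.V} (hf : f ∈ M.elts D.ar) :
    ∃ (X Y : E.Obj) (f' : X ⟶ Y), X.1 ∈ M.elts x ∧ Y.1 ∈ M.elts x ∧ f'.1 = f := by
  obtain ⟨X, Y, hX, hY, h1, h2⟩ := (hD.ar _).1 hf
  exact ⟨X, Y, ⟨f, h1, h2⟩, hX, hY, rfl⟩

theorem opair_mem_dom {X Y : E.Obj} {f : X ⟶ Y} {a : M.V} :
    M.opair f.1 a ∈ M.elts D.dom ↔ a = X.1 ∧ X.1 ∈ M.elts x ∧ Y.1 ∈ M.elts x := by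
  by_cases h : f.1 ∈ M.elts D.ar
  · rw [hD.dom _ _ h, ClassCat.opair_mem_dom]
    simp [hD.hom_mem_iff.1 h]
  · rw [hD.hom_mem_iff] at h
    exact iff_of_false (fun h' => h (hD.hom_mem_iff.1 (D.laws.dom.mem_left h'))) fun h' => h h'.2

theorem opair_mem_cod {X Y : E.Obj} {f : X ⟶ Y} {a : M.V} :
    M.opair f.1 a ∈ M.elts D.cod ↔ a = Y.1 ∧ X.1 ∈ M.elts x ∧ Y.1 ∈ M.elts x := by
  by_cases h : f.1 ∈ M.elts D.ar
  · rw [hD.cod _ _ h, ClassCat.opair_mem_cod]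
    simp [hD.hom_mem_iff.1 h]
  · rw [hD.hom_mem_iff] at h
    exact iff_of_false (fun h' => h (hD.hom_mem_iff.1 (D.laws.cod.mem_left h'))) fun h' => h h'.2

theorem exists_hom_of_cod {f a : M.V} (hf : M.opair f a ∈ M.elts D.cod) :
    ∃ (X Y : E.Obj) (f' : X ⟶ Y), X.1 ∈ M.elts x ∧ Y.1 ∈ M.elts x ∧ f'.1 = f ∧ Y.1 = a := by
  obtain ⟨X, Y, f', hX, hY, rfl⟩ := hD.exists_hom (D.laws.cod.mem_left hf)
  exact ⟨X, Y, f', hX, hY, rfl, (hD.opair_mem_cod.1 hf).1.symm⟩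

theorem exists_hom_of_mul {g f h : M.V} (H : M.opair (M.opair g f) h ∈ M.elts D.mul) :
    ∃ (X Y Z : E.Obj) (f' : X ⟶ Y) (g' : Y ⟶ Z), X.1 ∈ M.elts x ∧ Y.1 ∈ M.elts x ∧
      Z.1 ∈ M.elts x ∧ f'.1 = f ∧ g'.1 = g ∧ (f' ≫ g').1 = h := by
  obtain ⟨g₁, hg, f₁, hf, e, -⟩ := D.laws.mul.mem_left H
  obtain ⟨rfl, rfl⟩ := (opair_inj _).1 e
  rw [hD.mul _ _ _ hg hf] at H
  obtain ⟨X, Y, Z, f', g', rfl, rfl, rfl⟩ := ClassCat.exists_hom_of_mul H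
  rw [hD.hom_mem_iff] at hf hg
  exact ⟨X, Y, Z, f', g', hf.1, hf.2, hg.2, rfl, rfl, rfl⟩

theorem opair_mem_mul {X Y Z : E.Obj} {f : X ⟶ Y} {g : Y ⟶ Z} {h : M.V} :
    M.opair (M.opair g.1 f.1) h ∈ M.elts D.mul ↔
      h = (f ≫ g).1 ∧ X.1 ∈ M.elts x ∧ Y.1 ∈ M.elts x ∧ Z.1 ∈ M.elts x := by
  constructor
  · intro H
    obtain ⟨g₁, hg, f₁, hf, e, -⟩ := D.laws.mul.mem_left H
    obtain ⟨rfl, rfl⟩ := (opair_inj _).1 e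
    rw [hD.mul _ _ _ hg hf] at H
    rw [hD.hom_mem_iff] at hf hg
    exact ⟨ClassCat.opair_mem_mul.1 H, hf.1, hf.2, hg.2⟩
  · rintro ⟨rfl, hX, hY, hZ⟩
    rw [hD.mul _ _ _ (hD.hom_mem hY hZ g) (hD.hom_mem hX hY f)]
    exact ClassCat.opair_mem_mul.2 rfl

end IsFullSubcategory

/-! ### Cocones -/

theorem IsCocone.mem_iff {I A ι : M.V} {S X : E.Obj} (h : E.IsCocone I A ι S) {i : M.V}
    {a : X ⟶ S} (hi : M.opair i a.1 ∈ M.elts ι) : M.opair i X.1 ∈ M.elts A := by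
  obtain ⟨-, b, hb, hb'⟩ := h.2 _ _ hi
  rwa [← opair_mem_dom.1 hb']

theorem IsCocone.exists_hom {I A ι : M.V} {S : E.Obj} (h : E.IsCocone I A ι S) {i f : M.V}
    (hi : M.opair i f ∈ M.elts ι) : ∃ (X : E.Obj) (a : X ⟶ S), a.1 = f := by
  obtain ⟨X, Y, f', rfl⟩ := ClassCat.exists_hom (h.1.mem_right hi)
  obtain rfl : S = Y := Subtype.ext (opair_mem_cod.1 (h.2 _ _ hi).1)
  exact ⟨X, f', rfl⟩

theorem IsCocone.exists_inj {I A ι : M.V} {S X : E.Obj}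
    (hA : IsFun (M.elts A) (M.elts I) (M.members E.ob)) (h : E.IsCocone I A ι S) {i : M.V}
    (hi : M.opair i X.1 ∈ M.elts A) : ∃ a : X ⟶ S, M.opair i a.1 ∈ M.elts ι := by
  obtain ⟨f, -, hf⟩ := h.1.exists (hA.mem_left hi)
  obtain ⟨Y, a, rfl⟩ := h.exists_hom hf
  obtain rfl : X = Y := Subtype.ext (hA.unique hi (h.mem_iff hf))
  exact ⟨a, hf⟩

theorem IsCocone.exists_of_mem {I A ι : M.V} {S : E.Obj} (h : E.IsCocone I A ι S) {i : M.V}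
    (hi : i ∈ M.elts I) : ∃ (X : E.Obj) (a : X ⟶ S), M.opair i a.1 ∈ M.elts ι := by
  obtain ⟨f, -, hf⟩ := h.1.exists hi
  obtain ⟨Y, a, rfl⟩ := h.exists_hom hf
  exact ⟨Y, a, hf⟩

variable (hs : E.IsLocallySmall)

/-- The objects in the range of `A`, and `X` and `Y`, span a small full subcategory. -/
theorem IsLocallySmall.exists_span (hs : E.IsLocallySmall) {A : M.V}
    (hA : ∀ a ∈ M.elts A, a ∈ M.members E.ob) (X Y : E.Obj) :
    ∃ (x : M.V) (D : M.SmallCat), E.IsFullSubcategory x D ∧ (∀ a ∈ M.elts A, a ∈ M.elts x) ∧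
      X.1 ∈ M.elts x ∧ Y.1 ∈ M.elts x := by
  obtain ⟨D, hD⟩ := hs (union₂ A (M.upair X.1 Y.1)) (by
    intro a ha
    rw [mem_union₂, mem_elts_upair] at ha
    rcases ha with ha | rfl | rfl
    exacts [hA a ha, X.2, Y.2])
  exact ⟨_, D, hD, fun a ha => mem_union₂.2 (.inl ha), mem_union₂.2 (.inr (mem_elts_upair.2 (.inl rfl))),
    mem_union₂.2 (.inr (mem_elts_upair.2 (.inr rfl)))⟩

/-- Separation may not mention the classes of `E`. The cocone is therefore cut out of pairs of an
index and an arrow of the small full subcategory on the given objects and `Z`, with domains and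
codomains read off from the sets of that subcategory. -/
theorem exists_cocone (hs : E.IsLocallySmall) {I A : M.V}
    (hA : IsFun (M.elts A) (M.elts I) (M.members E.ob)) (Z : E.Obj) (P : M.V → M.V → Prop)
    [Definable M.bounded fun q : (M.V × M.V) × M.V => P q.1.2 q.2]
    (hP : ∀ i (X : E.Obj), M.opair i X.1 ∈ M.elts A → ∃! a : X ⟶ Z, P i a.1) :
    ∃ τ, E.IsCocone I A τ Z ∧ ∀ i (X : E.Obj) (a : X ⟶ Z), M.opair i X.1 ∈ M.elts A → P i a.1 →
      M.opair i a.1 ∈ M.elts τ := by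
  obtain ⟨x, D, hD, hAx, hZ, -⟩ := hs.exists_span (A := range A)
    (fun a ha => hA.mem_right (mem_range.1 ha).choose_spec) Z Z
  have hAx : ∀ {i a}, M.opair i a ∈ M.elts A → a ∈ M.elts x := fun h => hAx _ (mem_range.2 ⟨_, h⟩)
  have key : ∀ i (X : E.Obj) (a : X ⟶ Z), M.opair i X.1 ∈ M.elts A → P i a.1 →
      M.opair i a.1 ∈ M.elts (rel I D.ar fun i f => P i f ∧ M.opair f Z.1 ∈ M.elts D.cod ∧
        ∃ a ∈ M.elts x, M.opair i a ∈ M.elts A ∧ M.opair f a ∈ M.elts D.dom) := by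
    intro i X a hi ha
    have hX := hAx hi
    exact opair_mem_rel.2 ⟨hA.mem_left hi, hD.hom_mem hX hZ a, ha,
      hD.opair_mem_cod.2 ⟨rfl, hX, hZ⟩, X.1, hX, hi, hD.opair_mem_dom.2 ⟨rfl, hX, hZ⟩⟩
  refine ⟨_, ⟨⟨?_, ?_⟩, ?_⟩, key⟩
  · intro p hp
    obtain ⟨i, hi, f, hf, rfl, -⟩ := mem_rel.1 hp
    obtain ⟨X, Y, f', -, -, rfl⟩ := hD.exists_hom hf
    exact ⟨i, hi, _, E.mem_ar f', rfl⟩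
  · intro i hi
    obtain ⟨a, ha, hia⟩ := hA.exists hi
    obtain ⟨f, hf, hf'⟩ := hP i ⟨a, ha⟩ hia
    refine ⟨f.1, key _ _ _ hia hf, fun g hg => ?_⟩
    obtain ⟨-, -, hPg, hg1, b, hb, hib, hg2⟩ := opair_mem_rel.1 hg
    obtain ⟨X, Y, g, hX, hY, rfl⟩ := hD.exists_hom (D.laws.dom.mem_left hg2)
    obtain rfl : Z = Y := Subtype.ext (hD.opair_mem_cod.1 hg1).1
    obtain rfl : b = X.1 := (hD.opair_mem_dom.1 hg2).1
    obtain rfl : X = ⟨a, ha⟩ := Subtype.ext (hA.unique hib hia)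
    rw [hf' g hPg]
  · intro i f hf
    obtain ⟨-, -, hPg, hg1, b, hb, hib, hg2⟩ := opair_mem_rel.1 hf
    have hf := D.laws.dom.mem_left hg2
    exact ⟨(hD.cod _ _ hf).1 hg1, b, hib, (hD.dom _ _ hf).1 hg2⟩

namespace IsCoproduct

variable {I A ι : M.V} {S : E.Obj} (h : E.IsCoproduct I A ι S)
  (hA : IsFun (M.elts A) (M.elts I) (M.members E.ob))

include h hA

theorem exists_desc (hs : E.IsLocallySmall) (Z : E.Obj) (P : M.V → M.V → Prop)
    [Definable M.bounded fun q : (M.V × M.V) × M.V => P q.1.2 q.2]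
    (hP : ∀ i (X : E.Obj), M.opair i X.1 ∈ M.elts A → ∃! a : X ⟶ Z, P i a.1) :
    ∃ k : S ⟶ Z, ∀ (i : M.V) (X : E.Obj) (a : X ⟶ S) (b : X ⟶ Z), M.opair i a.1 ∈ M.elts ι →
      P i b.1 → a ≫ k = b := by
  obtain ⟨τ, hτ, hτ'⟩ := exists_cocone hs hA Z P hP
  obtain ⟨k, hk, -⟩ := h.2 Z τ hτ
  exact ⟨k, fun i X a b ha hb => hk i X a b ha (hτ' i X b (h.1.mem_iff ha) hb)⟩

/-- The universal property gives uniqueness only relative to a cocone that is a set, so the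
composites of `a` with the injections first have to be collected into one. -/
theorem hom_ext (hs : E.IsLocallySmall) {Z : E.Obj} {a b : S ⟶ Z}
    (hab : ∀ i (X : E.Obj) (f : X ⟶ S), M.opair i f.1 ∈ M.elts ι → f ≫ a = f ≫ b) : a = b := by
  obtain ⟨x, D, hD, hAx, hS, hZ⟩ := hs.exists_span (A := range A)
    (fun a ha => hA.mem_right (mem_range.1 ha).choose_spec) S Z
  have hAx : ∀ {i a}, M.opair i a ∈ M.elts A → a ∈ M.elts x := fun h => hAx _ (mem_range.2 ⟨_, h⟩)
  have key : ∀ (i : M.V) (X : E.Obj) (f : X ⟶ S) (g : X ⟶ Z), M.opair i f.1 ∈ M.elts ι →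
      ((∃ f ∈ M.elts D.ar, M.opair i f ∈ M.elts ι ∧
        M.opair (M.opair a.1 f) g.1 ∈ M.elts D.mul) ↔ g = f ≫ a) := by
    intro i X f g hf
    have hX := hAx (h.1.mem_iff hf)
    constructor
    · rintro ⟨f', -, hf', h'⟩
      obtain rfl := h.1.1.unique hf hf'
      exact ClassCat.hom_ext (hD.opair_mem_mul.1 h').1
    · rintro rfl
      exact ⟨_, hD.hom_mem hX hS f, hf, hD.opair_mem_mul.2 ⟨rfl, hX, hS, hZ⟩⟩
  obtain ⟨τ, hτ, hτ'⟩ := exists_cocone hs hA Z (fun i g => ∃ f ∈ M.elts D.ar,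
    M.opair i f ∈ M.elts ι ∧ M.opair (M.opair a.1 f) g ∈ M.elts D.mul) (by
      intro i X hi
      obtain ⟨f, hf⟩ := h.1.exists_inj hA hi
      exact ⟨f ≫ a, (key i X f _ hf).2 rfl, fun g hg => (key i X f g hf).1 hg⟩)
  refine (h.2 Z τ hτ).unique ?_ ?_
  all_goals
    intro i X f g hf hg
    have := hτ' i X (f ≫ a) (h.1.mem_iff hf) ((key i X f _ hf).2 rfl)
    rw [ClassCat.hom_ext (hτ.1.unique hg this)]
  exact (hab i X f hf).symm

end IsCoproduct

/-! ### Consequences of stable disjoint coproducts -/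

namespace HasStableDisjointCoproducts

/-- Initial objects are strict: they are coproducts of the empty family, and stability makes
anything above them such a coproduct too. -/
theorem isInitial_of_hom (hc : E.HasStableDisjointCoproducts) {P T : E.Obj} (hP : IsInitial P)
    (t : T ⟶ P) : Nonempty (IsInitial T) := by
  obtain ⟨B, π, hB, hπ, -⟩ := hc.stable M.empty M.empty M.empty P isFun_empty
    ⟨⟨isFun_empty, fun _ _ h => (not_mem_empty h).elim⟩, fun Z τ _ =>
      ⟨hP.to Z, fun _ _ _ _ h => (not_mem_empty h).elim, fun _ _ => hP.hom_ext _ _⟩⟩ T t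
  have : ∀ Z, ∃! k : T ⟶ Z, True := fun Z => by
    obtain ⟨k, -, hk⟩ := hπ.2 Z M.empty ⟨isFun_empty, fun _ _ h => (not_mem_empty h).elim⟩
    exact ⟨k, trivial, fun l _ => hk l fun _ _ _ _ _ h => (not_mem_empty h).elim⟩
  exact ⟨IsInitial.ofUniqueHom (fun Z => (this Z).choose) fun Z k => (this Z).unique trivial trivial⟩

variable {I A ι : M.V} {S : E.Obj}

theorem isInitial_of_eq [HasFiniteLimits E.Obj] (hc : E.HasStableDisjointCoproducts)
    (hA : IsFun (M.elts A) (M.elts I) (M.members E.ob)) (h : E.IsCoproduct I A ι S) {i j : M.V}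
    (hij : i ≠ j) {X Y : E.Obj} {a : X ⟶ S} {b : Y ⟶ S} (ha : M.opair i a.1 ∈ M.elts ι)
    (hb : M.opair j b.1 ∈ M.elts ι) {P : E.Obj} {p : P ⟶ X} {q : P ⟶ Y} (e : p ≫ a = q ≫ b) :
    Nonempty (IsInitial P) := by
  obtain ⟨hI⟩ := hc.disjoint I A ι S hA h i j X Y _ a b _ _ hij ha hb (.of_hasPullback a b)
  exact hc.isInitial_of_hom hI (pullback.lift p q e)

/-- By stability `Y` is the coproduct of pullbacks of the injections along `f`, and the injections
of a coproduct are jointly epimorphic. -/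
theorem jointlyEpi (hs : E.IsLocallySmall) (hc : E.HasStableDisjointCoproducts)
    (hA : IsFun (M.elts A) (M.elts I) (M.members E.ob)) (h : E.IsCoproduct I A ι S) {Y : E.Obj}
    (f : Y ⟶ S) : JointlyEpi fun {D} (g : D ⟶ Y) => ∃ (i : M.V) (X : E.Obj) (a : X ⟶ S)
      (b : D ⟶ X), M.opair i a.1 ∈ M.elts ι ∧ g ≫ f = b ≫ a := by
  intro Z u v huv
  obtain ⟨B, π, hB, hπ, hp⟩ := hc.stable I A ι S hA h Y f
  refine hπ.hom_ext hB hs fun i P p hi => huv _ _ ?_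
  obtain ⟨X, a, ha⟩ := h.1.exists_of_mem (hB.mem_left (hπ.1.mem_iff hi))
  obtain ⟨q, hq⟩ := hp i X P a p ha hi
  exact ⟨i, X, a, q, ha, hq.w⟩

theorem isBinaryCoproduct (hs : E.IsLocallySmall) {i j : M.V} (hij : i ≠ j) {X Y : E.Obj}
    (hA : IsFun (M.elts A) (M.elts (M.upair i j)) (M.members E.ob))
    (h : E.IsCoproduct (M.upair i j) A ι S) {a : X ⟶ S} {b : Y ⟶ S}
    (ha : M.opair i a.1 ∈ M.elts ι) (hb : M.opair j b.1 ∈ M.elts ι) : IsBinaryCoproduct a b := by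
  constructor
  · intro Z u v h1 h2
    refine h.hom_ext hA hs fun k P p hk => ?_
    have := hA.mem_left (h.1.mem_iff hk)
    rcases mem_elts_upair.1 this with rfl | rfl
    · obtain rfl : P = X := Subtype.ext (hA.unique (h.1.mem_iff hk) (h.1.mem_iff ha))
      rwa [ClassCat.hom_ext (h.1.1.unique hk ha)]
    · obtain rfl : P = Y := Subtype.ext (hA.unique (h.1.mem_iff hk) (h.1.mem_iff hb))
      rwa [ClassCat.hom_ext (h.1.1.unique hk hb)]
  · intro Z f g
    obtain ⟨k, hk, -⟩ := h.2 Z (M.upair (M.opair i f.1) (M.opair j g.1)) ⟨isFun_upair hij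
        (E.mem_ar f) (E.mem_ar g), fun k l hkl => by
      rcases opair_mem_upair.1 hkl with ⟨rfl, rfl⟩ | ⟨rfl, rfl⟩
      · exact ⟨f.2.2, X.1, h.1.mem_iff ha, f.2.1⟩
      · exact ⟨g.2.2, Y.1, h.1.mem_iff hb, g.2.1⟩⟩
    exact ⟨k, hk _ _ _ _ ha (opair_mem_upair.2 (.inl ⟨rfl, rfl⟩)),
      hk _ _ _ _ hb (opair_mem_upair.2 (.inr ⟨rfl, rfl⟩))⟩

theorem hasStableDisjointBinaryCoproducts [HasFiniteLimits E.Obj] (hs : E.IsLocallySmall)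
    (hc : E.HasStableDisjointCoproducts) : HasStableDisjointBinaryCoproducts E.Obj := by
  intro X Y
  obtain ⟨i, j, hij⟩ := exists_ne M
  have hA := isFun_upair (B := M.members E.ob) hij X.2 Y.2
  obtain ⟨ι, S, h⟩ := hc.exists_coproduct _ _ hA
  obtain ⟨a, ha⟩ := h.1.exists_inj (X := X) hA (opair_mem_upair.2 (.inl ⟨rfl, rfl⟩))
  obtain ⟨b, hb⟩ := h.1.exists_inj (X := Y) hA (opair_mem_upair.2 (.inr ⟨rfl, rfl⟩))
  refine ⟨S, a, b, isBinaryCoproduct hs hij hA h ha hb, fun T t => ?_, fun P p q e =>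
    hc.isInitial_of_eq hA h hij ha hb e⟩
  obtain ⟨B, π, hB, hπ, hp⟩ := hc.stable _ _ _ _ hA h _ t
  obtain ⟨T₁, k, hk⟩ := hπ.1.exists_of_mem (i := i) (mem_elts_upair.2 (.inl rfl))
  obtain ⟨T₂, l, hl⟩ := hπ.1.exists_of_mem (i := j) (mem_elts_upair.2 (.inr rfl))
  obtain ⟨x, hx⟩ := hp i X T₁ a k ha hk
  obtain ⟨y, hy⟩ := hp j Y T₂ b l hb hl
  exact ⟨T₁, T₂, k, l, x, y, isBinaryCoproduct hs hij hB hπ hk hl, hx.w, hy.w⟩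

end HasStableDisjointCoproducts

end ClassCat

theorem IsFun.mono_right {F A B B' : Set M.V} (h : IsFun F A B) (hB : B ⊆ B') : IsFun F A B' :=
  ⟨fun p hp => by
    obtain ⟨a, ha, b, hb, e⟩ := h.1 p hp
    exact ⟨a, ha, b, hB hb, e⟩, h.2⟩

/-! ### Covering families of generators, gluing, and the topology as a set -/

namespace ClassCat

variable {E : M.ClassCat}

/-- The hypotheses of Giraud's theorem, with the set `G` of generators. -/
structure IsGiraud (E : M.ClassCat) (G : M.V) : Prop where
  small : E.IsLocallySmall
  lim : HasFiniteLimits E.Obj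
  coprod : E.HasStableDisjointCoproducts
  quot : E.HasStableQuotients
  mem_ob : ∀ a ∈ M.elts G, a ∈ M.members E.ob
  generates : ∀ (X Y : E.Obj) (u v : X ⟶ Y),
    (∀ (D : E.Obj) (h : D ⟶ X), D.1 ∈ M.elts G → h ≫ u = h ≫ v) → u = v

/-- The arrows to `X` in the set `R` are jointly epimorphic. -/
def Covers (X : E.Obj) (R : M.V) : Prop :=
  JointlyEpi fun {D} (h : D ⟶ X) => h.1 ∈ M.elts R

/-- `R` is a set of arrows to `X` with domains in `G`. -/
def IsFamily (G : M.V) (X : E.Obj) (R : M.V) : Prop :=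
  ∀ f ∈ M.elts R, ∃ (Z : E.Obj) (f' : Z ⟶ X), Z.1 ∈ M.elts G ∧ f'.1 = f

theorem IsFamily.mem {G R : M.V} {X Z : E.Obj} (h : IsFamily G X R) {f : Z ⟶ X}
    (hf : f.1 ∈ M.elts R) : Z.1 ∈ M.elts G := by
  obtain ⟨Z', f', hZ, e⟩ := h _ hf
  have := f.2.1
  rw [← e, opair_mem_dom] at this
  rwa [this]

/-- Parallel arrows out of an initial object always agree, so initial domains test nothing.
Discarding them lets disjointness be used in the form that distinct injections never meet. -/
theorem _root_.CategoryTheory.JointlyEpi.nonInitial {X : E.Obj}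
    {P : ∀ {D : E.Obj}, (D ⟶ X) → Prop} (hP : JointlyEpi P) :
    JointlyEpi fun {D} (h : D ⟶ X) => P h ∧ IsEmpty (IsInitial D) := by
  intro Z u v huv
  refine hP Z u v fun D h hh => ?_
  by_cases hD : IsEmpty (IsInitial D)
  · exact huv D h ⟨hh, hD⟩
  · rw [not_isEmpty_iff] at hD
    exact hD.some.hom_ext _ _

namespace IsGiraud

variable {G : M.V} (H : E.IsGiraud G)

include H

theorem isIso_of_mono_epi (X Y : E.Obj) (f : X ⟶ Y) (_ : Mono f) (_ : Epi f) : IsIso f :=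
  have := H.lim
  CategoryTheory.isIso_of_mono_epi H.quot (H.coprod.hasStableDisjointBinaryCoproducts H.small) f

theorem uEpi {X Y : E.Obj} (f : X ⟶ Y) [Epi f] : UEpi f :=
  have := H.lim
  uEpi_of_epi H.quot H.isIso_of_mono_epi f

theorem jointlyEpi_generators (X : E.Obj) :
    JointlyEpi fun {D} (_ : D ⟶ X) => D.1 ∈ M.elts G :=
  fun Z u v huv => H.generates X Z u v huv

/-- Arrows to `X` lift locally to the summands of `S`: pull back the universally effective `q`,
decompose the pullback by stability of coproducts, and cover the pieces by generators. -/
theorem jointlyEpi_factor {I A ι : M.V} {S X Y : E.Obj}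
    (hA : IsFun (M.elts A) (M.elts I) (M.members E.ob)) (h : E.IsCoproduct I A ι S) (q : S ⟶ X)
    [Epi q] (g : Y ⟶ X) : JointlyEpi fun {D} (k : D ⟶ Y) => D.1 ∈ M.elts G ∧
      ∃ (i : M.V) (Z : E.Obj) (a : Z ⟶ S) (b : D ⟶ Z), M.opair i a.1 ∈ M.elts ι ∧
        k ≫ g = b ≫ a ≫ q := by
  have := H.lim
  intro T u v huv
  obtain ⟨V, p, s, hp, hs⟩ := (H.uEpi q).exists_lift g
  have := hp.epi
  rw [← cancel_epi p]
  refine H.coprod.jointlyEpi H.small hA h s _ _ _ fun W k ⟨i, Z, a, b, hi, hk⟩ =>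
    H.generates _ _ _ _ fun D d hD => ?_
  simpa using huv D (d ≫ k ≫ p) ⟨hD, i, Z, a, d ≫ b, hi, by
    simp only [Category.assoc]
    rw [← hs, reassoc_of% hk]⟩

/-- Effectiveness of `q` asks for equality on arbitrary test objects. Splitting both lifts along the
coproduct and covering by generators reduces this to test objects in the set `G`. -/
theorem exists_desc {I A ι : M.V} {S X Y : E.Obj}
    (hA : IsFun (M.elts A) (M.elts I) (M.members E.ob)) (h : E.IsCoproduct I A ι S) (q : S ⟶ X)
    [Epi q] (k : S ⟶ Y) (hk : ∀ (i j : M.V) (D Z W : E.Obj) (a : Z ⟶ S) (a' : W ⟶ S) (b : D ⟶ Z)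
      (b' : D ⟶ W), D.1 ∈ M.elts G → M.opair i a.1 ∈ M.elts ι → M.opair j a'.1 ∈ M.elts ι →
      b ≫ a ≫ q = b' ≫ a' ≫ q → b ≫ a ≫ k = b' ≫ a' ≫ k) : ∃ w : X ⟶ Y, q ≫ w = k := by
  refine (H.uEpi q).exists_desc k fun T x y hxy => ?_
  refine H.coprod.jointlyEpi H.small hA h x _ _ _ fun T₁ g ⟨i, Z, a, b, hi, hg⟩ => ?_
  refine H.coprod.jointlyEpi H.small hA h (g ≫ y) _ _ _ fun T₂ g' ⟨j, W, a', b', hj, hg'⟩ => ?_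
  refine H.generates _ _ _ _ fun D d hD => ?_
  have h1 : d ≫ g' ≫ g ≫ x = (d ≫ g' ≫ b) ≫ a := by simp [hg]
  have h2 : d ≫ g' ≫ g ≫ y = (d ≫ b') ≫ a' := by rw [hg', Category.assoc]
  have := hk i j D Z W a a' (d ≫ g' ≫ b) (d ≫ b') hD hi hj (by
    rw [← Category.assoc, ← h1, ← Category.assoc _ a', ← h2]
    simp [hxy])
  rw [← Category.assoc, ← h1, ← Category.assoc _ a', ← h2] at this
  simpa using this

/-- The arrow to `X` from the coproduct of the domains of the arrows in `R`. -/
theorem exists_total {X : E.Obj} {R : M.V} (hR : IsFamily G X R) :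
    ∃ (A ι : M.V) (S : E.Obj) (q : S ⟶ X), IsFun (M.elts A) (M.elts R) (M.members E.ob) ∧
      E.IsCoproduct R A ι S ∧ (∀ (f : M.V) (Z : E.Obj) (a : Z ⟶ S), M.opair f a.1 ∈ M.elts ι →
        (a ≫ q).1 = f) ∧
      ∀ (Z : E.Obj) (f : Z ⟶ X), f.1 ∈ M.elts R →
        ∃ a : Z ⟶ S, M.opair f.1 a.1 ∈ M.elts ι ∧ a ≫ q = f := by
  obtain ⟨x, D, hD, hG, hX, -⟩ := H.small.exists_span H.mem_ob X X
  -- The family of domains is cut out of pairs in `R` and `G` by the set `D.dom`, which replaces the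
  -- class `E.dom` in the bounded formula.
  have hdom : ∀ (Z : E.Obj) (f : Z ⟶ X) {a : M.V}, f.1 ∈ M.elts R →
      (M.opair f.1 a ∈ M.elts (rel R G fun f a => M.opair f a ∈ M.elts D.dom) ↔ a = Z.1) := by
    intro Z f a hf
    have hZ := hR.mem hf
    rw [opair_mem_rel, hD.opair_mem_dom]
    exact ⟨fun h => h.2.2.1, by rintro rfl; exact ⟨hf, hZ, rfl, hG _ hZ, hX⟩⟩
  have hA : IsFun (M.elts (rel R G fun f a => M.opair f a ∈ M.elts D.dom)) (M.elts R)
      (M.members E.ob) := by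
    constructor
    · intro p hp
      obtain ⟨f, hf, a, ha, rfl, -⟩ := mem_rel.1 hp
      exact ⟨f, hf, a, H.mem_ob a ha, rfl⟩
    · intro f hf
      obtain ⟨Z, f, hZ, rfl⟩ := hR f hf
      exact ⟨Z.1, (hdom Z f hf).2 rfl, fun a ha => (hdom Z f hf).1 ha⟩
  obtain ⟨ι, S, h⟩ := H.coprod.exists_coproduct _ _ hA
  -- The family is indexed by its own members, so the cocone on `X` is simply equality of arrow and
  -- index.
  obtain ⟨q, hq⟩ := h.exists_desc hA H.small X (fun i f => f = i) (by
    intro i Z hi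
    obtain ⟨Z', f, hZ, rfl⟩ := hR i (hA.mem_left hi)
    obtain rfl : Z = Z' := Subtype.ext ((hdom _ _ (hA.mem_left hi)).1 hi)
    exact ⟨f, rfl, fun g hg => ClassCat.hom_ext hg⟩)
  have key : ∀ (f : M.V) (Z : E.Obj) (a : Z ⟶ S), M.opair f a.1 ∈ M.elts ι → (a ≫ q).1 = f := by
    intro f Z a ha
    have hi := h.1.mem_iff ha
    obtain ⟨Z', f, hZ, rfl⟩ := hR f (hA.mem_left hi)
    obtain rfl : Z = Z' := Subtype.ext ((hdom _ _ (hA.mem_left hi)).1 hi)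
    rw [hq _ _ a f ha rfl]
  refine ⟨_, ι, S, q, hA, h, key, fun Z f hf => ?_⟩
  obtain ⟨a, ha⟩ := h.1.exists_inj (X := Z) hA ((hdom Z f hf).2 rfl)
  exact ⟨a, ha, ClassCat.hom_ext (key _ _ _ ha)⟩

theorem jointlyEpi_pullback {X Y : E.Obj} {R : M.V} (hR : IsFamily G X R) (hc : Covers X R)
    (g : Y ⟶ X) : JointlyEpi fun {D} (k : D ⟶ Y) => D.1 ∈ M.elts G ∧
      ∃ (Z : E.Obj) (f : Z ⟶ X) (b : D ⟶ Z), f.1 ∈ M.elts R ∧ k ≫ g = b ≫ f := by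
  obtain ⟨A, ι, S, q, hA, h, hq, hq'⟩ := H.exists_total hR
  have : Epi q := ⟨fun u v huv => hc _ _ _ fun D f hf => by
    obtain ⟨a, -, rfl⟩ := hq' D f hf
    rw [Category.assoc, huv, Category.assoc]⟩
  refine (H.jointlyEpi_factor hA h q g).mono ?_
  rintro D k ⟨hD, i, Z, a, b, hi, hk⟩
  refine ⟨hD, Z, a ≫ q, b, ?_, hk⟩
  rw [hq _ _ _ hi]
  exact hA.mem_left (h.1.mem_iff hi)

/-- The arrow from the coproduct of the domains to `X` is epic because `R` covers. The prescribed
arrows define a map out of the coproduct, and compatibility on generators makes it descend. The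
object `X` need not be a generator. -/
theorem existsUnique_glue {X Y : E.Obj} {R : M.V} (hR : IsFamily G X R) (hc : Covers X R)
    (P : M.V → M.V → Prop) [Definable M.bounded fun q : (M.V × M.V) × M.V => P q.1.2 q.2]
    (hP : ∀ (Z : E.Obj) (f : Z ⟶ X), f.1 ∈ M.elts R → ∃! x : Z ⟶ Y, P f.1 x.1)
    (hcompat : ∀ (D Z W : E.Obj) (f : Z ⟶ X) (g : W ⟶ X) (b : D ⟶ Z) (c : D ⟶ W) (x : Z ⟶ Y)
      (y : W ⟶ Y), D.1 ∈ M.elts G → f.1 ∈ M.elts R → g.1 ∈ M.elts R → P f.1 x.1 → P g.1 y.1 →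
      b ≫ f = c ≫ g → b ≫ x = c ≫ y) :
    ∃! w : X ⟶ Y, ∀ (Z : E.Obj) (f : Z ⟶ X) (x : Z ⟶ Y), f.1 ∈ M.elts R → P f.1 x.1 →
      f ≫ w = x := by
  obtain ⟨A, ι, S, q, hA, h, hq, hq'⟩ := H.exists_total hR
  have : Epi q := ⟨fun u v huv => hc _ _ _ fun D f hf => by
    obtain ⟨a, -, rfl⟩ := hq' D f hf
    rw [Category.assoc, huv, Category.assoc]⟩
  have hmem : ∀ {f : M.V} {Z : E.Obj} {a : Z ⟶ S}, M.opair f a.1 ∈ M.elts ι →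
      (a ≫ q).1 ∈ M.elts R := by
    intro f Z a ha
    rw [hq _ _ _ ha]
    exact hA.mem_left (h.1.mem_iff ha)
  obtain ⟨k, hk⟩ := h.exists_desc hA H.small Y P (by
    intro f Z hf
    obtain ⟨a, ha⟩ := h.1.exists_inj hA hf
    have := hP Z (a ≫ q) (hmem ha)
    rwa [hq _ _ _ ha] at this)
  have hk' : ∀ {f : M.V} {Z : E.Obj} {a : Z ⟶ S}, M.opair f a.1 ∈ M.elts ι →
      P (a ≫ q).1 (a ≫ k).1 := by
    intro f Z a ha
    obtain ⟨x, hx, -⟩ := hP Z (a ≫ q) (hmem ha)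
    have hx' := hx
    rw [hq _ _ _ ha] at hx'
    rwa [hk _ _ _ _ ha hx']
  obtain ⟨w, hw⟩ := H.exists_desc hA h q k fun i j D Z W a a' b b' hD hi hj e =>
    hcompat D Z W _ _ b b' _ _ hD (hmem hi) (hmem hj) (hk' hi) (hk' hj) e
  have hw' : ∀ (Z : E.Obj) (f : Z ⟶ X) (x : Z ⟶ Y), f.1 ∈ M.elts R → P f.1 x.1 → f ≫ w = x := by
    intro Z f x hf hx
    obtain ⟨a, ha, rfl⟩ := hq' Z f hf
    rw [Category.assoc, hw]
    exact (hP _ _ hf).unique (hk' ha) hx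
  refine ⟨w, hw', fun w' h' => hc _ _ _ fun D f hf => ?_⟩
  obtain ⟨x, hx, -⟩ := hP D f hf
  rw [hw' D f x hf hx, h' D f x hf hx]

-- Covering is a condition on all objects of `E`, so separation cannot select the covering sieves
-- directly. It is replaced by a factorization: place every pair `(X, R)` in one coproduct `Q`, let
-- `P` be the coproduct of the domains of all the arrows involved, and let `B` be the image of `P ⟶
-- Q`. Disjointness keeps the different pairs apart, so `B` restricted to the copy of `X` at `(X,
-- R)` is the union of the images of the members of `R`.
set_option synthInstance.maxSize 2000 in
set_option synthInstance.maxHeartbeats 200000 in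
theorem exists_topology {C : M.SmallCat} (hC : E.IsFullSubcategory G C) : ∃ J : M.V,
    (∀ p ∈ M.elts J, ∃ (X : E.Obj) (R : M.V), X.1 ∈ M.elts G ∧ p = M.opair X.1 R) ∧
    ∀ (X : E.Obj) (R : M.V), X.1 ∈ M.elts G →
      (M.opair X.1 R ∈ M.elts J ↔ C.IsSieve X.1 R ∧ Covers X R) := by
  have := H.lim
  have hp : ∀ {R f : M.V}, R ∈ M.elts (power C.ar) → f ∈ M.elts R → f ∈ M.elts C.ar :=
    fun hR hf => mem_power.1 hR _ hf
  -- The indices of `Q`: all pairs of a generator and a set of arrows of `C` into it, covering or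
  -- not.
  let I : M.V := rel G (power C.ar) fun a R => ∀ f ∈ M.elts R, M.opair f a ∈ M.elts C.cod
  let A : M.V := rel I G fun i a => ∃ R ∈ M.elts (power C.ar), i = M.opair a R
  have hA₀ : IsFun (M.elts A) (M.elts I) (M.elts G) := isFun_rel (by
    intro i hi
    obtain ⟨a, ha, R, hR, rfl, -⟩ := mem_rel.1 hi
    exact ⟨a, ha, ⟨R, hR, rfl⟩, by rintro b - ⟨R', -, e⟩; exact ((opair_inj _).1 e).1.symm⟩)
  have hA := hA₀.mono_right H.mem_ob
  obtain ⟨ι, Q, hQ⟩ := H.coprod.exists_coproduct _ _ hA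
  -- The indices of `P`: such a pair together with a member of its set of arrows.
  let I' : M.V := rel I C.ar fun i f =>
    ∃ a ∈ M.elts G, ∃ R ∈ M.elts (power C.ar), i = M.opair a R ∧ f ∈ M.elts R
  let A' : M.V := rel I' G fun n a =>
    ∃ i ∈ M.elts I, ∃ f ∈ M.elts C.ar, n = M.opair i f ∧ M.opair f a ∈ M.elts C.dom
  have hA' : IsFun (M.elts A') (M.elts I') (M.members E.ob) := by
    refine (isFun_rel ?_).mono_right H.mem_ob
    intro n hn
    obtain ⟨i, hi, f, hf, rfl, -⟩ := mem_rel.1 hn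
    obtain ⟨a, ha, hfa⟩ := C.laws.dom.exists hf
    refine ⟨a, hC.ob ▸ ha, ⟨i, hi, f, hf, rfl, hfa⟩, ?_⟩
    rintro b - ⟨i', -, f', -, e, hfb⟩
    obtain ⟨rfl, rfl⟩ := (opair_inj _).1 e
    exact C.laws.dom.unique hfb hfa
  obtain ⟨ι', P, hP⟩ := H.coprod.exists_coproduct _ _ hA'
  obtain ⟨x, D, hD, hGx, hQx, -⟩ := H.small.exists_span H.mem_ob Q Q
  have hAι : ∀ {X : E.Obj} {R : M.V} {a : X ⟶ Q} {Y : E.Obj},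
      M.opair (M.opair Y.1 R) a.1 ∈ M.elts ι → X = Y := by
    intro X R a Y ha
    obtain ⟨-, -, R', -, e⟩ := opair_mem_rel.1 (hQ.1.mem_iff ha)
    exact Subtype.ext ((opair_inj _).1 e).1.symm
  have hA'ι : ∀ {n : M.V} {Z : E.Obj}, M.opair n Z.1 ∈ M.elts A' → ∃ (X : E.Obj) (R : M.V)
      (f : Z ⟶ X) (a : X ⟶ Q), n = M.opair (M.opair X.1 R) f.1 ∧
        M.opair (M.opair X.1 R) a.1 ∈ M.elts ι ∧ f.1 ∈ M.elts R ∧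
        Z.1 ∈ M.elts G ∧ X.1 ∈ M.elts G := by
    intro n Z hn
    obtain ⟨hn, hZ, i, hi, f, hf, rfl, hfZ⟩ := opair_mem_rel.1 hn
    obtain ⟨-, -, X, hX, R, hR, rfl, hfR⟩ := opair_mem_rel.1 hn
    obtain ⟨-, -, hR'⟩ := opair_mem_rel.1 hi
    obtain ⟨Z', X', f, hZ', hX', rfl⟩ := hC.exists_hom hf
    obtain rfl : Z = Z' := Subtype.ext (hC.opair_mem_dom.1 hfZ).1
    obtain rfl : X = X'.1 := (hC.opair_mem_cod.1 (hR' _ hfR)).1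
    obtain ⟨Y, a, ha⟩ := hQ.1.exists_of_mem hi
    obtain rfl := hAι ha
    exact ⟨Y, R, f, a, rfl, ha, hfR, hZ, hX⟩
  -- On the summand at `((X, R), f)` the arrow `t` is `f` followed by the injection of the copy of
  -- `X` at `(X, R)`.
  obtain ⟨t, ht⟩ := hP.exists_desc hA' H.small Q (fun n h => ∃ i ∈ M.elts I, ∃ f ∈ M.elts C.ar,
      n = M.opair i f ∧ ∃ a ∈ M.elts D.ar, M.opair i a ∈ M.elts ι ∧
        M.opair (M.opair a f) h ∈ M.elts D.mul) (by
    intro n Z hn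
    obtain ⟨X, R, f, a, rfl, ha, hf, hZ, hX⟩ := hA'ι hn
    refine ⟨f ≫ a, ⟨_, hA.mem_left (hQ.1.mem_iff ha), _, hC.hom_mem hZ hX f, rfl, _,
      hD.hom_mem (hGx _ hX) hQx a, ha, hD.opair_mem_mul.2 ⟨rfl, hGx _ hZ, hGx _ hX, hQx⟩⟩, ?_⟩
    rintro h ⟨i, -, f', -, e, a', -, ha', hm⟩
    obtain ⟨rfl, rfl⟩ := (opair_inj _).1 e
    obtain rfl := hQ.1.1.unique ha ha'
    exact ClassCat.hom_ext (hD.opair_mem_mul.1 hm).1)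
  have ht' : ∀ {X Z : E.Obj} {R : M.V} {f : Z ⟶ X} {a : X ⟶ Q} {b : Z ⟶ P},
      M.opair (M.opair X.1 R) a.1 ∈ M.elts ι →
      M.opair (M.opair (M.opair X.1 R) f.1) b.1 ∈ M.elts ι' → b ≫ t = f ≫ a := by
    intro X Z R f a b ha hb
    obtain ⟨X', R', f', a', e, ha', hf, hZ, hX⟩ := hA'ι (hP.1.mem_iff hb)
    obtain ⟨e₁, e₂⟩ := (opair_inj _).1 e
    obtain ⟨e₃, rfl⟩ := (opair_inj _).1 e₁
    obtain rfl : X = X' := Subtype.ext e₃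
    exact ht _ _ b (f ≫ a) hb ⟨_, hA.mem_left (hQ.1.mem_iff ha), _, hC.hom_mem hZ hX f, rfl, _,
      hD.hom_mem (hGx _ hX) hQx a, ha, hD.opair_mem_mul.2 ⟨rfl, hGx _ hZ, hGx _ hX, hQx⟩⟩
  obtain ⟨B, e, m, he, hm, rfl⟩ := exists_image H.quot t
  have := he.epi
  -- a family covers if and only if the corresponding injection factors through the image
  have key : ∀ {X : E.Obj} {R : M.V} {a : X ⟶ Q}, M.opair (M.opair X.1 R) a.1 ∈ M.elts ι →
      ((∃ s : X ⟶ B, s ≫ m = a) ↔ Covers X R) := by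
    intro X R a ha
    obtain ⟨hi, hX, -⟩ := opair_mem_rel.1 (hQ.1.mem_iff ha)
    obtain ⟨-, hR, hR'⟩ := opair_mem_rel.1 hi
    constructor
    · rintro ⟨s, rfl⟩ Z u v huv
      -- Locally `X` is reached from some summand of `P`. On a noninitial test object disjointness
      -- forces it to belong to the same pair `(X, R)`, and the injection is monic, so the test
      -- arrow factors through a member of `R`.
      refine (H.jointlyEpi_factor hA' hP e s).nonInitial _ _ _ ?_
      rintro T k ⟨⟨-, n, Y, b, c, hn, hk⟩, hT⟩
      obtain ⟨X', R', f, a', rfl, ha', hf, -⟩ := hA'ι (hP.1.mem_iff hn)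
      have h1 : k ≫ s ≫ m = (c ≫ f) ≫ a' := by
        rw [reassoc_of% hk, ht' ha' hn, Category.assoc]
      have h2 : M.opair X'.1 R' = M.opair X.1 R := by
        by_contra hne
        exact hT.false (H.coprod.isInitial_of_eq hA hQ hne ha' ha h1.symm).some
      obtain ⟨h3, rfl⟩ := (opair_inj _).1 h2
      obtain rfl : X' = X := Subtype.ext h3
      rw [ClassCat.hom_ext (hQ.1.1.unique ha' ha)] at h1
      have := H.coprod.mono _ _ _ _ hA hQ _ _ _ ha
      rw [cancel_mono] at h1
      rw [h1, Category.assoc, Category.assoc, huv _ _ hf]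
    · intro hc
      -- Read as the relation `(m, m)`, the monomorphism `m` fits `Related.of_jointlyEpi`, which
      -- says here that factoring through `B` is local for the covering family `R`.
      have : JointlyMono₂ m m := ⟨fun _ u v h _ => (cancel_mono m).1 h⟩
      obtain ⟨s, hs, -⟩ := Related.of_jointlyEpi H.isIso_of_mono_epi (r₁ := m) (r₂ := m) (x := a)
        (y := a) hc (by
          intro T f hf
          have hfC := hp hR hf
          have hT := (hC.hom_mem_iff.1 hfC).1
          have hn : M.opair (M.opair (M.opair X.1 R) f.1) T.1 ∈ M.elts A' :=
            opair_mem_rel.2 ⟨opair_mem_rel.2 ⟨hi, hfC, _, hX, R, hR, rfl, hf⟩, hT, _, hi, _, hfC, rfl,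
              hC.opair_mem_dom.2 ⟨rfl, hT, hX⟩⟩
          obtain ⟨b, hb⟩ := hP.1.exists_inj hA' hn
          exact ⟨b ≫ e, by rw [Category.assoc, ht' ha hb], by rw [Category.assoc, ht' ha hb]⟩)
      exact ⟨s, hs⟩
  -- With `B` and `Q` in a small full subcategory, the existence of the factorization is a bounded
  -- formula.
  obtain ⟨x', D', hD', hGx', hBx', hQx'⟩ := H.small.exists_span H.mem_ob B Q
  refine ⟨rel G (power C.ar) fun a R => (∀ f ∈ M.elts R, M.opair f a ∈ M.elts C.cod) ∧
    (∀ f ∈ M.elts R, ∀ g ∈ M.elts C.ar, ∀ h ∈ M.elts C.ar,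
      M.opair (M.opair f g) h ∈ M.elts C.mul → h ∈ M.elts R) ∧
    ∃ i ∈ M.elts I, i = M.opair a R ∧ ∃ s ∈ M.elts D'.ar, ∃ k ∈ M.elts D'.ar,
      M.opair i k ∈ M.elts ι ∧ M.opair (M.opair m.1 s) k ∈ M.elts D'.mul, ?_, ?_⟩
  · intro p hp
    obtain ⟨a, ha, R, -, rfl, -⟩ := mem_rel.1 hp
    exact ⟨⟨a, H.mem_ob a ha⟩, R, ha, rfl⟩
  · intro X R hX
    rw [opair_mem_rel]
    constructor
    · rintro ⟨-, hR, h1, h2, i, hi, rfl, s, hs, k, hk, hik, hsk⟩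
      refine ⟨⟨h1, fun f g h hf hm => h2 f hf g ?_ h (C.laws.mul.mem_right hm) hm⟩, ?_⟩
      · obtain ⟨_, _, _, g', f', h3, h4, h5, rfl, rfl, rfl⟩ := hC.exists_hom_of_mul hm
        exact hC.hom_mem h3 h4 _
      · obtain ⟨Y, k, rfl⟩ := hQ.1.exists_hom hik
        obtain rfl := hAι hik
        obtain ⟨Z, B', Q', s, m', -, -, -, rfl, hm', hk'⟩ := hD'.exists_hom_of_mul hsk
        have hd := m'.2.1
        have hd' := m'.2.2
        rw [hm', opair_mem_dom] at hd
        rw [hm', opair_mem_cod] at hd'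
        obtain rfl : B' = B := Subtype.ext hd
        obtain rfl : Q' = Q := Subtype.ext hd'
        obtain rfl := ClassCat.hom_ext hm'
        have hd := (s ≫ m').2.1
        rw [hk', opair_mem_dom] at hd
        obtain rfl : Z = Y := Subtype.ext hd
        exact (key hik).1 ⟨s, ClassCat.hom_ext hk'⟩
    · rintro ⟨hR, hc⟩
      have hRp : R ∈ M.elts (power C.ar) := mem_power.2 fun f hf => C.laws.cod.mem_left (hR.1 f hf)
      have hi : M.opair X.1 R ∈ M.elts I := opair_mem_rel.2 ⟨hX, hRp, hR.1⟩
      obtain ⟨Y, k, hk⟩ := hQ.1.exists_of_mem hi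
      obtain rfl := hAι hk
      obtain ⟨s, hs⟩ := (key hk).2 hc
      have hYx := hGx' _ hX
      exact ⟨hX, hRp, hR.1, fun f hf g _ h _ hm => hR.2 f g h hf hm, _, hi, rfl, s.1,
        hD'.hom_mem hYx hBx' s, k.1, hD'.hom_mem hYx hQx' k, hk,
        hD'.opair_mem_mul.2 ⟨congrArg Subtype.val hs.symm, hYx, hBx', hQx'⟩⟩

end IsGiraud

end ClassCat

/-! ### The site of generators and the sheaves of arrows -/

namespace ClassCat

variable {E : M.ClassCat}

/-- `(C, J)` is the full subcategory on the generators with the jointly epimorphic sieves. -/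
structure IsGiraudSite (E : M.ClassCat) (G : M.V) (C : M.SmallCat) (J : M.V) : Prop
    extends IsGiraud E G where
  full : E.IsFullSubcategory G C
  exists_of_mem : ∀ p ∈ M.elts J, ∃ (X : E.Obj) (R : M.V), X.1 ∈ M.elts G ∧ p = M.opair X.1 R
  mem_iff : ∀ (X : E.Obj) (R : M.V), X.1 ∈ M.elts G →
    (M.opair X.1 R ∈ M.elts J ↔ C.IsSieve X.1 R ∧ Covers X R)

/-- `F, γ, e` is the presheaf of arrows from objects of `C` to `X`. -/
structure IsArrowPresheaf (E : M.ClassCat) (G : M.V) (C : M.SmallCat) (X F γ e : M.V) : Prop where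
  mem : ∀ f, f ∈ M.elts F ↔ M.opair f X ∈ M.members E.cod ∧
    ∃ a, a ∈ M.elts G ∧ M.opair f a ∈ M.members E.dom
  proj : ∀ p, p ∈ M.elts γ ↔ ∃ f a, f ∈ M.elts F ∧ a ∈ M.elts G ∧ p = M.opair f a ∧
    M.opair f a ∈ M.members E.dom
  act : ∀ p, p ∈ M.elts e ↔ ∃ f g h, f ∈ M.elts F ∧ g ∈ M.elts C.ar ∧ p = M.opair (M.opair f g) h ∧
    M.opair (M.opair f g) h ∈ M.members E.mul

namespace IsArrowPresheaf

variable {G F γ e F' γ' e' : M.V} {C : M.SmallCat}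

/-- The three sets are determined by their members; this makes the object part of the Yoneda functor
single-valued without any choice of presheaf. -/
theorem unique {X : M.V} (h : E.IsArrowPresheaf G C X F γ e)
    (h' : E.IsArrowPresheaf G C X F' γ' e') : F = F' ∧ γ = γ' ∧ e = e' := by
  obtain rfl : F = F' := eq_of_elts fun z => (h.mem z).trans (h'.mem z).symm
  exact ⟨rfl, eq_of_elts fun z => (h.proj z).trans (h'.proj z).symm,
    eq_of_elts fun z => (h.act z).trans (h'.act z).symm⟩

variable {X : E.Obj} (h : E.IsArrowPresheaf G C X.1 F γ e)

include h

theorem hom_mem_iff {Z : E.Obj} {f : Z ⟶ X} : f.1 ∈ M.elts F ↔ Z.1 ∈ M.elts G := by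
  rw [h.mem, and_iff_right f.2.2]
  exact ⟨fun ⟨a, ha, hf⟩ => opair_mem_dom.1 hf ▸ ha, fun hZ => ⟨_, hZ, f.2.1⟩⟩

theorem exists_hom {f : M.V} (hf : f ∈ M.elts F) :
    ∃ (Z : E.Obj) (f' : Z ⟶ X), Z.1 ∈ M.elts G ∧ f'.1 = f := by
  obtain ⟨h1, a, ha, h2⟩ := (h.mem f).1 hf
  exact ⟨⟨a, E.laws.dom.mem_right h2⟩, ⟨f, h2, h1⟩, ha, rfl⟩

theorem proj_iff {Z : E.Obj} {f : Z ⟶ X} {a : M.V} :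
    M.opair f.1 a ∈ M.elts γ ↔ a = Z.1 ∧ Z.1 ∈ M.elts G := by
  rw [h.proj]
  constructor
  · rintro ⟨f', a', hf, -, e, hd⟩
    obtain ⟨rfl, rfl⟩ := (opair_inj _).1 e
    exact ⟨opair_mem_dom.1 hd, h.hom_mem_iff.1 hf⟩
  · rintro ⟨rfl, hZ⟩
    exact ⟨_, _, h.hom_mem_iff.2 hZ, hZ, rfl, f.2.1⟩

theorem exists_hom_of_proj {f a : M.V} (hf : M.opair f a ∈ M.elts γ) :
    ∃ (Z : E.Obj) (f' : Z ⟶ X), Z.1 ∈ M.elts G ∧ f'.1 = f ∧ Z.1 = a := by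
  obtain ⟨f', a', hf, -, e, hd⟩ := (h.proj _).1 hf
  obtain ⟨rfl, rfl⟩ := (opair_inj _).1 e
  obtain ⟨Z, f, hZ, rfl⟩ := h.exists_hom hf
  exact ⟨Z, f, hZ, rfl, (opair_mem_dom.1 hd).symm⟩

theorem act_iff (hC : E.IsFullSubcategory G C) {Y Z : E.Obj} {f : Z ⟶ X} {g : Y ⟶ Z} {k : M.V} :
    M.opair (M.opair f.1 g.1) k ∈ M.elts e ↔ k = (g ≫ f).1 ∧ Y.1 ∈ M.elts G ∧ Z.1 ∈ M.elts G := by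
  rw [h.act]
  constructor
  · rintro ⟨f', g', h', hf, hg, e₁, hd⟩
    obtain ⟨e₂, rfl⟩ := (opair_inj _).1 e₁
    obtain ⟨rfl, rfl⟩ := (opair_inj _).1 e₂
    exact ⟨opair_mem_mul.1 hd, (hC.hom_mem_iff.1 hg).1, h.hom_mem_iff.1 hf⟩
  · rintro ⟨rfl, hY, hZ⟩
    exact ⟨_, _, _, h.hom_mem_iff.2 hZ, hC.hom_mem hY hZ g, rfl, opair_mem_mul.2 rfl⟩

theorem exists_hom_of_act (hC : E.IsFullSubcategory G C) {f g k : M.V}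
    (hf : M.opair (M.opair f g) k ∈ M.elts e) : ∃ (Y Z : E.Obj) (f' : Z ⟶ X) (g' : Y ⟶ Z),
      Y.1 ∈ M.elts G ∧ Z.1 ∈ M.elts G ∧ f'.1 = f ∧ g'.1 = g ∧ k = (g' ≫ f').1 := by
  obtain ⟨f', g', h', hf', hg, e₁, hd⟩ := (h.act _).1 hf
  obtain ⟨e₂, rfl⟩ := (opair_inj _).1 e₁
  obtain ⟨rfl, rfl⟩ := (opair_inj _).1 e₂
  obtain ⟨Y, Z, X', g', f', rfl, rfl, rfl⟩ := ClassCat.exists_hom_of_mul hd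
  obtain rfl : X' = X := Subtype.ext (opair_mem_cod.1 ((h.mem _).1 hf').1).symm
  exact ⟨Y, Z, f', g', (hC.hom_mem_iff.1 hg).1, h.hom_mem_iff.1 hf', rfl, rfl, rfl⟩

theorem presheafLaws (hC : E.IsFullSubcategory G C) : C.PresheafLaws F γ e where
  isFun_proj := by
    constructor
    · intro p hp
      obtain ⟨f, a, hf, ha, rfl, -⟩ := (h.proj p).1 hp
      exact ⟨f, hf, a, hC.ob.symm ▸ ha, rfl⟩
    · intro f hf
      obtain ⟨Z, f, hZ, rfl⟩ := h.exists_hom hf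
      exact ⟨Z.1, h.proj_iff.2 ⟨rfl, hZ⟩, fun a ha => (h.proj_iff.1 ha).1⟩
  isFun_act := by
    constructor
    · intro p hp
      obtain ⟨f, g, k, hf, hg, rfl, -⟩ := (h.act p).1 hp
      obtain ⟨Y, Z, f, g, hY, hZ, rfl, rfl, rfl⟩ := h.exists_hom_of_act hC hp
      exact ⟨_, ⟨f.1, hf, g.1, hg, rfl, Z.1, h.proj_iff.2 ⟨rfl, hZ⟩,
        hC.opair_mem_cod.2 ⟨rfl, hY, hZ⟩⟩, _, h.hom_mem_iff.2 hY, rfl⟩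
    · rintro _ ⟨f, hf, g, hg, rfl, A, hA, hg'⟩
      obtain ⟨Z, f, hZ, rfl, rfl⟩ := h.exists_hom_of_proj hA
      obtain ⟨Y, Z', g, hY, -, rfl, e⟩ := hC.exists_hom_of_cod hg'
      obtain rfl : Z' = Z := Subtype.ext e
      exact ⟨(g ≫ f).1, (h.act_iff hC).2 ⟨rfl, hY, hZ⟩, fun k hk => ((h.act_iff hC).1 hk).1⟩
  proj_act := by
    intro s g t B hs hB
    obtain ⟨Y, Z, f, g, hY, hZ, rfl, rfl, rfl⟩ := h.exists_hom_of_act hC hs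
    exact h.proj_iff.2 ⟨(hC.opair_mem_dom.1 hB).1, hY⟩
  act_mul := by
    intro s g k gk t r hgk hs ht
    obtain ⟨Y, Z, f, g, hY, hZ, rfl, rfl, rfl⟩ := h.exists_hom_of_act hC hs
    obtain ⟨W, Y', Z', k, g', hW, -, -, rfl, e, rfl⟩ := hC.exists_hom_of_mul hgk
    obtain ⟨rfl, rfl⟩ := obj_eq_of_hom_eq e
    obtain rfl := ClassCat.hom_ext e
    rw [h.act_iff hC] at ht ⊢
    exact ⟨by rw [ht.1, Category.assoc], hW, hZ⟩
  act_id := by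
    intro s A i hs hi hi'
    obtain ⟨Z, f, hZ, rfl, rfl⟩ := h.exists_hom_of_proj hs
    -- The law only assumes that `i` is a left unit; evaluated at the identity it gives `i ∘ 𝟙 = 𝟙`,
    -- so `i` is the identity.
    have h1 := hi' (𝟙 Z : Z ⟶ Z).1 (hC.opair_mem_cod.2 ⟨rfl, hZ, hZ⟩)
    obtain ⟨Y, Z', W, k, i, -, -, -, h2, rfl, h3⟩ := hC.exists_hom_of_mul h1
    obtain rfl : Z = Z' := Subtype.ext (hC.opair_mem_dom.1 hi).1
    have h4 := (𝟙 Z : Z ⟶ Z).2.2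
    rw [← h3, opair_mem_cod] at h4
    obtain rfl : Z = W := Subtype.ext h4
    have h5 := (𝟙 Z : Z ⟶ Z).2.1
    rw [← h3, opair_mem_dom] at h5
    obtain rfl : Z = Y := Subtype.ext h5
    obtain rfl := ClassCat.hom_ext h2
    rw [Category.id_comp] at h3
    obtain rfl := ClassCat.hom_ext h3
    exact (h.act_iff hC).2 ⟨by rw [Category.id_comp], hZ, hZ⟩

end IsArrowPresheaf

namespace IsGiraudSite

variable {G J : M.V} {C : M.SmallCat} (H : E.IsGiraudSite G C J)

include H

theorem isFamily {X : E.Obj} {R : M.V} (hR : C.IsSieve X.1 R) : IsFamily G X R := by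
  intro f hf
  obtain ⟨Z, X', f, hZ, -, rfl, e⟩ := H.full.exists_hom_of_cod (hR.1 f hf)
  obtain rfl : X' = X := Subtype.ext e
  exact ⟨Z, f, hZ, rfl⟩

theorem comp_mem {X : E.Obj} {R : M.V} (hX : X.1 ∈ M.elts G) (hR : C.IsSieve X.1 R) {Y Z : E.Obj}
    {f : Z ⟶ X} (hf : f.1 ∈ M.elts R) (g : Y ⟶ Z) (hY : Y.1 ∈ M.elts G) :
    (g ≫ f).1 ∈ M.elts R :=
  hR.2 f.1 g.1 _ hf (H.full.opair_mem_mul.2 ⟨rfl, hY, (H.isFamily hR).mem hf, hX⟩)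

theorem mem_pullbackSieve {X Y Z : E.Obj} {R T : M.V} {g : Y ⟶ X} (hX : X.1 ∈ M.elts G)
    (hY : Y.1 ∈ M.elts G) (hZ : Z.1 ∈ M.elts G) (hT : C.IsPullbackSieve g.1 R T) {f : Z ⟶ Y} :
    f.1 ∈ M.elts T ↔ (f ≫ g).1 ∈ M.elts R := by
  rw [hT]
  constructor
  · rintro ⟨k, hk, hm⟩
    rwa [← (H.full.opair_mem_mul.1 hm).1]
  · intro h
    exact ⟨_, h, H.full.opair_mem_mul.2 ⟨rfl, hZ, hY, hX⟩⟩

theorem exists_hom_of_mem_pullbackSieve {X Y : E.Obj} {R T : M.V} {g : Y ⟶ X}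
    (hT : C.IsPullbackSieve g.1 R T) {f : M.V} (hf : f ∈ M.elts T) :
    ∃ (Z : E.Obj) (f' : Z ⟶ Y), Z.1 ∈ M.elts G ∧ f'.1 = f := by
  obtain ⟨k, -, hm⟩ := (hT f).1 hf
  obtain ⟨Z, Y', X', f, g', hZ, -, -, rfl, e, -⟩ := H.full.exists_hom_of_mul hm
  have hd := g.2.1
  rw [← e, opair_mem_dom] at hd
  obtain rfl : Y = Y' := Subtype.ext hd
  exact ⟨Z, f, hZ, rfl⟩

/-- Maximal sieves cover because `G` generates, stability is `jointlyEpi_pullback`, and transitivity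
tests equality first along `R` and then along the pulled back sieves. -/
theorem isTopology : C.IsTopology J where
  isSieve p hp := by
    obtain ⟨X, R, hX, rfl⟩ := H.exists_of_mem p hp
    exact ⟨_, _, rfl, H.full.ob.symm ▸ hX, ((H.mem_iff X R hX).1 hp).1⟩
  maximal A R hA hR := by
    have hA : A ∈ M.elts G := H.full.ob ▸ hA
    refine (H.mem_iff ⟨A, H.mem_ob A hA⟩ R hA).2 ⟨⟨fun f hf => (hR f).1 hf, ?_⟩, ?_⟩
    · intro f g h hf hm
      rw [hR] at hf ⊢
      exact C.laws.cod_mul _ _ _ _ hm hf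
    · exact (H.jointlyEpi_generators _).mono fun f hf =>
        (hR _).2 (H.full.opair_mem_cod.2 ⟨rfl, hf, hA⟩)
  stable A B R T g hR hA hB hT := by
    obtain ⟨X, R', hX, e⟩ := H.exists_of_mem _ hR
    obtain ⟨rfl, rfl⟩ := (opair_inj _).1 e
    obtain ⟨hs, hc⟩ := (H.mem_iff X R hX).1 hR
    obtain ⟨Y, X', g, hY, -, rfl, e⟩ := H.full.exists_hom_of_cod hA
    obtain rfl : X' = X := Subtype.ext e
    obtain rfl := (H.full.opair_mem_dom.1 hB).1
    refine (H.mem_iff Y T hY).2 ⟨⟨?_, ?_⟩, ?_⟩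
    · intro f hf
      obtain ⟨Z, f, hZ, rfl⟩ := H.exists_hom_of_mem_pullbackSieve hT hf
      exact H.full.opair_mem_cod.2 ⟨rfl, hZ, hY⟩
    · intro f k h hf hm
      obtain ⟨Z, f, hZ, rfl⟩ := H.exists_hom_of_mem_pullbackSieve hT hf
      obtain ⟨W, Z', Y', k, f', hW, -, -, rfl, e, rfl⟩ := H.full.exists_hom_of_mul hm
      obtain ⟨rfl, rfl⟩ := obj_eq_of_hom_eq e
      obtain rfl := ClassCat.hom_ext e
      rw [H.mem_pullbackSieve hX hY hZ hT] at hf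
      rw [H.mem_pullbackSieve hX hY hW hT, Category.assoc]
      exact H.comp_mem hX hs hf k hW
    · refine (H.jointlyEpi_pullback (H.isFamily hs) hc g).mono ?_
      rintro D k ⟨hD, Z, f, b, hf, hk⟩
      rw [H.mem_pullbackSieve hX hY hD hT, hk]
      exact H.comp_mem hX hs hf b hD
  transitive A R R' hR hs' hT := by
    obtain ⟨X, R₁, hX, e⟩ := H.exists_of_mem _ hR
    obtain ⟨rfl, rfl⟩ := (opair_inj _).1 e
    obtain ⟨hs, hc⟩ := (H.mem_iff X R hX).1 hR
    refine (H.mem_iff X R' hX).2 ⟨hs', fun Z u v huv => hc _ _ _ fun Y f hf => ?_⟩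
    obtain ⟨B, T, hB, hT, hBT⟩ := hT _ hf
    have hY := (H.isFamily hs).mem hf
    obtain rfl := (H.full.opair_mem_dom.1 hB).1
    refine ((H.mem_iff Y T hY).1 hBT).2 _ _ _ fun W g hg => ?_
    have hW := (H.isFamily ((H.mem_iff Y T hY).1 hBT).1).mem hg
    simpa using huv _ _ ((H.mem_pullbackSieve hX hY hW hT).1 hg)

theorem isSheaf {X : E.Obj} {F γ e : M.V} (h : E.IsArrowPresheaf G C X.1 F γ e) :
    C.IsSheaf J (M.opair F (M.opair γ e)) := by
  refine ⟨F, γ, e, rfl, h.presheafLaws H.full, ?_⟩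
  intro A R x hR hx
  obtain ⟨Y, R', hY, e'⟩ := H.exists_of_mem _ hR
  obtain ⟨rfl, rfl⟩ := (opair_inj _).1 e'
  obtain ⟨hs, hc⟩ := (H.mem_iff Y R hY).1 hR
  have hx' : ∀ {Z : E.Obj} {f : Z ⟶ Y} {s : M.V}, M.opair f.1 s ∈ M.elts x →
      ∃ s' : Z ⟶ X, s'.1 = s := by
    intro Z f s hfs
    have hZ := (H.isFamily hs).mem (hx.1.mem_left hfs)
    have := hx.2.1 _ _ Z.1 hfs (H.full.opair_mem_dom.2 ⟨rfl, hZ, hY⟩)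
    obtain ⟨Z', s, -, rfl, e⟩ := h.exists_hom_of_proj this
    obtain rfl : Z' = Z := Subtype.ext e
    exact ⟨s, rfl⟩
  obtain ⟨w, hw, hw'⟩ := H.existsUnique_glue (Y := X) (H.isFamily hs) hc
    (fun f s => M.opair f s ∈ M.elts x) (by
      intro Z f hf
      obtain ⟨s, -, hfs⟩ := hx.1.exists hf
      obtain ⟨s, rfl⟩ := hx' hfs
      exact ⟨s, hfs, fun t ht => ClassCat.hom_ext (hx.1.unique ht hfs)⟩) (by
      intro D Z W f g b c s t hD hf hg hs' ht e
      have hmul : ∀ {Z : E.Obj} {f : Z ⟶ Y} {b : D ⟶ Z}, f.1 ∈ M.elts R →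
          M.opair (M.opair f.1 b.1) (b ≫ f).1 ∈ M.elts C.mul := fun hf =>
        H.full.opair_mem_mul.2 ⟨rfl, hD, (H.isFamily hs).mem hf, hY⟩
      -- The arrow `b ≫ f = c ≫ g` belongs to the sieve, and its single value is the restriction of
      -- both `s` and `t`.
      obtain ⟨r, -, hr⟩ := hx.1.exists (H.comp_mem hY hs hf b hD)
      have h1 := hx.2.2 _ _ _ _ _ (hmul hf) hs' hr
      rw [e] at hr
      have h2 := hx.2.2 _ _ _ _ _ (hmul hg) ht hr
      rw [h.act_iff H.full] at h1 h2
      exact ClassCat.hom_ext (h1.1.symm.trans h2.1))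
  refine ⟨w.1, ⟨h.proj_iff.2 ⟨rfl, hY⟩, ?_⟩, ?_⟩
  · intro f t hft
    obtain ⟨Z, f, hZ, rfl⟩ := H.isFamily hs f (hx.1.mem_left hft)
    obtain ⟨t, rfl⟩ := hx' hft
    rw [← hw Z f t (hx.1.mem_left hft) hft]
    exact (h.act_iff H.full).2 ⟨rfl, hZ, hY⟩
  · rintro w₁ ⟨h1, h2⟩
    obtain ⟨Y', w₁, -, rfl, e⟩ := h.exists_hom_of_proj h1
    obtain rfl : Y' = Y := Subtype.ext e
    refine congrArg Subtype.val (hw' w₁ fun Z f t hf hft => ?_)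
    have := h2 _ _ hft
    rw [h.act_iff H.full] at this
    exact ClassCat.hom_ext this.1.symm

/-- Local smallness makes the arrows from generators to `X` a set; everything is then separated
inside one small full subcategory containing `G` and `X`. -/
theorem exists_arrowPresheaf (X : E.Obj) : ∃ F γ e, E.IsArrowPresheaf G C X.1 F γ e := by
  obtain ⟨x, D, hD, hGx, hX, -⟩ := H.small.exists_span H.mem_ob X X
  let F : M.V := sep D.ar fun f => M.opair f X.1 ∈ M.elts D.cod ∧
    ∃ a ∈ M.elts G, M.opair f a ∈ M.elts D.dom
  have hF : ∀ f, f ∈ M.elts F ↔ M.opair f X.1 ∈ M.members E.cod ∧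
      ∃ a, a ∈ M.elts G ∧ M.opair f a ∈ M.members E.dom := by
    intro f
    rw [mem_sep]
    constructor
    · rintro ⟨hf, h1, a, ha, h2⟩
      exact ⟨(hD.cod _ _ hf).1 h1, a, ha, (hD.dom _ _ hf).1 h2⟩
    · rintro ⟨h1, a, ha, h2⟩
      have hf : f ∈ M.elts D.ar :=
        hD.hom_mem (X := ⟨a, H.mem_ob a ha⟩) (Y := X) (hGx _ ha) hX ⟨f, h2, h1⟩
      exact ⟨hf, (hD.cod _ _ hf).2 h1, a, ha, (hD.dom _ _ hf).2 h2⟩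
  have hF' : ∀ {f}, f ∈ M.elts F → f ∈ M.elts D.ar := fun h => (mem_sep.1 h).1
  have hC : ∀ {g}, g ∈ M.elts C.ar → g ∈ M.elts D.ar := by
    intro g hg
    obtain ⟨Y, Z, g, hY, hZ, rfl⟩ := H.full.exists_hom hg
    exact hD.hom_mem (hGx _ hY) (hGx _ hZ) g
  refine ⟨F, rel F G fun f a => M.opair f a ∈ M.elts D.dom,
    rel (prod F C.ar) D.ar fun p h => M.opair p h ∈ M.elts D.mul, hF, ?_, ?_⟩
  · intro p
    rw [mem_rel]
    constructor
    · rintro ⟨f, hf, a, ha, rfl, h⟩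
      exact ⟨f, a, hf, ha, rfl, (hD.dom _ _ (hF' hf)).1 h⟩
    · rintro ⟨f, a, hf, ha, rfl, h⟩
      exact ⟨f, hf, a, ha, rfl, (hD.dom _ _ (hF' hf)).2 h⟩
  · intro p
    rw [mem_rel]
    constructor
    · rintro ⟨q, hq, h, -, rfl, hm⟩
      obtain ⟨f, hf, g, hg, rfl⟩ := mem_prod.1 hq
      exact ⟨f, g, h, hf, hg, rfl, (hD.mul _ _ _ (hF' hf) (hC hg)).1 hm⟩
    · rintro ⟨f, g, h, hf, hg, rfl, hm⟩
      have hm := (hD.mul _ _ _ (hF' hf) (hC hg)).2 hm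
      exact ⟨_, opair_mem_prod.2 ⟨hf, hg⟩, h, D.laws.mul.mem_right hm, rfl, hm⟩

end IsGiraudSite

end ClassCat

/-! ## The class category of sheaves -/

theorem opair₂_inj {a b c a' b' c' : M.V} :
    M.opair a (M.opair b c) = M.opair a' (M.opair b' c') ↔ a = a' ∧ b = b' ∧ c = c' := by
  rw [opair_inj, opair_inj]

theorem opair₃_inj {a b c a' b' c' : M.V} :
    M.opair (M.opair a b) c = M.opair (M.opair a' b') c' ↔ a = a' ∧ b = b' ∧ c = c' := by
  rw [opair_inj, opair_inj, and_assoc]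

theorem isTransform_iff {F γ e F' γ' e' η : M.V} :
    IsTransform (M.opair F (M.opair γ e)) (M.opair F' (M.opair γ' e')) η ↔
      IsFun (M.elts η) (M.elts F) (M.elts F') ∧
      (∀ s t A, M.opair s t ∈ M.elts η → M.opair s A ∈ M.elts γ → M.opair t A ∈ M.elts γ') ∧
      ∀ s t f r q, M.opair s t ∈ M.elts η → M.opair (M.opair s f) r ∈ M.elts e →
        M.opair r q ∈ M.elts η → M.opair (M.opair t f) q ∈ M.elts e' := by
  constructor
  · rintro ⟨F₁, γ₁, e₁, F₂, γ₂, e₂, h₁, h₂, h⟩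
    obtain ⟨rfl, rfl, rfl⟩ := opair₂_inj.1 h₁
    obtain ⟨rfl, rfl, rfl⟩ := opair₂_inj.1 h₂
    exact h
  · exact fun h => ⟨_, _, _, _, _, _, rfl, rfl, h⟩

/-- A total graph contained in a single-valued one with the same domain is equal to it. Hence the
one-sided condition by which composition of transformations is specified determines the composite.
-/
theorem IsFun.ext {η η' : M.V} {A B B' : Set M.V} (h : IsFun (M.elts η) A B)
    (h' : IsFun (M.elts η') A B') (H : ∀ a b, M.opair a b ∈ M.elts η → M.opair a b ∈ M.elts η') :
    η = η' := by
  refine eq_of_elts fun p => ⟨fun hp => ?_, fun hp => ?_⟩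
  · obtain ⟨a, -, b, -, rfl⟩ := h.1 p hp
    exact H a b hp
  · obtain ⟨a, ha, b, -, rfl⟩ := h'.1 p hp
    obtain ⟨c, -, hc⟩ := h.exists ha
    rwa [h'.unique hp (H a c hc)]

namespace IsTransform

theorem exists_app {X Y η s t : M.V} {θ Z : M.V} (h : IsTransform X Y η) (h' : IsTransform Y Z θ)
    (hst : M.opair s t ∈ M.elts η) : ∃ r, M.opair t r ∈ M.elts θ := by
  obtain ⟨F, γ, e, F', γ', e', rfl, rfl, h, -⟩ := h
  obtain ⟨F₁, γ₁, e₁, F₂, γ₂, e₂, e₀, rfl, h', -⟩ := h'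
  obtain ⟨rfl, rfl, rfl⟩ := opair₂_inj.1 e₀
  obtain ⟨r, -, hr⟩ := h'.exists (h.mem_right hst)
  exact ⟨r, hr⟩

theorem app_unique {X Y η s t t' : M.V} (h : IsTransform X Y η) (ht : M.opair s t ∈ M.elts η)
    (ht' : M.opair s t' ∈ M.elts η) : t = t' := by
  obtain ⟨F, γ, e, F', γ', e', rfl, rfl, h, -⟩ := h
  exact h.unique ht ht'

theorem ext {X Y Y' η η' : M.V} (h : IsTransform X Y η) (h' : IsTransform X Y' η')
    (H : ∀ s t, M.opair s t ∈ M.elts η → M.opair s t ∈ M.elts η') : η = η' := by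
  obtain ⟨F, γ, e, F', γ', e', rfl, rfl, h, -⟩ := h
  obtain ⟨F₁, γ₁, e₁, F₂, γ₂, e₂, e₀, rfl, h', -⟩ := h'
  obtain ⟨rfl, rfl, rfl⟩ := opair₂_inj.1 e₀
  exact h.ext h' H

theorem exists_comp {X Y Z η θ : M.V} (h : IsTransform X Y η) (h' : IsTransform Y Z θ) :
    ∃ ζ, IsTransform X Z ζ ∧ ∀ s t r, M.opair s t ∈ M.elts η → M.opair t r ∈ M.elts θ →
      M.opair s r ∈ M.elts ζ := by
  obtain ⟨F, γ, e, F', γ', e', rfl, rfl, h⟩ := h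
  obtain ⟨F₁, γ₁, e₁, F₂, γ₂, e₂, e₀, rfl, h'⟩ := h'
  obtain ⟨rfl, rfl, rfl⟩ := opair₂_inj.1 e₀
  have key : ∀ s r, M.opair s r ∈ M.elts (rel F F₂ fun s r => ∃ t ∈ M.elts F',
      M.opair s t ∈ M.elts η ∧ M.opair t r ∈ M.elts θ) ↔
      ∃ t, M.opair s t ∈ M.elts η ∧ M.opair t r ∈ M.elts θ := fun s r => by
    rw [opair_mem_rel]
    exact ⟨fun ⟨_, _, t, _, h⟩ => ⟨t, h⟩, fun ⟨t, h1, h2⟩ =>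
      ⟨h.1.mem_left h1, h'.1.mem_right h2, t, h.1.mem_right h1, h1, h2⟩⟩
  refine ⟨_, isTransform_iff.2 ⟨isFun_rel ?_, ?_, ?_⟩, fun s t r h1 h2 => (key s r).2 ⟨t, h1, h2⟩⟩
  · intro s hs
    obtain ⟨t, ht, hst⟩ := h.1.exists hs
    obtain ⟨r, hr, htr⟩ := h'.1.exists ht
    refine ⟨r, hr, ⟨t, ht, hst, htr⟩, ?_⟩
    rintro r' - ⟨t', -, hst', htr'⟩
    obtain rfl := h.1.unique hst hst'
    exact h'.1.unique htr' htr
  · intro s r A hsr hs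
    obtain ⟨t, h1, h2⟩ := (key s r).1 hsr
    exact h'.2.1 _ _ _ h2 (h.2.1 _ _ _ h1 hs)
  · intro s r f s' r' hsr hs hsr'
    obtain ⟨t, h1, h2⟩ := (key _ _).1 hsr
    obtain ⟨t', h1', h2'⟩ := (key _ _).1 hsr'
    exact h'.2.2 _ _ _ _ _ h2 (h.2.2 _ _ _ _ _ h1 hs h1') h2'

end IsTransform

namespace SmallCat

variable (C : M.SmallCat) (J : M.V)

theorem IsSheaf.exists_id {C : M.SmallCat} {J X : M.V} (hX : C.IsSheaf J X) :
    ∃ ι, IsTransform X X ι ∧ ∀ s t, M.opair s t ∈ M.elts ι → s = t := by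
  obtain ⟨F, γ, e, rfl, h, -⟩ := hX
  have key : ∀ s t, M.opair s t ∈ M.elts (rel F F fun s t => s = t) ↔ s ∈ M.elts F ∧ s = t := by
    intro s t
    rw [opair_mem_rel]
    exact ⟨fun h => ⟨h.1, h.2.2⟩, by rintro ⟨h, rfl⟩; exact ⟨h, h, rfl⟩⟩
  refine ⟨_, isTransform_iff.2 ⟨isFun_rel fun s hs => ⟨s, hs, rfl, fun t _ ht => ht.symm⟩, ?_, ?_⟩,
    fun s t h => ((key s t).1 h).2⟩
  · intro s t A hst hs
    rwa [← ((key _ _).1 hst).2]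
  · intro s t f r q hst hs hrq
    rwa [← ((key _ _).1 hst).2, ← ((key _ _).1 hrq).2]

/-- The action is a function on a metatheoretic set of pairs. Here this is spelled out with
quantifiers over sets of the model, a form that the instances for `Definable` can process. -/
theorem presheafLaws_iff {F γ e : M.V} : C.PresheafLaws F γ e ↔
    IsFun (M.elts γ) (M.elts F) (M.elts C.ob) ∧
    ((∀ p ∈ M.elts e, ∃ s ∈ M.elts F, ∃ f ∈ M.elts C.ar, ∃ t ∈ M.elts F,
      p = M.opair (M.opair s f) t ∧ ∃ A, M.opair s A ∈ M.elts γ ∧ M.opair f A ∈ M.elts C.cod) ∧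
      ∀ s ∈ M.elts F, ∀ f ∈ M.elts C.ar,
        (∃ A, M.opair s A ∈ M.elts γ ∧ M.opair f A ∈ M.elts C.cod) →
        ∃! t, M.opair (M.opair s f) t ∈ M.elts e) ∧
    (∀ s g t B, M.opair (M.opair s g) t ∈ M.elts e → M.opair g B ∈ M.elts C.dom →
      M.opair t B ∈ M.elts γ) ∧
    (∀ s g h gh t r, M.opair (M.opair g h) gh ∈ M.elts C.mul →
      M.opair (M.opair s g) t ∈ M.elts e → M.opair (M.opair t h) r ∈ M.elts e →
      M.opair (M.opair s gh) r ∈ M.elts e) ∧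
    ∀ s A i, M.opair s A ∈ M.elts γ → M.opair i A ∈ M.elts C.dom →
      (∀ f, M.opair f A ∈ M.elts C.cod → M.opair (M.opair i f) f ∈ M.elts C.mul) →
      M.opair (M.opair s i) s ∈ M.elts e := by
  constructor
  · intro h
    refine ⟨h.1, ⟨fun p hp => ?_, fun s hs f hf hA => h.2.2 _ ⟨s, hs, f, hf, rfl, hA⟩⟩, h.3, h.4,
      h.5⟩
    obtain ⟨q, ⟨s, hs, f, hf, rfl, hA⟩, t, ht, rfl⟩ := h.2.1 p hp
    exact ⟨s, hs, f, hf, t, ht, rfl, hA⟩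
  · rintro ⟨h1, h2, h3, h4, h5⟩
    refine ⟨h1, ⟨fun p hp => ?_, ?_⟩, h3, h4, h5⟩
    · obtain ⟨s, hs, f, hf, t, ht, rfl, hA⟩ := h2.1 p hp
      exact ⟨_, ⟨s, hs, f, hf, rfl, hA⟩, t, ht, rfl⟩
    · rintro _ ⟨s, hs, f, hf, rfl, hA⟩
      exact h2.2 s hs f hf hA

section Definability

variable {C J} {c : ℕ → M.Cls} {Γ : Type u} [Context M Γ] [Rooted M Γ]

-- Weakening of an assumed variable is not an instance, so it is supplied for each quantifier depth
-- at which the variable occurs in the formula.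
set_option synthInstance.maxSize 4000 in
set_option synthInstance.maxHeartbeats 400000 in
instance (F γ e : Γ → M.V) [hF : Var F] [hγ : Var γ] [he : Var e] :
    Definable (M.setTheoretic c) fun g => C.PresheafLaws (F g) (γ g) (e g) := by
  have := hF.comp (fun p : Γ × M.V => p.1)
  have := hF.comp (fun p : (Γ × M.V) × M.V => p.1.1)
  have := hγ.comp (fun p : (((Γ × M.V) × M.V) × M.V) × M.V => p.1.1.1.1)
  have := hγ.comp (fun p : ((Γ × M.V) × M.V) × M.V => p.1.1.1)
  have := he.comp (fun p : ((Γ × M.V) × M.V) × M.V => p.1.1.1)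
  have := he.comp (fun p : (Γ × M.V) × M.V => p.1.1)
  have := he.comp (fun p : (((Γ × M.V) × M.V) × M.V) × M.V => p.1.1.1.1)
  have := he.comp (fun p : (((((Γ × M.V) × M.V) × M.V) × M.V) × M.V) × M.V => p.1.1.1.1.1.1)
  have := hF.comp (fun p : ((Γ × M.V) × M.V) × M.V => p.1.1.1)
  have := hγ.comp (fun p : ((((Γ × M.V) × M.V) × M.V) × M.V) × M.V => p.1.1.1.1.1)
  refine Definable.congr ?_ fun g => C.presheafLaws_iff
  infer_instance

set_option synthInstance.maxSize 4000 in
set_option synthInstance.maxHeartbeats 400000 in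
instance Definable.isSheaf (X : Γ → M.V) [hX : Var X] :
    Definable (M.setTheoretic c) fun g => C.IsSheaf J (X g) := by
  have := hX.comp (fun p : ((Γ × M.V) × M.V) × M.V => p.1.1.1)
  unfold IsSheaf IsMatchingFamily
  infer_instance

instance : Definable (M.setTheoretic c) (C.IsSheaf J) :=
  Definable.isSheaf fun X => X

set_option synthInstance.maxSize 4000 in
set_option synthInstance.maxHeartbeats 400000 in
instance _root_.MTTModel.Definable.isTransform (X Y η : Γ → M.V) [hX : Var X] [hY : Var Y]
    [hη : Var η] : Definable (M.setTheoretic c) fun g => IsTransform (X g) (Y g) (η g) := by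
  have := hX.comp (fun p : (((((Γ × M.V) × M.V) × M.V) × M.V) × M.V) × M.V => p.1.1.1.1.1.1)
  have := hY.comp (fun p : (((((Γ × M.V) × M.V) × M.V) × M.V) × M.V) × M.V => p.1.1.1.1.1.1)
  have := hη.comp (fun p : (((((Γ × M.V) × M.V) × M.V) × M.V) × M.V) × M.V => p.1.1.1.1.1.1)
  have := hη.comp (fun p : ((((((((Γ × M.V) × M.V) × M.V) × M.V) × M.V) × M.V) × M.V) × M.V) × M.V
    => p.1.1.1.1.1.1.1.1.1)
  have := hη.comp (fun p : ((((((((((Γ × M.V) × M.V) × M.V) × M.V) × M.V) × M.V) × M.V) × M.V) ×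
    M.V) × M.V) × M.V => p.1.1.1.1.1.1.1.1.1.1.1)
  unfold IsTransform
  infer_instance

end Definability

/-- The class of sheaves. -/
noncomputable def sheafOb : M.Cls :=
  classOf (fun _ => Classical.choice M.nonempty_Cls) fun X => C.IsSheaf J X

set_option synthInstance.maxSize 4000 in
/-- The class of triples `⟨⟨X, Y⟩, η⟩` with `η` a natural transformation of sheaves. -/
noncomputable def sheafAr : M.Cls :=
  classOf (fun _ => Classical.choice M.nonempty_Cls) fun t =>
    ∃ X Y η, t = M.opair (M.opair X Y) η ∧ C.IsSheaf J X ∧ C.IsSheaf J Y ∧ IsTransform X Y η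

instance _root_.MTTModel.IsParameter.of_const (X : M.Cls) : IsParameter (fun _ => X) X :=
  ⟨0, rfl⟩

/-- The graph of the domain function of the category of sheaves. -/
noncomputable def sheafDom : M.Cls :=
  classOf (fun _ => C.sheafAr J) fun p => ∃ X Y η, M.opair (M.opair X Y) η ∈ M.members (C.sheafAr J) ∧
    p = M.opair (M.opair (M.opair X Y) η) X

/-- The graph of the codomain function of the category of sheaves. -/
noncomputable def sheafCod : M.Cls :=
  classOf (fun _ => C.sheafAr J) fun p => ∃ X Y η, M.opair (M.opair X Y) η ∈ M.members (C.sheafAr J) ∧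
    p = M.opair (M.opair (M.opair X Y) η) Y

set_option synthInstance.maxSize 4000 in
set_option synthInstance.maxHeartbeats 400000 in
/-- The graph of the composition of the category of sheaves. -/
noncomputable def sheafMul : M.Cls :=
  classOf (fun _ => C.sheafAr J) fun p => ∃ g f h,
    p = M.opair (M.opair g f) h ∧ ∃ X Y Z η θ ζ, g = M.opair (M.opair Y Z) θ ∧
    f = M.opair (M.opair X Y) η ∧ h = M.opair (M.opair X Z) ζ ∧
    M.opair (M.opair Y Z) θ ∈ M.members (C.sheafAr J) ∧
    M.opair (M.opair X Y) η ∈ M.members (C.sheafAr J) ∧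
    M.opair (M.opair X Z) ζ ∈ M.members (C.sheafAr J) ∧
    ∀ s t r, M.opair s t ∈ M.elts η → M.opair t r ∈ M.elts θ → M.opair s r ∈ M.elts ζ

section

variable {C J}

theorem mem_sheafOb {X : M.V} : X ∈ M.members (C.sheafOb J) ↔ C.IsSheaf J X := mem_classOf

theorem mem_sheafAr {t : M.V} : t ∈ M.members (C.sheafAr J) ↔ ∃ X Y η,
    t = M.opair (M.opair X Y) η ∧ C.IsSheaf J X ∧ C.IsSheaf J Y ∧ IsTransform X Y η := mem_classOf

theorem opair_mem_sheafAr {X Y η : M.V} : M.opair (M.opair X Y) η ∈ M.members (C.sheafAr J) ↔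
    C.IsSheaf J X ∧ C.IsSheaf J Y ∧ IsTransform X Y η := by
  rw [mem_sheafAr]
  constructor
  · rintro ⟨X', Y', η', e, h⟩
    obtain ⟨rfl, rfl, rfl⟩ := opair₃_inj.1 e
    exact h
  · exact fun h => ⟨_, _, _, rfl, h⟩

theorem opair_mem_sheafDom {X Y η A : M.V} :
    M.opair (M.opair (M.opair X Y) η) A ∈ M.members (C.sheafDom J) ↔
      M.opair (M.opair X Y) η ∈ M.members (C.sheafAr J) ∧ A = X := by
  refine mem_classOf.trans ?_
  constructor
  · rintro ⟨X', Y', η', h, e⟩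
    obtain ⟨e, rfl⟩ := (opair_inj _).1 e
    obtain ⟨rfl, rfl, rfl⟩ := opair₃_inj.1 e
    exact ⟨h, rfl⟩
  · rintro ⟨h, rfl⟩
    exact ⟨_, _, _, h, rfl⟩

theorem opair_mem_sheafCod {X Y η A : M.V} :
    M.opair (M.opair (M.opair X Y) η) A ∈ M.members (C.sheafCod J) ↔
      M.opair (M.opair X Y) η ∈ M.members (C.sheafAr J) ∧ A = Y := by
  refine mem_classOf.trans ?_
  constructor
  · rintro ⟨X', Y', η', h, e⟩
    obtain ⟨e, rfl⟩ := (opair_inj _).1 e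
    obtain ⟨rfl, rfl, rfl⟩ := opair₃_inj.1 e
    exact ⟨h, rfl⟩
  · rintro ⟨h, rfl⟩
    exact ⟨_, _, _, h, rfl⟩

theorem exists_of_sheafMul {g f h : M.V}
    (H : M.opair (M.opair g f) h ∈ M.members (C.sheafMul J)) : ∃ X Y Z η θ ζ,
    g = M.opair (M.opair Y Z) θ ∧ f = M.opair (M.opair X Y) η ∧ h = M.opair (M.opair X Z) ζ ∧
    M.opair (M.opair Y Z) θ ∈ M.members (C.sheafAr J) ∧
    M.opair (M.opair X Y) η ∈ M.members (C.sheafAr J) ∧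
    M.opair (M.opair X Z) ζ ∈ M.members (C.sheafAr J) ∧
    ∀ s t r, M.opair s t ∈ M.elts η → M.opair t r ∈ M.elts θ → M.opair s r ∈ M.elts ζ := by
  obtain ⟨g', f', h', e, H⟩ := mem_classOf.1 H
  obtain ⟨rfl, rfl, rfl⟩ := opair₃_inj.1 e
  exact H

theorem opair_mem_sheafMul {X Y Z η θ ζ : M.V}
    (hθ : M.opair (M.opair Y Z) θ ∈ M.members (C.sheafAr J))
    (hη : M.opair (M.opair X Y) η ∈ M.members (C.sheafAr J))
    (hζ : M.opair (M.opair X Z) ζ ∈ M.members (C.sheafAr J)) :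
    M.opair (M.opair (M.opair (M.opair Y Z) θ) (M.opair (M.opair X Y) η))
      (M.opair (M.opair X Z) ζ) ∈ M.members (C.sheafMul J) ↔
    ∀ s t r, M.opair s t ∈ M.elts η → M.opair t r ∈ M.elts θ → M.opair s r ∈ M.elts ζ := by
  constructor
  · intro H
    obtain ⟨X', Y', Z', η', θ', ζ', h1, h2, h3, -, -, -, h⟩ := exists_of_sheafMul H
    obtain ⟨rfl, rfl, rfl⟩ := opair₃_inj.1 h1
    obtain ⟨rfl, -, rfl⟩ := opair₃_inj.1 h2
    obtain ⟨-, -, rfl⟩ := opair₃_inj.1 h3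
    exact h
  · exact fun h => mem_classOf.2
      ⟨_, _, _, rfl, _, _, _, _, _, _, rfl, rfl, rfl, hθ, hη, hζ, h⟩

end

theorem sheafLaws : M.CatLaws (M.members (C.sheafOb J)) (M.members (C.sheafAr J))
    (M.members (C.sheafDom J)) (M.members (C.sheafCod J)) (M.members (C.sheafMul J)) where
  dom := by
    constructor
    · intro p hp
      obtain ⟨X, Y, η, h, rfl⟩ := mem_classOf.1 hp
      exact ⟨_, h, X, mem_sheafOb.2 (opair_mem_sheafAr.1 h).1, rfl⟩
    · intro t ht
      obtain ⟨X, Y, η, rfl, -⟩ := mem_sheafAr.1 ht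
      exact ⟨X, opair_mem_sheafDom.2 ⟨ht, rfl⟩, fun A hA => (opair_mem_sheafDom.1 hA).2⟩
  cod := by
    constructor
    · intro p hp
      obtain ⟨X, Y, η, h, rfl⟩ := mem_classOf.1 hp
      exact ⟨_, h, Y, mem_sheafOb.2 (opair_mem_sheafAr.1 h).2.1, rfl⟩
    · intro t ht
      obtain ⟨X, Y, η, rfl, -⟩ := mem_sheafAr.1 ht
      exact ⟨Y, opair_mem_sheafCod.2 ⟨ht, rfl⟩, fun A hA => (opair_mem_sheafCod.1 hA).2⟩
  mul := by
    constructor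
    · intro p hp
      obtain ⟨_, _, _, rfl, X, Y, Z, η, θ, ζ, rfl, rfl, rfl, hθ, hη, hζ, -⟩ := mem_classOf.1 hp
      exact ⟨_, ⟨_, hθ, _, hη, rfl, Y, opair_mem_sheafDom.2 ⟨hθ, rfl⟩,
        opair_mem_sheafCod.2 ⟨hη, rfl⟩⟩, _, hζ, rfl⟩
    · rintro _ ⟨g, hg, f, hf, rfl, B, hB, hB'⟩
      obtain ⟨Y, Z, θ, rfl, hY, hZ, hθ⟩ := mem_sheafAr.1 hg
      obtain ⟨X, Y', η, rfl, hX, hY', hη⟩ := mem_sheafAr.1 hf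
      obtain rfl := (opair_mem_sheafDom.1 hB).2
      obtain rfl := (opair_mem_sheafCod.1 hB').2
      obtain ⟨ζ, hζ, h⟩ := hη.exists_comp hθ
      refine ⟨M.opair (M.opair X Z) ζ,
        (opair_mem_sheafMul hg hf (opair_mem_sheafAr.2 ⟨hX, hZ, hζ⟩)).2 h, ?_⟩
      -- A second composite need only contain the first on related elements; both are
      -- transformations with the same source, so their graphs coincide.
      intro k hk
      obtain ⟨X', Y', Z', η', θ', ζ', h1, h2, rfl, -, -, hζ', h'⟩ := exists_of_sheafMul hk
      obtain ⟨rfl, rfl, rfl⟩ := opair₃_inj.1 h1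
      obtain ⟨rfl, -, rfl⟩ := opair₃_inj.1 h2
      have hζ' := (opair_mem_sheafAr.1 hζ').2.2
      rw [hζ'.ext hζ fun s r hs => ?_]
      have hη₀ := hη
      obtain ⟨F, γ, e, F', γ', e', rfl, rfl, hη', -⟩ := hη
      obtain ⟨F₁, γ₁, e₁, F₂, γ₂, e₂, e₀, rfl, hz, -⟩ := hζ'
      obtain ⟨rfl, rfl, rfl⟩ := opair₂_inj.1 e₀
      obtain ⟨t, -, ht⟩ := hη'.exists (hz.mem_left hs)
      obtain ⟨r', hr'⟩ := hη₀.exists_app hθ ht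
      rw [hz.unique hs (h' _ _ _ ht hr')]
      exact h _ _ _ ht hr'
  dom_mul := by
    intro g f h A hm hA
    obtain ⟨X, Y, Z, η, θ, ζ, rfl, rfl, rfl, hθ, hη, hζ, -⟩ := exists_of_sheafMul hm
    exact opair_mem_sheafDom.2 ⟨hζ, (opair_mem_sheafDom.1 hA).2⟩
  cod_mul := by
    intro g f h A hm hA
    obtain ⟨X, Y, Z, η, θ, ζ, rfl, rfl, rfl, hθ, hη, hζ, -⟩ := exists_of_sheafMul hm
    exact opair_mem_sheafCod.2 ⟨hζ, (opair_mem_sheafCod.1 hA).2⟩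
  assoc := by
    intro f g h gf hg k h1 h2 h3
    obtain ⟨X, Y, Z, η, θ, ζ, rfl, rfl, rfl, hθ, hη, hζ, h1⟩ := exists_of_sheafMul h1
    obtain ⟨Y', Z', W, θ', φ, ψ, rfl, e, rfl, hφ, -, hψ, h2⟩ := exists_of_sheafMul h2
    obtain ⟨rfl, rfl, rfl⟩ := opair₃_inj.1 e
    obtain ⟨X', Z', W', ζ', φ', κ, e, e', rfl, -, -, hκ, h3⟩ := exists_of_sheafMul h3
    obtain ⟨rfl, rfl, rfl⟩ := opair₃_inj.1 e
    obtain ⟨rfl, -, rfl⟩ := opair₃_inj.1 e'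
    rw [opair_mem_sheafMul hψ hη hκ]
    intro s t r hst htr
    obtain ⟨u, hu⟩ := (opair_mem_sheafAr.1 hη).2.2.exists_app (opair_mem_sheafAr.1 hθ).2.2 hst
    obtain ⟨v, hv⟩ := (opair_mem_sheafAr.1 hθ).2.2.exists_app (opair_mem_sheafAr.1 hφ).2.2 hu
    rw [(opair_mem_sheafAr.1 hψ).2.2.app_unique htr (h2 _ _ _ hu hv)]
    exact h3 _ _ _ (h1 _ _ _ hst hu) hv
  id := by
    intro X hX
    rw [mem_sheafOb] at hX
    obtain ⟨ι, hι, hι'⟩ := hX.exists_id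
    have hi := opair_mem_sheafAr.2 ⟨hX, hX, hι⟩
    refine ⟨_, hi, opair_mem_sheafDom.2 ⟨hi, rfl⟩, opair_mem_sheafCod.2 ⟨hi, rfl⟩, ?_, ?_⟩
    · intro f hf
      obtain ⟨W, X', η, h, e⟩ := mem_classOf.1 hf
      obtain ⟨rfl, rfl⟩ := (opair_inj _).1 e
      rw [opair_mem_sheafMul hi h h]
      intro s t r hst htr
      rwa [← hι' _ _ htr]
    · intro f hf
      obtain ⟨X', Y, η, h, e⟩ := mem_classOf.1 hf
      obtain ⟨rfl, rfl⟩ := (opair_inj _).1 e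
      rw [opair_mem_sheafMul h hi h]
      intro s t r hst htr
      rwa [hι' _ _ hst]

/-- The class category of sheaves. -/
noncomputable def sheafCat : M.ClassCat where
  ob := C.sheafOb J
  ar := C.sheafAr J
  dom := C.sheafDom J
  cod := C.sheafCod J
  mul := C.sheafMul J
  laws := C.sheafLaws J

theorem isSheafCategory_sheafCat : C.IsSheafCategory J (C.sheafCat J) where
  ob _ := mem_sheafOb
  ar _ := mem_sheafAr
  dom _ _ _ h := opair_mem_sheafDom.2 ⟨h, rfl⟩
  cod _ _ _ h := opair_mem_sheafCod.2 ⟨h, rfl⟩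
  mul X Y Z η θ ζ h := by
    obtain ⟨X', Y', Z', η', θ', ζ', h1, h2, h3, -, -, -, h⟩ := exists_of_sheafMul h
    obtain ⟨rfl, rfl, rfl⟩ := opair₃_inj.1 h1
    obtain ⟨rfl, -, rfl⟩ := opair₃_inj.1 h2
    obtain ⟨-, -, rfl⟩ := opair₃_inj.1 h3
    exact h

end SmallCat

/-! ### Natural transformations as arrows of the sheaf category -/

namespace SmallCat

variable {C : M.SmallCat} {J : M.V}

theorem sheafCat_isSheaf (X : (C.sheafCat J).Obj) : C.IsSheaf J X.1 := mem_sheafOb.1 X.2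

/-- The arrow of sheaves given by a natural transformation. -/
noncomputable def sheafHom {X Y : (C.sheafCat J).Obj} (η : M.V) (h : IsTransform X.1 Y.1 η) :
    X ⟶ Y :=
  have := opair_mem_sheafAr.2 ⟨sheafCat_isSheaf X, sheafCat_isSheaf Y, h⟩
  ⟨M.opair (M.opair X.1 Y.1) η, opair_mem_sheafDom.2 ⟨this, rfl⟩, opair_mem_sheafCod.2 ⟨this, rfl⟩⟩

theorem exists_sheafHom {X Y : (C.sheafCat J).Obj} (f : X ⟶ Y) : ∃ η h, f = sheafHom η h := by
  obtain ⟨X', Y', η, e, -, -, h⟩ := mem_sheafAr.1 ((C.sheafCat J).mem_ar f)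
  have ha := (C.sheafCat J).mem_ar f
  have hd := f.2.1
  have hc := f.2.2
  rw [e] at ha hd hc
  obtain rfl := (opair_mem_sheafDom.1 hd).2
  obtain rfl := (opair_mem_sheafCod.1 hc).2
  exact ⟨η, h, ClassCat.hom_ext e⟩

theorem sheafHom_comp {X Y Z : (C.sheafCat J).Obj} {η θ ζ : M.V} (hη : IsTransform X.1 Y.1 η)
    (hθ : IsTransform Y.1 Z.1 θ) (hζ : IsTransform X.1 Z.1 ζ)
    (h : ∀ s t r, M.opair s t ∈ M.elts η → M.opair t r ∈ M.elts θ → M.opair s r ∈ M.elts ζ) :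
    sheafHom η hη ≫ sheafHom θ hθ = sheafHom ζ hζ :=
  ClassCat.compHom_eq _ ((opair_mem_sheafMul ((C.sheafCat J).mem_ar (sheafHom θ hθ))
    ((C.sheafCat J).mem_ar (sheafHom η hη)) ((C.sheafCat J).mem_ar (sheafHom ζ hζ))).2 h)

/-- Let `η` underlie the identity arrow. As `ι` relates elements only to themselves, the composite
of `ι` with `η` is `η`; but composing with the identity also returns `ι`. -/
theorem sheafHom_eq_id {X : (C.sheafCat J).Obj} {ι : M.V} (hι : IsTransform X.1 X.1 ι)
    (h : ∀ s t, M.opair s t ∈ M.elts ι → s = t) : sheafHom ι hι = 𝟙 X := by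
  obtain ⟨η, hη, e⟩ := exists_sheafHom (𝟙 X)
  rw [← Category.comp_id (sheafHom ι hι), e]
  refine sheafHom_comp _ _ _ fun s t r hst htr => ?_
  rwa [h _ _ hst]

theorem isIso_sheafHom {X Y : (C.sheafCat J).Obj} {η : M.V} (hη : IsTransform X.1 Y.1 η)
    {θ : M.V} (hθ : IsTransform Y.1 X.1 θ)
    (h : ∀ s t, M.opair s t ∈ M.elts η ↔ M.opair t s ∈ M.elts θ) : IsIso (sheafHom η hη) := by
  obtain ⟨ι, hι, hι'⟩ := (sheafCat_isSheaf X).exists_id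
  obtain ⟨κ, hκ, hκ'⟩ := (sheafCat_isSheaf Y).exists_id
  refine ⟨sheafHom θ hθ, ?_, ?_⟩
  · rw [← sheafHom_eq_id hι hι']
    refine sheafHom_comp _ _ _ fun s t r hst htr => ?_
    obtain rfl := hθ.app_unique ((h _ _).1 hst) htr
    obtain ⟨u, hu⟩ := hθ.exists_app hι ((h _ _).1 hst)
    rwa [← hι' _ _ hu] at hu
  · rw [← sheafHom_eq_id hκ hκ']
    refine sheafHom_comp _ _ _ fun s t r hst htr => ?_
    obtain rfl := hη.app_unique ((h _ _).2 hst) htr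
    obtain ⟨u, hu⟩ := hη.exists_app hκ ((h _ _).2 hst)
    rwa [← hκ' _ _ hu] at hu

end SmallCat

/-! ### The Yoneda functor on generators, full and faithful -/

namespace ClassCat

variable {E : M.ClassCat}

/-- The graph `η` is that of composition with `u` on the arrows with domains in `G`. -/
def IsPostcomp (E : M.ClassCat) (G u η : M.V) : Prop :=
  ∀ z, z ∈ M.elts η ↔ ∃ f a h, a ∈ M.elts G ∧ M.opair f a ∈ M.members E.dom ∧
    M.opair (M.opair u f) h ∈ M.members E.mul ∧ z = M.opair f h

namespace IsPostcomp

variable {G η : M.V} {X Y : E.Obj} {u : X ⟶ Y} (h : E.IsPostcomp G u.1 η)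

include h

theorem exists_hom {s t : M.V} (hst : M.opair s t ∈ M.elts η) :
    ∃ (Z : E.Obj) (f : Z ⟶ X), Z.1 ∈ M.elts G ∧ f.1 = s ∧ (f ≫ u).1 = t := by
  obtain ⟨f, a, k, ha, hf, hm, e⟩ := (h _).1 hst
  obtain ⟨rfl, rfl⟩ := (opair_inj _).1 e
  obtain ⟨Z, X', Y', f, u', rfl, e', rfl⟩ := exists_hom_of_mul hm
  obtain ⟨rfl, rfl⟩ := obj_eq_of_hom_eq e'
  obtain rfl := hom_ext e'
  exact ⟨Z, f, opair_mem_dom.1 hf ▸ ha, rfl, rfl⟩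

theorem opair_mem_iff {Z : E.Obj} {f : Z ⟶ X} {k : M.V} :
    M.opair f.1 k ∈ M.elts η ↔ k = (f ≫ u).1 ∧ Z.1 ∈ M.elts G := by
  constructor
  · intro hk
    obtain ⟨Z', f', hZ, e, rfl⟩ := h.exists_hom hk
    have hd := f.2.1
    rw [← e, opair_mem_dom] at hd
    obtain rfl : Z = Z' := Subtype.ext hd
    obtain rfl := hom_ext e
    exact ⟨rfl, hZ⟩
  · rintro ⟨rfl, hZ⟩
    exact (h _).2 ⟨_, _, _, hZ, f.2.1, opair_mem_mul.2 rfl, rfl⟩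

theorem unique {η' : M.V} (h' : E.IsPostcomp G u.1 η') : η = η' :=
  eq_of_elts fun z => (h z).trans (h' z).symm

theorem isTransform {C : M.SmallCat} (hC : E.IsFullSubcategory G C) {F γ e F' γ' e' : M.V}
    (hX : E.IsArrowPresheaf G C X.1 F γ e) (hY : E.IsArrowPresheaf G C Y.1 F' γ' e') :
    IsTransform (M.opair F (M.opair γ e)) (M.opair F' (M.opair γ' e')) η := by
  refine isTransform_iff.2 ⟨⟨?_, ?_⟩, ?_, ?_⟩
  · intro z hz
    obtain ⟨f, a, k, -, -, -, rfl⟩ := (h z).1 hz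
    obtain ⟨Z, f, hZ, rfl, rfl⟩ := h.exists_hom hz
    exact ⟨_, hX.hom_mem_iff.2 hZ, _, hY.hom_mem_iff.2 hZ, rfl⟩
  · intro f hf
    obtain ⟨Z, f, hZ, rfl⟩ := hX.exists_hom hf
    exact ⟨_, h.opair_mem_iff.2 ⟨rfl, hZ⟩, fun k hk => (h.opair_mem_iff.1 hk).1⟩
  · intro s t A hst hA
    obtain ⟨Z, f, hZ, rfl, rfl⟩ := h.exists_hom hst
    exact hY.proj_iff.2 ⟨(hX.proj_iff.1 hA).1, hZ⟩
  · intro s t g r q hst hs hrq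
    obtain ⟨W, Z, f, g, hW, hZ, rfl, rfl, rfl⟩ := hX.exists_hom_of_act hC hs
    obtain rfl := (h.opair_mem_iff.1 hst).1
    obtain rfl := (h.opair_mem_iff.1 hrq).1
    exact (hY.act_iff hC).2 ⟨by rw [Category.assoc], hW, hZ⟩

end IsPostcomp

/-- The classes `ob`, `ar`, `dom`, `cod`, `mul` as parameters. -/
def params (E : M.ClassCat) (X : M.Cls) : ℕ → M.Cls
  | 0 => E.ob
  | 1 => E.dom
  | 2 => E.cod
  | 3 => E.mul
  | _ => X

section Definability

variable {K : M.Cls}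

instance : IsParameter (E.params K) E.ob := ⟨0, rfl⟩
instance : IsParameter (E.params K) E.dom := ⟨1, rfl⟩
instance : IsParameter (E.params K) E.cod := ⟨2, rfl⟩
instance : IsParameter (E.params K) E.mul := ⟨3, rfl⟩
instance : IsParameter (E.params K) K := ⟨4, rfl⟩

variable {Γ : Type u} [Context M Γ] [Rooted M Γ]

set_option synthInstance.maxSize 4000 in
set_option synthInstance.maxHeartbeats 400000 in
instance (G : M.V) (C : M.SmallCat) (X F γ e : Γ → M.V) [hX : Var X] [hF : Var F] [hγ : Var γ]
    [he : Var e] : Definable (M.setTheoretic (E.params K)) fun g =>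
      E.IsArrowPresheaf G C (X g) (F g) (γ g) (e g) := by
  have := hX.comp (fun p : Γ × M.V => p.1)
  have := hF.comp (fun p : Γ × M.V => p.1)
  have := hF.comp (fun p : ((Γ × M.V) × M.V) × M.V => p.1.1.1)
  have := hF.comp (fun p : (((Γ × M.V) × M.V) × M.V) × M.V => p.1.1.1.1)
  have := hγ.comp (fun p : Γ × M.V => p.1)
  have := he.comp (fun p : Γ × M.V => p.1)
  refine Definable.congr ?_ fun g =>
    (⟨fun h => ⟨h.1, h.2, h.3⟩, fun h => ⟨h.1, h.2.1, h.2.2⟩⟩ : E.IsArrowPresheaf _ _ _ _ _ _ ↔ _ ∧ _ ∧ _)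
  infer_instance

set_option synthInstance.maxSize 4000 in
set_option synthInstance.maxHeartbeats 400000 in
instance (G : M.V) (X η : Γ → M.V) [hX : Var X] [hη : Var η] :
    Definable (M.setTheoretic (E.params K)) fun g => E.IsPostcomp G (X g) (η g) := by
  have := hX.comp (fun p : (((Γ × M.V) × M.V) × M.V) × M.V => p.1.1.1.1)
  have := hη.comp (fun p : Γ × M.V => p.1)
  unfold IsPostcomp
  infer_instance

end Definability

variable (E)

set_option synthInstance.maxSize 4000 in
set_option synthInstance.maxHeartbeats 400000 in
/-- The graph of the function sending `X` to the presheaf of arrows to `X`. -/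
noncomputable def yonedaOb (G : M.V) (C : M.SmallCat) : M.Cls :=
  classOf (E.params E.ob) fun p => ∃ X F γ e, p = M.opair X (M.opair F (M.opair γ e)) ∧
    X ∈ M.members E.ob ∧ E.IsArrowPresheaf G C X F γ e

set_option synthInstance.maxSize 4000 in
set_option synthInstance.maxHeartbeats 400000 in
/-- The graph of the function sending `u` to composition with `u`. -/
noncomputable def yonedaAr (G : M.V) (C : M.SmallCat) : M.Cls :=
  classOf (E.params (E.yonedaOb G C)) fun p => ∃ u t, p = M.opair u t ∧
    ∃ X Y hX hY η, t = M.opair (M.opair hX hY) η ∧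
      M.opair u X ∈ M.members E.dom ∧ M.opair u Y ∈ M.members E.cod ∧
      M.opair X hX ∈ M.members (E.yonedaOb G C) ∧ M.opair Y hY ∈ M.members (E.yonedaOb G C) ∧
      E.IsPostcomp G u η

variable {E} {G : M.V} {C : M.SmallCat}

theorem opair_mem_yonedaOb {X : E.Obj} {h : M.V} : M.opair X.1 h ∈ M.members (E.yonedaOb G C) ↔
    ∃ F γ e, h = M.opair F (M.opair γ e) ∧ E.IsArrowPresheaf G C X.1 F γ e := by
  refine mem_classOf.trans ⟨?_, ?_⟩
  · rintro ⟨X', F, γ, e, h₁, hX, h⟩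
    obtain ⟨rfl, rfl⟩ := (opair_inj _).1 h₁
    exact ⟨F, γ, e, rfl, h⟩
  · rintro ⟨F, γ, e, rfl, h⟩
    exact ⟨_, F, γ, e, rfl, X.2, h⟩

theorem mem_yonedaOb {p : M.V} : p ∈ M.members (E.yonedaOb G C) ↔ ∃ (X : E.Obj) (F γ e : M.V),
    p = M.opair X.1 (M.opair F (M.opair γ e)) ∧ E.IsArrowPresheaf G C X.1 F γ e := by
  refine mem_classOf.trans ⟨?_, ?_⟩
  · rintro ⟨X, F, γ, e, h₁, hX, h⟩
    exact ⟨⟨X, hX⟩, F, γ, e, h₁, h⟩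
  · rintro ⟨X, F, γ, e, h₁, h⟩
    exact ⟨X.1, F, γ, e, h₁, X.2, h⟩

theorem mem_yonedaAr {p : M.V} : p ∈ M.members (E.yonedaAr G C) ↔ ∃ (X Y : E.Obj) (u : X ⟶ Y)
    (hX hY η : M.V), p = M.opair u.1 (M.opair (M.opair hX hY) η) ∧
      M.opair X.1 hX ∈ M.members (E.yonedaOb G C) ∧ M.opair Y.1 hY ∈ M.members (E.yonedaOb G C) ∧
      E.IsPostcomp G u.1 η := by
  refine mem_classOf.trans ⟨?_, ?_⟩
  · rintro ⟨u, _, rfl, X, Y, hX, hY, η, rfl, hd, hc, h1, h2, h3⟩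
    exact ⟨⟨X, E.laws.dom.mem_right hd⟩, ⟨Y, E.laws.cod.mem_right hc⟩, ⟨u, hd, hc⟩, hX, hY, η, rfl,
      h1, h2, h3⟩
  · rintro ⟨X, Y, u, hX, hY, η, rfl, h1, h2, h3⟩
    exact ⟨_, _, rfl, X.1, Y.1, hX, hY, η, rfl, u.2.1, u.2.2, h1, h2, h3⟩

theorem opair_mem_yonedaAr {X Y : E.Obj} {u : X ⟶ Y} {t : M.V} :
    M.opair u.1 t ∈ M.members (E.yonedaAr G C) ↔ ∃ hX hY η, t = M.opair (M.opair hX hY) η ∧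
      M.opair X.1 hX ∈ M.members (E.yonedaOb G C) ∧ M.opair Y.1 hY ∈ M.members (E.yonedaOb G C) ∧
      E.IsPostcomp G u.1 η := by
  rw [mem_yonedaAr]
  constructor
  · rintro ⟨X', Y', u', hX, hY, η, e, h1, h2, h3⟩
    obtain ⟨e', rfl⟩ := (opair_inj _).1 e
    obtain ⟨rfl, rfl⟩ := obj_eq_of_hom_eq e'
    obtain rfl := hom_ext e'
    exact ⟨hX, hY, η, rfl, h1, h2, h3⟩
  · rintro ⟨hX, hY, η, rfl, h⟩
    exact ⟨X, Y, u, hX, hY, η, rfl, h⟩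

namespace IsGiraudSite

variable {J : M.V} (H : E.IsGiraudSite G C J)

include H

theorem isFun_yonedaOb : IsFun (M.members (E.yonedaOb G C)) (M.members E.ob)
    (M.members (C.sheafCat J).ob) := by
  constructor
  · intro p hp
    obtain ⟨X, F, γ, e, rfl, h⟩ := mem_yonedaOb.1 hp
    exact ⟨_, X.2, _, SmallCat.mem_sheafOb.2 (H.isSheaf h), rfl⟩
  · intro X hX
    obtain ⟨F, γ, e, h⟩ := H.exists_arrowPresheaf ⟨X, hX⟩
    refine ⟨_, (opair_mem_yonedaOb (X := ⟨X, hX⟩)).2 ⟨F, γ, e, rfl, h⟩, fun h' hh' => ?_⟩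
    obtain ⟨F', γ', e', rfl, h'⟩ := (opair_mem_yonedaOb (X := ⟨X, hX⟩)).1 hh'
    obtain ⟨rfl, rfl, rfl⟩ := h.unique h'
    rfl

theorem exists_isPostcomp {X Y : E.Obj} (u : X ⟶ Y) : ∃ η, E.IsPostcomp G u.1 η := by
  obtain ⟨x, D, hD, hGx, hX, hY⟩ := H.small.exists_span H.mem_ob X Y
  refine ⟨rel D.ar D.ar fun f h => (∃ a ∈ M.elts G, M.opair f a ∈ M.elts D.dom) ∧
    ∃ k ∈ M.elts D.ar, k = u.1 ∧ M.opair (M.opair k f) h ∈ M.elts D.mul, fun z => ?_⟩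
  rw [mem_rel]
  constructor
  · rintro ⟨f, hf, h, hh, rfl, ⟨a, ha, hfa⟩, _, hk, rfl, hm⟩
    exact ⟨f, a, h, ha, (hD.dom _ _ hf).1 hfa, (hD.mul _ _ _ hk hf).1 hm, rfl⟩
  · rintro ⟨f, a, h, ha, hf, hm, rfl⟩
    have hu := hD.hom_mem hX hY u
    obtain ⟨X', rfl⟩ : ∃ Z : E.Obj, Z.1 = a := ⟨⟨a, H.mem_ob a ha⟩, rfl⟩
    obtain ⟨Z, X₁, Y₁, f, u', rfl, e, rfl⟩ := exists_hom_of_mul hm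
    have hd := u.2.1
    rw [← e, opair_mem_dom] at hd
    obtain rfl : X = X₁ := Subtype.ext hd
    obtain rfl : X' = Z := Subtype.ext (opair_mem_dom.1 hf)
    have hf' := hD.hom_mem (hGx _ ha) hX f
    have hm' := (hD.mul _ _ _ hu hf').2 hm
    exact ⟨_, hf', _, D.laws.mul.mem_right hm', rfl, ⟨_, ha, (hD.dom _ _ hf').2 f.2.1⟩, _, hu, rfl,
      hm'⟩

theorem yonedaOb_unique {X h h' : M.V} (hX : M.opair X h ∈ M.members (E.yonedaOb G C))
    (hX' : M.opair X h' ∈ M.members (E.yonedaOb G C)) : h = h' :=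
  H.isFun_yonedaOb.unique hX hX'

theorem isTransform {X Y : E.Obj} {u : X ⟶ Y} {hX hY η : M.V} (h : E.IsPostcomp G u.1 η)
    (h1 : M.opair X.1 hX ∈ M.members (E.yonedaOb G C))
    (h2 : M.opair Y.1 hY ∈ M.members (E.yonedaOb G C)) :
    M.opair (M.opair hX hY) η ∈ M.members (C.sheafAr J) := by
  obtain ⟨F, γ, e, rfl, h3⟩ := opair_mem_yonedaOb.1 h1
  obtain ⟨F', γ', e', rfl, h4⟩ := opair_mem_yonedaOb.1 h2
  exact SmallCat.opair_mem_sheafAr.2 ⟨H.isSheaf h3, H.isSheaf h4, h.isTransform H.full h3 h4⟩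

theorem isFun_yonedaAr : IsFun (M.members (E.yonedaAr G C)) (M.members E.ar)
    (M.members (C.sheafCat J).ar) := by
  constructor
  · intro p hp
    obtain ⟨X, Y, u, hX, hY, η, rfl, h1, h2, h3⟩ := mem_yonedaAr.1 hp
    exact ⟨_, E.mem_ar u, _, H.isTransform h3 h1 h2, rfl⟩
  · intro u hu
    obtain ⟨X, Y, u, rfl⟩ := exists_hom hu
    obtain ⟨hX, -, h1⟩ := H.isFun_yonedaOb.exists X.2
    obtain ⟨hY, -, h2⟩ := H.isFun_yonedaOb.exists Y.2
    obtain ⟨η, h3⟩ := H.exists_isPostcomp u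
    refine ⟨_, opair_mem_yonedaAr.2 ⟨hX, hY, η, rfl, h1, h2, h3⟩, fun t ht => ?_⟩
    obtain ⟨hX', hY', η', rfl, h1', h2', h3'⟩ := opair_mem_yonedaAr.1 ht
    rw [H.yonedaOb_unique h1 h1', H.yonedaOb_unique h2 h2', h3.unique h3']

/-- The functor sending `X` to the sheaf of arrows from the generators to `X`. -/
noncomputable def yoneda : ClassFunctor E (C.sheafCat J) where
  onOb := E.yonedaOb G C
  onAr := E.yonedaAr G C
  isFun_ob := H.isFun_yonedaOb
  isFun_ar := H.isFun_yonedaAr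
  dom := by
    intro f f' a a' hf ha hd
    obtain ⟨X, Y, u, hX, hY, η, e, h1, h2, h3⟩ := mem_yonedaAr.1 hf
    obtain ⟨rfl, rfl⟩ := (opair_inj _).1 e
    obtain rfl := opair_mem_dom.1 hd
    exact SmallCat.opair_mem_sheafDom.2 ⟨H.isTransform h3 h1 h2, H.yonedaOb_unique ha h1⟩
  cod := by
    intro f f' a a' hf ha hd
    obtain ⟨X, Y, u, hX, hY, η, e, h1, h2, h3⟩ := mem_yonedaAr.1 hf
    obtain ⟨rfl, rfl⟩ := (opair_inj _).1 e
    obtain rfl := opair_mem_cod.1 hd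
    exact SmallCat.opair_mem_sheafCod.2 ⟨H.isTransform h3 h1 h2, H.yonedaOb_unique ha h2⟩
  map_id := by
    intro X Y hXY
    obtain ⟨η, hη⟩ := H.exists_isPostcomp (𝟙 X)
    have ht := (SmallCat.opair_mem_sheafAr.1 (H.isTransform hη hXY hXY)).2.2
    have : SmallCat.sheafHom η ht = 𝟙 Y := SmallCat.sheafHom_eq_id ht fun s t hst => by
      obtain ⟨Z, f, -, rfl, rfl⟩ := hη.exists_hom hst
      rw [Category.comp_id]
    exact opair_mem_yonedaAr.2 ⟨_, _, η, (congrArg Subtype.val this).symm, hXY, hXY, hη⟩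
  map_mul := by
    intro g f h g' f' h' hg hf hh hm
    obtain ⟨X, Y, Z, f, g, rfl, rfl, rfl⟩ := exists_hom_of_mul hm
    obtain ⟨hY, hZ, θ, rfl, g1, g2, g3⟩ := opair_mem_yonedaAr.1 hg
    obtain ⟨hX, hY', η, rfl, f1, f2, f3⟩ := opair_mem_yonedaAr.1 hf
    obtain ⟨hX', hZ', ζ, rfl, h1, h2, h3⟩ := opair_mem_yonedaAr.1 hh
    obtain rfl := H.yonedaOb_unique g1 f2
    obtain rfl := H.yonedaOb_unique f1 h1
    obtain rfl := H.yonedaOb_unique g2 h2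
    refine (SmallCat.opair_mem_sheafMul (H.isTransform g3 g1 g2) (H.isTransform f3 f1 g1)
      (H.isTransform h3 f1 g2)).2 fun s t r hst htr => ?_
    obtain ⟨T, a, hT, rfl, rfl⟩ := f3.exists_hom hst
    obtain rfl := (g3.opair_mem_iff.1 htr).1
    exact h3.opair_mem_iff.2 ⟨by rw [Category.assoc], hT⟩

/-- Arrows with the same postcomposition graph agree after every arrow from a generator. -/
theorem yoneda_faithful : H.yoneda.toFunctor.Faithful where
  map_injective {X Y u u'} e := by
    obtain ⟨_, _, η, h₁, -, -, hη⟩ := opair_mem_yonedaAr.1 (H.yoneda.map_spec u)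
    obtain ⟨_, _, η', h₁', -, -, hη'⟩ := opair_mem_yonedaAr.1 (H.yoneda.map_spec u')
    obtain rfl : η = η' := by
      have : (H.yoneda.map u).1 = (H.yoneda.map u').1 := congrArg Subtype.val e
      rw [h₁, h₁'] at this
      exact ((opair_inj _).1 this).2
    refine H.generates _ _ _ _ fun D f hD => hom_ext ?_
    exact (hη'.opair_mem_iff.1 (hη.opair_mem_iff.2 ⟨rfl, hD⟩)).1

/-- A natural transformation assigns to each arrow from a generator to `X` an arrow to `Y`, and
naturality is the compatibility required for gluing these along `X`. -/
theorem yoneda_full : H.yoneda.toFunctor.Full where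
  map_surjective {X Y} φ := by
    obtain ⟨η, hη, rfl⟩ := SmallCat.exists_sheafHom φ
    have hX := H.yoneda.obj_spec X
    have hY := H.yoneda.obj_spec Y
    obtain ⟨F, γ, e, h₁, hF⟩ := opair_mem_yonedaOb.1 hX
    obtain ⟨F', γ', e', h₂, hF'⟩ := opair_mem_yonedaOb.1 hY
    have hη' := hη
    change IsTransform (H.yoneda.obj X).1 (H.yoneda.obj Y).1 η at hη'
    rw [h₁, h₂, isTransform_iff] at hη'
    obtain ⟨t1, t2, t3⟩ := hη'
    have key : ∀ {Z : E.Obj} {f : Z ⟶ X} {k : M.V}, M.opair f.1 k ∈ M.elts η →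
        ∃ k' : Z ⟶ Y, k'.1 = k := by
      intro Z f k hk
      have hZ := hF.hom_mem_iff.1 (t1.mem_left hk)
      obtain ⟨Z', k, -, rfl, e⟩ := hF'.exists_hom_of_proj (t2 _ _ _ hk (hF.proj_iff.2 ⟨rfl, hZ⟩))
      obtain rfl : Z' = Z := Subtype.ext e
      exact ⟨k, rfl⟩
    -- The set `F` of all arrows from generators to `X` is itself the covering family.
    have hfam : IsFamily G X F := fun f hf => hF.exists_hom hf
    obtain ⟨w, hw, -⟩ := H.existsUnique_glue (Y := Y) hfam
      ((H.jointlyEpi_generators X).mono fun f hD => hF.hom_mem_iff.2 hD)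
      (fun f k => M.opair f k ∈ M.elts η) (by
        intro Z f hf
        obtain ⟨k, -, hk⟩ := t1.exists hf
        obtain ⟨k, rfl⟩ := key hk
        exact ⟨k, hk, fun k' hk' => hom_ext (t1.unique hk' hk)⟩) (by
        intro D Z W f g b c k l hD hf hg hk hl hbc
        have h1 : ∀ {Z : E.Obj} {f : Z ⟶ X} {b : D ⟶ Z} {k : Z ⟶ Y}, M.opair f.1 k.1 ∈ M.elts η →
            M.opair (b ≫ f).1 (b ≫ k).1 ∈ M.elts η := by
          intro Z f b k hk
          have hZ := hF.hom_mem_iff.1 (t1.mem_left hk)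
          obtain ⟨r, -, hr⟩ := t1.exists (hF.hom_mem_iff.2 hD : (b ≫ f).1 ∈ M.elts F)
          have := t3 _ _ _ _ _ hk ((hF.act_iff H.full (g := b)).2 ⟨rfl, hD, hZ⟩) hr
          rwa [((hF'.act_iff H.full).1 this).1] at hr
        have h2 := h1 (b := c) hl
        rw [← hbc] at h2
        exact hom_ext (t1.unique (h1 hk) h2))
    have hw' : E.IsPostcomp G w.1 η := by
      intro z
      constructor
      · intro hz
        obtain ⟨f, hf, k, -, rfl⟩ := t1.1 z hz
        obtain ⟨Z, f, hZ, rfl⟩ := hF.exists_hom hf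
        obtain ⟨k, rfl⟩ := key hz
        exact ⟨_, Z.1, _, hZ, f.2.1, opair_mem_mul.2 (congrArg Subtype.val (hw Z f k hf hz).symm),
          rfl⟩
      · rintro ⟨f, a, k, ha, hd, hm, rfl⟩
        obtain ⟨Z, X', Y', f, w', rfl, e, rfl⟩ := exists_hom_of_mul hm
        obtain ⟨rfl, rfl⟩ := obj_eq_of_hom_eq e
        obtain rfl := hom_ext e
        obtain rfl := opair_mem_dom.1 hd
        obtain ⟨k, -, hk⟩ := t1.exists (hF.hom_mem_iff.2 ha : f.1 ∈ M.elts F)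
        obtain ⟨k, rfl⟩ := key hk
        rwa [hw _ f k (t1.mem_left hk) hk]
    refine ⟨w, hom_ext ?_⟩
    exact H.isFun_yonedaAr.unique (H.yoneda.map_spec w)
      (opair_mem_yonedaAr.2 ⟨_, _, η, rfl, hX, hY, hw'⟩)

end IsGiraudSite

end ClassCat

/-! ### Essential surjectivity: every sheaf comes from an object -/

namespace SmallCat.PresheafLaws

variable {E : M.ClassCat} {C : M.SmallCat} {G F γ e : M.V} (hF : C.PresheafLaws F γ e)
  (hC : E.IsFullSubcategory G C)

include hF

theorem act_unique {s f t t' : M.V} (h : M.opair (M.opair s f) t ∈ M.elts e)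
    (h' : M.opair (M.opair s f) t' ∈ M.elts e) : t = t' :=
  hF.isFun_act.unique h h'

include hC

theorem mem_of_proj {s a : M.V} (hs : M.opair s a ∈ M.elts γ) : a ∈ M.elts G :=
  hC.ob ▸ hF.isFun_proj.mem_right hs

theorem exists_act {A B : E.Obj} {s : M.V} (hs : M.opair s A.1 ∈ M.elts γ) (f : B ⟶ A)
    (hB : B.1 ∈ M.elts G) :
    ∃ t, M.opair (M.opair s f.1) t ∈ M.elts e ∧ M.opair t B.1 ∈ M.elts γ := by
  have hA := hF.mem_of_proj hC hs
  obtain ⟨t, -, ht⟩ := hF.isFun_act.exists ⟨s, hF.isFun_proj.mem_left hs, f.1, hC.hom_mem hB hA f,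
    rfl, A.1, hs, hC.opair_mem_cod.2 ⟨rfl, hB, hA⟩⟩
  exact ⟨t, ht, hF.proj_act _ _ _ _ ht (hC.opair_mem_dom.2 ⟨rfl, hB, hA⟩)⟩

theorem act_type {A B : E.Obj} {s t : M.V} {f : B ⟶ A}
    (h : M.opair (M.opair s f.1) t ∈ M.elts e) :
    M.opair s A.1 ∈ M.elts γ ∧ M.opair t B.1 ∈ M.elts γ := by
  obtain ⟨s', hs, f', hf, e₁, a, ha, hc⟩ := hF.isFun_act.mem_left h
  obtain ⟨rfl, rfl⟩ := (opair_inj _).1 e₁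
  obtain ⟨rfl, hB, hA⟩ := hC.opair_mem_cod.1 hc
  exact ⟨ha, hF.proj_act _ _ _ _ h (hC.opair_mem_dom.2 ⟨rfl, hB, hA⟩)⟩

theorem act_comp {A B D : E.Obj} {s t r : M.V} {f : B ⟶ A} {g : D ⟶ B}
    (h : M.opair (M.opair s f.1) t ∈ M.elts e) (h' : M.opair (M.opair t g.1) r ∈ M.elts e) :
    M.opair (M.opair s (g ≫ f).1) r ∈ M.elts e := by
  have h1 := hF.act_type hC h
  have h2 := hF.act_type hC h'
  exact hF.act_mul _ _ _ _ _ _ (hC.opair_mem_mul.2 ⟨rfl, hF.mem_of_proj hC h2.2,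
    hF.mem_of_proj hC h1.2, hF.mem_of_proj hC h1.1⟩) h h'

theorem act_id' {A : E.Obj} {s : M.V} (hs : M.opair s A.1 ∈ M.elts γ) :
    M.opair (M.opair s (𝟙 A : A ⟶ A).1) s ∈ M.elts e := by
  have hA := hF.mem_of_proj hC hs
  refine hF.act_id _ _ _ hs (hC.opair_mem_dom.2 ⟨rfl, hA, hA⟩) fun f hf => ?_
  obtain ⟨B, A', f, hB, -, rfl, h⟩ := hC.exists_hom_of_cod hf
  obtain rfl : A' = A := Subtype.ext h
  exact hC.opair_mem_mul.2 ⟨by rw [Category.comp_id], hB, hA, hA⟩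

end SmallCat.PresheafLaws

/-- The restriction of `s` along `a` is that of `t` along `b`. -/
def Agree (e s a t b : M.V) : Prop :=
  ∃ r, M.opair (M.opair s a) r ∈ M.elts e ∧ M.opair (M.opair t b) r ∈ M.elts e

namespace Agree

theorem symm {e s a t b : M.V} (h : Agree e s a t b) : Agree e t b s a := by
  obtain ⟨r, h1, h2⟩ := h
  exact ⟨r, h2, h1⟩

variable {E : M.ClassCat} {C : M.SmallCat} {G F γ e : M.V}

theorem trans {s a t b u c : M.V} (hF : C.PresheafLaws F γ e) (h : Agree e s a t b)
    (h' : Agree e t b u c) : Agree e s a u c := by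
  obtain ⟨r, h1, h2⟩ := h
  obtain ⟨r', h1', h2'⟩ := h'
  obtain rfl := hF.act_unique h2 h1'
  exact ⟨r, h1, h2'⟩

theorem comp (hF : C.PresheafLaws F γ e) (hC : E.IsFullSubcategory G C) {A B D T : E.Obj}
    {s t : M.V} {a : D ⟶ A} {b : D ⟶ B} (h : Agree e s a.1 t b.1) (g : T ⟶ D)
    (hT : T.1 ∈ M.elts G) : Agree e s (g ≫ a).1 t (g ≫ b).1 := by
  obtain ⟨r, h1, h2⟩ := h
  obtain ⟨q, hq, -⟩ := hF.exists_act hC (hF.act_type hC h1).2 g hT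
  exact ⟨q, hF.act_comp hC h1 hq, hF.act_comp hC h2 hq⟩

end Agree

namespace ClassCat.IsGiraudSite

variable {E : M.ClassCat} {C : M.SmallCat} {G J F γ e ι : M.V} {S : E.Obj}
  (H : E.IsGiraudSite G C J) (hF : C.PresheafLaws F γ e)

include H hF

theorem isFun_proj : IsFun (M.elts γ) (M.elts F) (M.members E.ob) :=
  hF.isFun_proj.mono_right fun a ha => H.mem_ob a (H.full.ob ▸ ha)

set_option synthInstance.maxSize 2000 in
set_option synthInstance.maxHeartbeats 200000 in
/-- The pairs of sections with a common restriction give a relation on the coproduct `S` of the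
objects on which the sections of the presheaf are defined. -/
theorem exists_relation (h : E.IsCoproduct F γ ι S) : ∃ (R : E.Obj) (r₁ r₂ : R ⟶ S),
    JointlyMono₂ r₁ r₂ ∧
    (∀ (s t : M.V) (A B D : E.Obj) (i : A ⟶ S) (j : B ⟶ S) (a : D ⟶ A) (b : D ⟶ B),
      M.opair s i.1 ∈ M.elts ι → M.opair t j.1 ∈ M.elts ι → Agree e s a.1 t b.1 →
      Related r₁ r₂ (a ≫ i) (b ≫ j)) ∧
    ∀ (T : E.Obj) (k : T ⟶ R), JointlyEpi fun {D} (g : D ⟶ T) => D.1 ∈ M.elts G ∧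
      ∃ (s t : M.V) (A B : E.Obj) (i : A ⟶ S) (j : B ⟶ S) (a : D ⟶ A) (b : D ⟶ B),
        M.opair s i.1 ∈ M.elts ι ∧ M.opair t j.1 ∈ M.elts ι ∧ Agree e s a.1 t b.1 ∧
        g ≫ k ≫ r₁ = a ≫ i ∧ g ≫ k ≫ r₂ = b ≫ j := by
  have := H.lim
  have hγ := H.isFun_proj hF
  obtain ⟨x, D, hD, hGx, hS, -⟩ := H.small.exists_span H.mem_ob S S
  let Q : M.V := prod F C.ar
  -- An index is a pair of a pair `⟨s, a⟩` and a pair `⟨t, b⟩` for which `s` along `a` and `t` along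
  -- `b` have the same restriction. Its summand is the object over which that restriction lives, the
  -- common domain of `a` and `b`.
  let N : M.V := rel Q Q fun p q => ∃ r ∈ M.elts F, M.opair p r ∈ M.elts e ∧ M.opair q r ∈ M.elts e
  let B : M.V := rel N G fun n a => ∃ p ∈ M.elts Q, ∃ q ∈ M.elts Q, n = M.opair p q ∧
    ∃ r ∈ M.elts F, M.opair p r ∈ M.elts e ∧ M.opair r a ∈ M.elts γ
  have hB : IsFun (M.elts B) (M.elts N) (M.members E.ob) := by
    refine (isFun_rel ?_).mono_right H.mem_ob
    intro n hn
    obtain ⟨p, hp, q, hq, rfl, r, hr, hpr, hqr⟩ := mem_rel.1 hn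
    obtain ⟨a, ha, hra⟩ := hF.isFun_proj.exists hr
    refine ⟨a, H.full.ob ▸ ha, ⟨p, hp, q, hq, rfl, r, hr, hpr, hra⟩, ?_⟩
    rintro b - ⟨p', -, q', -, e₁, r', -, hpr', hrb⟩
    obtain ⟨rfl, rfl⟩ := (opair_inj _).1 e₁
    obtain rfl := hF.isFun_act.unique hpr hpr'
    exact hF.isFun_proj.unique hrb hra
  have hB₁ : ∀ {n : M.V} {Z : E.Obj}, M.opair n Z.1 ∈ M.elts B → ∃ (s t : M.V) (A A' : E.Obj)
      (a : Z ⟶ A) (b : Z ⟶ A'), n = M.opair (M.opair s a.1) (M.opair t b.1) ∧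
        Agree e s a.1 t b.1 := by
    intro n Z hn
    obtain ⟨hN, hZ, p, hp, q, hq, rfl, r, -, hpr, hrZ⟩ := opair_mem_rel.1 hn
    obtain ⟨-, -, r', -, hpr', hqr⟩ := opair_mem_rel.1 hN
    obtain rfl := hF.isFun_act.unique hpr hpr'
    obtain ⟨s, hs, a, ha, rfl⟩ := mem_prod.1 hp
    obtain ⟨t, ht, b, hb, rfl⟩ := mem_prod.1 hq
    obtain ⟨Z₁, A, a, -, -, rfl⟩ := H.full.exists_hom ha
    obtain ⟨Z₂, A', b, -, -, rfl⟩ := H.full.exists_hom hb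
    obtain rfl : Z = Z₁ := Subtype.ext (hF.isFun_proj.unique hrZ (hF.act_type H.full hpr).2)
    obtain rfl : Z = Z₂ := Subtype.ext (hF.isFun_proj.unique hrZ (hF.act_type H.full hqr).2)
    exact ⟨s, t, A, A', a, b, rfl, r, hpr, hqr⟩
  have hB₂ : ∀ {s t : M.V} {A A' Z : E.Obj} {a : Z ⟶ A} {b : Z ⟶ A'}, Agree e s a.1 t b.1 →
      M.opair (M.opair (M.opair s a.1) (M.opair t b.1)) Z.1 ∈ M.elts B := by
    rintro s t A A' Z a b ⟨r, h1, h2⟩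
    have h3 := hF.act_type H.full h1
    have h4 := hF.act_type H.full h2
    have hr := hF.isFun_proj.mem_left h3.2
    have hG : ∀ {s : M.V} {A : E.Obj}, M.opair s A.1 ∈ M.elts γ → A.1 ∈ M.elts G :=
      fun h => hF.mem_of_proj H.full h
    have hp : M.opair s a.1 ∈ M.elts Q := opair_mem_prod.2
      ⟨hF.isFun_proj.mem_left h3.1, H.full.hom_mem (hG h3.2) (hG h3.1) a⟩
    have hq : M.opair t b.1 ∈ M.elts Q := opair_mem_prod.2
      ⟨hF.isFun_proj.mem_left h4.1, H.full.hom_mem (hG h4.2) (hG h4.1) b⟩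
    exact opair_mem_rel.2 ⟨opair_mem_rel.2 ⟨hp, hq, r, hr, h1, h2⟩, hG h3.2, _, hp, _, hq, rfl, r, hr,
      h1, h3.2⟩
  obtain ⟨κ, W, hW⟩ := H.coprod.exists_coproduct _ _ hB
  -- Both legs of the relation are built by this one construction: `μ` selects the first or the
  -- second component of an index, and the leg is `a` followed by the injection at `s` for the
  -- selected `⟨s, a⟩`.
  have hdesc : ∀ μ : M.V, (∀ (n : M.V) (Z : E.Obj), M.opair n Z.1 ∈ M.elts B →
      ∃ (s : M.V) (A : E.Obj) (a : Z ⟶ A), M.opair s A.1 ∈ M.elts γ ∧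
        ∀ p, M.opair n p ∈ M.elts μ ↔ p = M.opair s a.1) →
      ∃ k : W ⟶ S, ∀ (n s : M.V) (Z A : E.Obj) (c : Z ⟶ W) (a : Z ⟶ A) (i : A ⟶ S),
        M.opair n c.1 ∈ M.elts κ → M.opair n (M.opair s a.1) ∈ M.elts μ →
        M.opair s i.1 ∈ M.elts ι → c ≫ k = a ≫ i := by
    intro μ hμ
    have key : ∀ {n s : M.V} {Z A : E.Obj} {a : Z ⟶ A} {i : A ⟶ S}, M.opair n Z.1 ∈ M.elts B →
        M.opair n (M.opair s a.1) ∈ M.elts μ → M.opair s i.1 ∈ M.elts ι →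
        ∃ s ∈ M.elts F, ∃ a ∈ M.elts C.ar, M.opair n (M.opair s a) ∈ M.elts μ ∧
          ∃ i ∈ M.elts D.ar, M.opair s i ∈ M.elts ι ∧
            M.opair (M.opair i a) (‹Z ⟶ A› ≫ ‹A ⟶ S›).1 ∈ M.elts D.mul := by
      intro n s Z A a i hn hs hi
      have hsA := h.1.mem_iff hi
      have hA := hF.mem_of_proj H.full hsA
      have hZ := (opair_mem_rel.1 hn).2.1
      exact ⟨s, hF.isFun_proj.mem_left hsA, a.1, H.full.hom_mem hZ hA a, hs, i.1,
        hD.hom_mem (hGx _ hA) hS i, hi, hD.opair_mem_mul.2 ⟨rfl, hGx _ hZ, hGx _ hA, hS⟩⟩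
    obtain ⟨k, hk⟩ := hW.exists_desc hB H.small S (fun n k => ∃ s ∈ M.elts F, ∃ a ∈ M.elts C.ar,
        M.opair n (M.opair s a) ∈ M.elts μ ∧ ∃ i ∈ M.elts D.ar, M.opair s i ∈ M.elts ι ∧
          M.opair (M.opair i a) k ∈ M.elts D.mul) (by
      intro n Z hn
      obtain ⟨s, A, a, hs, hp⟩ := hμ n Z hn
      obtain ⟨i, hi⟩ := h.1.exists_inj hγ hs
      refine ⟨a ≫ i, key hn ((hp _).2 rfl) hi, ?_⟩
      rintro k ⟨s', -, a', -, hp', i', -, hi', hm⟩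
      obtain ⟨rfl, rfl⟩ := (opair_inj _).1 ((hp _).1 hp')
      obtain rfl := h.1.1.unique hi hi'
      exact hom_ext (hD.opair_mem_mul.1 hm).1)
    exact ⟨k, fun n s Z A c a i hc hs hi =>
      hk n Z c (a ≫ i) hc (key (hW.1.mem_iff hc) hs hi)⟩
  have hN : ∀ {n a}, M.opair n a ∈ M.elts B → n ∈ M.elts N := fun h => hB.mem_left h
  have hQ : ∀ {p q}, M.opair p q ∈ M.elts N → p ∈ M.elts Q ∧ q ∈ M.elts Q :=
    fun h => ⟨(opair_mem_rel.1 h).1, (opair_mem_rel.1 h).2.1⟩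
  obtain ⟨w₁, hw₁⟩ := hdesc (rel N Q fun n p => ∃ q ∈ M.elts Q, n = M.opair p q) (by
    intro n Z hn
    obtain ⟨s, t, A, A', a, b, rfl, r, h1, h2⟩ := hB₁ hn
    refine ⟨s, A, a, (hF.act_type H.full h1).1, fun p => ?_⟩
    rw [opair_mem_rel]
    constructor
    · rintro ⟨-, -, q, -, e₁⟩
      exact ((opair_inj _).1 e₁).1.symm
    · rintro rfl
      exact ⟨hN hn, (hQ (hN hn)).1, _, (hQ (hN hn)).2, rfl⟩)
  obtain ⟨w₂, hw₂⟩ := hdesc (rel N Q fun n q => ∃ p ∈ M.elts Q, n = M.opair p q) (by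
    intro n Z hn
    obtain ⟨s, t, A, A', a, b, rfl, r, h1, h2⟩ := hB₁ hn
    refine ⟨t, A', b, (hF.act_type H.full h2).1, fun p => ?_⟩
    rw [opair_mem_rel]
    constructor
    · rintro ⟨-, -, q, -, e₁⟩
      exact ((opair_inj _).1 e₁).2.symm
    · rintro rfl
      exact ⟨hN hn, (hQ (hN hn)).2, _, (hQ (hN hn)).1, rfl⟩)
  have hw : ∀ {s t : M.V} {A A' Z : E.Obj} {a : Z ⟶ A} {b : Z ⟶ A'} {i : A ⟶ S} {j : A' ⟶ S}
      {c : Z ⟶ W}, M.opair (M.opair (M.opair s a.1) (M.opair t b.1)) c.1 ∈ M.elts κ →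
      M.opair s i.1 ∈ M.elts ι → M.opair t j.1 ∈ M.elts ι → c ≫ w₁ = a ≫ i ∧ c ≫ w₂ = b ≫ j := by
    intro s t A A' Z a b i j c hc hi hj
    have hn := hB.mem_left (hW.1.mem_iff hc)
    exact ⟨hw₁ _ s Z A c a i hc (opair_mem_rel.2 ⟨hn, (hQ hn).1, _, (hQ hn).2, rfl⟩) hi,
      hw₂ _ t Z A' c b j hc (opair_mem_rel.2 ⟨hn, (hQ hn).2, _, (hQ hn).1, rfl⟩) hj⟩
  obtain ⟨R, r₁, r₂, q, hq, hr, rfl, rfl⟩ := exists_image_pair H.quot w₁ w₂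
  have := hq.epi
  refine ⟨R, r₁, r₂, hr, ?_, ?_⟩
  · intro s t A A' Z i j a b hi hj hab
    obtain ⟨c, hc⟩ := hW.1.exists_inj hB (hB₂ hab)
    obtain ⟨h1, h2⟩ := hw hc hi hj
    exact ⟨c ≫ q, by rw [Category.assoc, h1], by rw [Category.assoc, h2]⟩
  · intro T k
    -- An element of the image `R` comes locally from a summand of `W`, and so from a pair of
    -- sections with a common restriction.
    refine (H.jointlyEpi_factor hB hW q k).mono ?_
    rintro Z g ⟨hZ, n, Z', c, z, hc, hg⟩
    obtain ⟨s, t, A, A', a, b, rfl, hab⟩ := hB₁ (hW.1.mem_iff hc)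
    have hst := hab
    obtain ⟨r, h1, h2⟩ := hst
    obtain ⟨i, hi⟩ := h.1.exists_inj hγ (hF.act_type H.full h1).1
    obtain ⟨j, hj⟩ := h.1.exists_inj hγ (hF.act_type H.full h2).1
    obtain ⟨h3, h4⟩ := hw hc hi hj
    refine ⟨hZ, s, t, A, A', i, j, z ≫ a, z ≫ b, hi, hj, hab.comp hF H.full z hZ, ?_, ?_⟩
    · rw [reassoc_of% hg, h3, Category.assoc]
    · rw [reassoc_of% hg, h4, Category.assoc]

end ClassCat.IsGiraudSite

namespace ClassCat.IsGiraudSite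

variable {E : M.ClassCat} {C : M.SmallCat} {G J F γ e ι : M.V} {S : E.Obj}
  (H : E.IsGiraudSite G C J) (hF : C.PresheafLaws F γ e)

include H hF

/-- Distinct sections have disjoint summands, so on a noninitial test object equality in `S` forces
equal sections, and then equal arrows since the injection is monic. -/
theorem agree_of_eq (h : E.IsCoproduct F γ ι S) {s t : M.V} {A B D : E.Obj} {i : A ⟶ S} {j : B ⟶ S}
    {a : D ⟶ A} {b : D ⟶ B} (hi : M.opair s i.1 ∈ M.elts ι) (hj : M.opair t j.1 ∈ M.elts ι)
    (hD : D.1 ∈ M.elts G) (hD' : IsEmpty (IsInitial D)) (hab : a ≫ i = b ≫ j) :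
    Agree e s a.1 t b.1 := by
  have := H.lim
  have hγ := H.isFun_proj hF
  obtain rfl : s = t := by
    by_contra hst
    exact hD'.false (H.coprod.isInitial_of_eq hγ h hst hi hj hab).some
  obtain rfl : A = B := Subtype.ext (hγ.unique (h.1.mem_iff hi) (h.1.mem_iff hj))
  obtain rfl := hom_ext (h.1.1.unique hi hj)
  have := H.coprod.mono _ _ _ _ hγ h _ _ _ hi
  obtain rfl := (cancel_mono i).1 hab
  obtain ⟨r, hr, -⟩ := hF.exists_act H.full (h.1.mem_iff hi) a hD
  exact ⟨r, hr, hr⟩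

/-- The gluing of a presheaf: a quotient `X` of the coproduct of the objects on which its sections
are defined. -/
theorem exists_gluing (h : E.IsCoproduct F γ ι S) : ∃ (X : E.Obj) (π : S ⟶ X), Epi π ∧
    (∀ (s t : M.V) (A B D : E.Obj) (i : A ⟶ S) (j : B ⟶ S) (a : D ⟶ A) (b : D ⟶ B),
      M.opair s i.1 ∈ M.elts ι → M.opair t j.1 ∈ M.elts ι → Agree e s a.1 t b.1 →
      a ≫ i ≫ π = b ≫ j ≫ π) ∧
    ∀ (s t : M.V) (A : E.Obj) (i j : A ⟶ S), M.opair s i.1 ∈ M.elts ι →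
      M.opair t j.1 ∈ M.elts ι → i ≫ π = j ≫ π →
      JointlyEpi fun {D} (g : D ⟶ A) => D.1 ∈ M.elts G ∧ Agree e s g.1 t g.1 := by
  have := H.lim
  have hγ := H.isFun_proj hF
  obtain ⟨R, r₁, r₂, hr, h1, h2⟩ := H.exists_relation hF h
  -- The relation is already given by a jointly monic pair, so the cover in `exists_quotient` is the
  -- identity of `R`. All three properties are checked locally on `S` or on related pairs.
  obtain ⟨X, π, hπ, hπ'⟩ := exists_quotient H.quot (r₁ := r₁) (r₂ := r₂) (H.uEpi (𝟙 R)) (by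
    refine .of_jointlyEpi H.isIso_of_mono_epi (H.coprod.jointlyEpi H.small hγ h (𝟙 S)) ?_
    rintro D g ⟨s, A, i, b, hi, hg⟩
    have hs := h.1.mem_iff hi
    have := h1 s s A A A i i (𝟙 A) (𝟙 A) hi hi ⟨s, hF.act_id' H.full hs, hF.act_id' H.full hs⟩
    rw [hg]
    simpa using this.comp b) (by
    refine .of_jointlyEpi H.isIso_of_mono_epi (h2 R (𝟙 R)) ?_
    rintro D g ⟨hD, s, t, A, B, i, j, a, b, hi, hj, hab, e₁, e₂⟩
    rw [e₁, e₂]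
    exact h1 t s B A D j i b a hj hi hab.symm) (by
    intro T x y hxy
    rw [Category.id_comp, Category.id_comp] at *
    refine .of_jointlyEpi H.isIso_of_mono_epi (h2 T x) ?_
    rintro D g ⟨hD, s, t, A, B, i, j, a, b, hi, hj, hab, e₁, e₂⟩
    refine .of_jointlyEpi H.isIso_of_mono_epi (h2 D (g ≫ y)).nonInitial ?_
    rintro D' g' ⟨⟨hD', s', t', A', B', i', j', a', b', hi', hj', hab', e₁', e₂'⟩, hn⟩
    have h3 : (g' ≫ b) ≫ j = a' ≫ i' := by
      rw [← e₁', Category.assoc, ← e₂, hxy, Category.assoc]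
    -- The middle entries are equal in `S`, hence agree as restrictions by `agree_of_eq`, and the
    -- two agreements can be chained.
    have h4 := ((hab.comp hF H.full g' hD').trans hF
      (H.agree_of_eq hF h hj hi' hD' hn h3)).trans hF hab'
    rw [e₁, ← Category.assoc g y, e₂', ← Category.assoc]
    exact h1 s t' A B' D' i j' (g' ≫ a) b' hi hj' h4)
  refine ⟨X, π, hπ.epi, ?_, ?_⟩
  · intro s t A B D i j a b hi hj hab
    rw [← Category.assoc, ← Category.assoc, hπ']
    exact h1 s t A B D i j a b hi hj hab
  · intro s t A i j hi hj hij
    obtain ⟨k, rfl, rfl⟩ := (hπ' _ _ _).1 hij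
    refine (h2 A k).nonInitial.mono ?_
    rintro D g ⟨⟨hD, s', t', A', B', i', j', a, b, hi', hj', hab, e₁, e₂⟩, hn⟩
    exact ⟨hD, ((H.agree_of_eq hF h hi hi' hD hn e₁).trans hF hab).trans hF
      (H.agree_of_eq hF h hj hj' hD hn e₂).symm⟩

end ClassCat.IsGiraudSite

theorem SmallCat.PresheafLaws.exists_inverse {C : M.SmallCat} {F γ e F' γ' e' η : M.V}
    (hF : C.PresheafLaws F γ e) (hF' : C.PresheafLaws F' γ' e')
    (h : IsTransform (M.opair F (M.opair γ e)) (M.opair F' (M.opair γ' e')) η)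
    (hinj : ∀ s t r, M.opair s r ∈ M.elts η → M.opair t r ∈ M.elts η → s = t)
    (hsurj : ∀ t ∈ M.elts F', ∃ s, M.opair s t ∈ M.elts η) :
    ∃ θ, IsTransform (M.opair F' (M.opair γ' e')) (M.opair F (M.opair γ e)) θ ∧
      ∀ s t, M.opair s t ∈ M.elts η ↔ M.opair t s ∈ M.elts θ := by
  obtain ⟨h1, h2, h3⟩ := isTransform_iff.1 h
  have key : ∀ s t, M.opair s t ∈ M.elts η ↔
      M.opair t s ∈ M.elts (rel F' F fun t s => M.opair s t ∈ M.elts η) := fun s t => by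
    rw [opair_mem_rel]
    exact ⟨fun h => ⟨h1.mem_right h, h1.mem_left h, h⟩, fun h => h.2.2⟩
  refine ⟨_, isTransform_iff.2 ⟨isFun_rel fun t ht => ?_, ?_, ?_⟩, key⟩
  · obtain ⟨s, hs⟩ := hsurj t ht
    exact ⟨s, h1.mem_left hs, hs, fun s' _ hs' => hinj _ _ _ hs' hs⟩
  · intro t s A hts hA
    rw [← key] at hts
    obtain ⟨B, -, hB⟩ := hF.isFun_proj.exists (h1.mem_left hts)
    rwa [hF'.isFun_proj.unique hA (h2 _ _ _ hts hB)]
  · intro t s f r q hts htr hrq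
    rw [← key] at hts hrq
    obtain ⟨t', -, f', hf, e₁, A, hA, hfA⟩ := hF'.isFun_act.mem_left htr
    obtain ⟨rfl, rfl⟩ := (opair_inj _).1 e₁
    obtain ⟨B, -, hB⟩ := hF.isFun_proj.exists (h1.mem_left hts)
    obtain rfl := hF'.isFun_proj.unique hA (h2 _ _ _ hts hB)
    -- Naturality of the inverse: the image of the restriction of `s` is the restriction of `t`, and
    -- injectivity identifies that restriction with the given preimage.
    obtain ⟨q', hq', hsq⟩ := hF.isFun_act.exists ⟨s, h1.mem_left hts, f, hf, rfl, A, hB, hfA⟩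
    obtain ⟨r', -, hr'⟩ := h1.exists hq'
    obtain rfl := hF'.isFun_act.unique htr (h3 _ _ _ _ _ hts hsq hr')
    rwa [hinj _ _ _ hrq hr']

namespace ClassCat

variable {E : M.ClassCat} {C : M.SmallCat} {G J F γ e ι : M.V}

theorem IsFullSubcategory.isSieve (hC : E.IsFullSubcategory G C) {A : E.Obj} {R : M.V}
    (hR : ∀ f ∈ M.elts R, M.opair f A.1 ∈ M.elts C.cod)
    (h : ∀ (D D' : E.Obj) (f : D ⟶ A) (g : D' ⟶ D), D'.1 ∈ M.elts G → f.1 ∈ M.elts R →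
      (g ≫ f).1 ∈ M.elts R) : C.IsSieve A.1 R := by
  refine ⟨hR, fun f g k hf hm => ?_⟩
  obtain ⟨D, A', f, hD, hA, rfl, e⟩ := hC.exists_hom_of_cod (hR f hf)
  obtain rfl : A' = A := Subtype.ext e
  obtain ⟨D', D₁, A₁, g, f', hD', -, -, rfl, e, rfl⟩ := hC.exists_hom_of_mul hm
  obtain ⟨rfl, rfl⟩ := obj_eq_of_hom_eq e
  obtain rfl := hom_ext e
  exact h _ _ _ _ hD' hf

namespace IsGiraudSite

variable (H : E.IsGiraudSite G C J) (hF : C.PresheafLaws F γ e)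
  (hS : ∀ A R x, M.opair A R ∈ M.elts J → C.IsMatchingFamily F γ e R x →
    ∃! s, M.opair s A ∈ M.elts γ ∧
      ∀ f t, M.opair f t ∈ M.elts x → M.opair (M.opair s f) t ∈ M.elts e)

include H hF hS

/-- The sheaf axiom for a family given by a bounded formula and indexed by arrows of `E`; separation
turns the formula into the set-sized matching family that the axiom speaks of. -/
theorem existsUnique_section {A : E.Obj} {R : M.V} (hA : A.1 ∈ M.elts G) (hR : C.IsSieve A.1 R)
    (hc : Covers A R) (P : M.V → M.V → Prop)
    [Definable M.bounded fun q : (M.V × M.V) × M.V => P q.1.2 q.2]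
    (hP : ∀ (D : E.Obj) (f : D ⟶ A), f.1 ∈ M.elts R → ∃ s, M.opair s D.1 ∈ M.elts γ ∧ P f.1 s ∧
      ∀ t, P f.1 t → t = s)
    (hcomp : ∀ (D D' : E.Obj) (f : D ⟶ A) (g : D' ⟶ D) (s t : M.V), f.1 ∈ M.elts R → P f.1 s →
      M.opair (M.opair s g.1) t ∈ M.elts e → P (g ≫ f).1 t) :
    ∃! s, M.opair s A.1 ∈ M.elts γ ∧ ∀ (D : E.Obj) (f : D ⟶ A) (t : M.V), f.1 ∈ M.elts R →
      P f.1 t → M.opair (M.opair s f.1) t ∈ M.elts e := by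
  have hfam := H.isFamily hR
  have hx : ∀ {D : E.Obj} {f : D ⟶ A} {t : M.V},
      M.opair f.1 t ∈ M.elts (rel R F P) ↔ f.1 ∈ M.elts R ∧ P f.1 t := by
    intro D f t
    rw [opair_mem_rel]
    refine ⟨fun h => ⟨h.1, h.2.2⟩, fun h => ⟨h.1, ?_, h.2⟩⟩
    obtain ⟨s, hs, -, hs'⟩ := hP D f h.1
    rw [hs' t h.2]
    exact hF.isFun_proj.mem_left hs
  have hmatch : C.IsMatchingFamily F γ e R (rel R F P) := by
    refine ⟨isFun_rel fun f hf => ?_, ?_, ?_⟩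
    · obtain ⟨D, f, hD, rfl⟩ := hfam f hf
      obtain ⟨s, hs, hs', h⟩ := hP D f hf
      exact ⟨s, hF.isFun_proj.mem_left hs, hs', fun t _ ht => h t ht⟩
    · intro f s B hfs hB
      obtain ⟨D, f, hD, rfl⟩ := hfam f (opair_mem_rel.1 hfs).1
      obtain ⟨hf, hs⟩ := hx.1 hfs
      obtain ⟨s', hs', -, h⟩ := hP D f hf
      obtain rfl := h s hs
      rwa [(H.full.opair_mem_dom.1 hB).1]
    · intro f g k s t hm hfs hkt
      obtain ⟨D, f, hD, rfl⟩ := hfam f (opair_mem_rel.1 hfs).1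
      obtain ⟨D', D₁, A₁, g, f', hD', -, -, rfl, e', rfl⟩ := H.full.exists_hom_of_mul hm
      obtain ⟨rfl, rfl⟩ := obj_eq_of_hom_eq e'
      obtain rfl := hom_ext e'
      obtain ⟨hf, hs⟩ := hx.1 hfs
      obtain ⟨hk, ht⟩ := hx.1 hkt
      obtain ⟨s', hs', -, h⟩ := hP _ _ hf
      obtain rfl := h s hs
      obtain ⟨r, hr, -⟩ := hF.exists_act H.full hs' g hD'
      obtain ⟨r', -, -, h'⟩ := hP D' _ hk
      rwa [h' t ht, ← h' r (hcomp _ _ _ _ _ _ hf hs hr)]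
  obtain ⟨s, ⟨hs, hs'⟩, hu⟩ := hS A.1 R _ ((H.mem_iff A R hA).2 ⟨hR, hc⟩) hmatch
  refine ⟨s, ⟨hs, fun D f t hf ht => hs' _ _ (hx.2 ⟨hf, ht⟩)⟩, fun s' h => hu s' ⟨h.1, ?_⟩⟩
  intro f t hft
  obtain ⟨D, f, hD, rfl⟩ := hfam f (opair_mem_rel.1 hft).1
  obtain ⟨hf, ht⟩ := hx.1 hft
  exact h.2 D f t hf ht

/-- The arrows along which `s` and `t` have the same restriction form a covering sieve, and both
sections amalgamate the restrictions of `s` to it. -/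
theorem eq_of_agree {A : E.Obj} {s t : M.V} (hs : M.opair s A.1 ∈ M.elts γ)
    (ht : M.opair t A.1 ∈ M.elts γ)
    (hc : JointlyEpi fun {D} (g : D ⟶ A) => D.1 ∈ M.elts G ∧ Agree e s g.1 t g.1) : s = t := by
  have hA := hF.mem_of_proj H.full hs
  have hR : ∀ {D : E.Obj} {g : D ⟶ A}, g.1 ∈ M.elts (sep C.ar fun g => M.opair g A.1 ∈ M.elts C.cod ∧
      ∃ r ∈ M.elts F, M.opair (M.opair s g) r ∈ M.elts e ∧ M.opair (M.opair t g) r ∈ M.elts e) ↔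
      D.1 ∈ M.elts G ∧ Agree e s g.1 t g.1 := by
    intro D g
    rw [mem_sep]
    constructor
    · rintro ⟨hg, -, r, -, h⟩
      exact ⟨(H.full.hom_mem_iff.1 hg).1, r, h⟩
    · rintro ⟨hD, r, h⟩
      exact ⟨H.full.hom_mem hD hA g, H.full.opair_mem_cod.2 ⟨rfl, hD, hA⟩, r,
        hF.isFun_act.mem_right h.1, h⟩
  refine (H.existsUnique_section hF hS hA (H.full.isSieve (fun f hf => (mem_sep.1 hf).2.1) ?_)
    (hc.mono fun g hg => hR.2 hg) (fun f r => M.opair (M.opair s f) r ∈ M.elts e) ?_ ?_).unique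
    ⟨hs, fun D f r _ hr => hr⟩ ⟨ht, fun D f r hf hr => ?_⟩
  · intro D D' f g hD' hf
    exact hR.2 ⟨hD', (hR.1 hf).2.comp hF H.full g hD'⟩
  · intro D f hf
    obtain ⟨r, hr, h⟩ := hF.exists_act H.full hs f (hR.1 hf).1
    exact ⟨r, h, hr, fun q hq => hF.act_unique hq hr⟩
  · intro D D' f g r q hf hr hq
    exact hF.act_comp H.full hr hq
  · obtain ⟨-, r', h1, h2⟩ := hR.1 hf
    rwa [hF.act_unique hr h1]

/-- The object is the gluing `X` of the presheaf, and the transformation sends `s` to the injection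
at `s` followed by `π`. Only here does the sheaf condition enter the construction: separatedness
gives injectivity and amalgamation gives surjectivity. -/
theorem exists_isIso : ∃ (X : E.Obj) (F' γ' e' η θ : M.V), E.IsArrowPresheaf G C X.1 F' γ' e' ∧
    IsTransform (M.opair F (M.opair γ e)) (M.opair F' (M.opair γ' e')) η ∧
    IsTransform (M.opair F' (M.opair γ' e')) (M.opair F (M.opair γ e)) θ ∧
    ∀ s t, M.opair s t ∈ M.elts η ↔ M.opair t s ∈ M.elts θ := by
  have hγ := H.isFun_proj hF
  obtain ⟨ι, S, h⟩ := H.coprod.exists_coproduct _ _ hγ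
  obtain ⟨X, π, hπ, h1, h2⟩ := H.exists_gluing hF h
  obtain ⟨F', γ', e', hX⟩ := H.exists_arrowPresheaf X
  obtain ⟨x, D, hD, hGx, hSx, hXx⟩ := H.small.exists_span H.mem_ob S X
  let η : M.V := rel F F' fun s u => ∃ i ∈ M.elts D.ar, M.opair s i ∈ M.elts ι ∧
    M.opair (M.opair π.1 i) u ∈ M.elts D.mul
  have hη : ∀ s u, M.opair s u ∈ M.elts η ↔
      ∃ (A : E.Obj) (i : A ⟶ S), M.opair s i.1 ∈ M.elts ι ∧ u = (i ≫ π).1 := by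
    intro s u
    rw [opair_mem_rel]
    constructor
    · rintro ⟨-, -, i, -, hi, hm⟩
      obtain ⟨A, i, rfl⟩ := h.1.exists_hom hi
      exact ⟨A, i, hi, (hD.opair_mem_mul.1 hm).1⟩
    · rintro ⟨A, i, hi, rfl⟩
      have hs := h.1.mem_iff hi
      have hA := hF.mem_of_proj H.full hs
      exact ⟨hγ.mem_left hs, hX.hom_mem_iff.2 hA, i.1, hD.hom_mem (hGx _ hA) hSx i, hi,
        hD.opair_mem_mul.2 ⟨rfl, hGx _ hA, hSx, hXx⟩⟩
  have hfun : IsFun (M.elts η) (M.elts F) (M.elts F') := by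
    refine ⟨fun p hp => ?_, fun s hs => ?_⟩
    · obtain ⟨s, hs, u, hu, rfl, -⟩ := mem_rel.1 hp
      exact ⟨s, hs, u, hu, rfl⟩
    · obtain ⟨A, i, hi⟩ := h.1.exists_of_mem hs
      refine ⟨_, (hη _ _).2 ⟨A, i, hi, rfl⟩, fun u hu => ?_⟩
      obtain ⟨B, j, hj, rfl⟩ := (hη _ _).1 hu
      obtain rfl : A = B := Subtype.ext (hγ.unique (h.1.mem_iff hi) (h.1.mem_iff hj))
      rw [hom_ext (h.1.1.unique hi hj)]
  have hinj : ∀ s t r, M.opair s r ∈ M.elts η → M.opair t r ∈ M.elts η → s = t := by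
    intro s t r hs ht
    obtain ⟨A, i, hi, rfl⟩ := (hη _ _).1 hs
    obtain ⟨B, j, hj, hij⟩ := (hη _ _).1 ht
    obtain ⟨rfl, -⟩ := obj_eq_of_hom_eq hij
    -- Sections with the same image in `X` agree locally, by effectiveness of the quotient.
    exact H.eq_of_agree hF hS (h.1.mem_iff hi) (h.1.mem_iff hj) (h2 s t A i j hi hj (hom_ext hij))
  have hcomp : ∀ {s t : M.V} {A B : E.Obj} {i : A ⟶ S} {f : B ⟶ A},
      M.opair s i.1 ∈ M.elts ι → M.opair (M.opair s f.1) t ∈ M.elts e →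
      ∃ j : B ⟶ S, M.opair t j.1 ∈ M.elts ι ∧ f ≫ i ≫ π = j ≫ π := by
    intro s t A B i f hi hf
    have ht := (hF.act_type H.full hf).2
    obtain ⟨j, hj⟩ := h.1.exists_inj hγ ht
    refine ⟨j, hj, ?_⟩
    rw [h1 s t A B B i j f (𝟙 B) hi hj ⟨t, hf, hF.act_id' H.full ht⟩, Category.id_comp]
  have htrans : IsTransform (M.opair F (M.opair γ e)) (M.opair F' (M.opair γ' e')) η := by
    refine isTransform_iff.2 ⟨hfun, ?_, ?_⟩
    · intro s t A hst hA
      obtain ⟨B, i, hi, rfl⟩ := (hη _ _).1 hst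
      have hs := h.1.mem_iff hi
      exact hX.proj_iff.2 ⟨hγ.unique hA hs, hF.mem_of_proj H.full hs⟩
    · intro s t f r q hst hf hrq
      obtain ⟨A, i, hi, rfl⟩ := (hη _ _).1 hst
      obtain ⟨s', -, f', hf', e₁, a, ha, hc⟩ := hF.isFun_act.mem_left hf
      obtain ⟨rfl, rfl⟩ := (opair_inj _).1 e₁
      obtain ⟨B, A', f, hB, hA, rfl, rfl⟩ := H.full.exists_hom_of_cod hc
      obtain rfl : A = A' := Subtype.ext (hγ.unique (h.1.mem_iff hi) ha)
      obtain ⟨j, hj, hij⟩ := hcomp hi hf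
      obtain rfl := hfun.unique hrq ((hη _ _).2 ⟨B, j, hj, rfl⟩)
      exact (hX.act_iff H.full).2 ⟨by rw [hij], hB, hA⟩
  have hsurj : ∀ u ∈ M.elts F', ∃ s, M.opair s u ∈ M.elts η := by
    intro u hu
    obtain ⟨A, u, hA, rfl⟩ := hX.exists_hom hu
    have hP : ∀ {B : E.Obj} {g : B ⟶ A} {s : M.V}, (∃ k ∈ M.elts F', M.opair s k ∈ M.elts η ∧
        M.opair (M.opair u.1 g.1) k ∈ M.elts e') ↔
        B.1 ∈ M.elts G ∧ ∃ i : B ⟶ S, M.opair s i.1 ∈ M.elts ι ∧ g ≫ u = i ≫ π := by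
      intro B g s
      constructor
      · rintro ⟨k, -, hs, hk⟩
        obtain ⟨rfl, hB, -⟩ := (hX.act_iff H.full).1 hk
        obtain ⟨B', i, hi, hk⟩ := (hη _ _).1 hs
        obtain ⟨rfl, -⟩ := obj_eq_of_hom_eq hk
        exact ⟨hB, i, hi, hom_ext hk⟩
      · rintro ⟨hB, i, hi, hg⟩
        exact ⟨_, hX.hom_mem_iff.2 hB, (hη _ _).2 ⟨B, i, hi, rfl⟩,
          (hX.act_iff H.full).2 ⟨by rw [hg], hB, hA⟩⟩
    have hR : ∀ {B : E.Obj} {g : B ⟶ A}, g.1 ∈ M.elts (sep C.ar fun g =>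
        M.opair g A.1 ∈ M.elts C.cod ∧ ∃ s ∈ M.elts F, ∃ k ∈ M.elts F', M.opair s k ∈ M.elts η ∧
          M.opair (M.opair u.1 g) k ∈ M.elts e') ↔
        B.1 ∈ M.elts G ∧ ∃ (s : M.V) (i : B ⟶ S), M.opair s i.1 ∈ M.elts ι ∧ g ≫ u = i ≫ π := by
      intro B g
      rw [mem_sep]
      constructor
      · rintro ⟨-, -, s, -, hs⟩
        obtain ⟨hB, i, hi⟩ := hP.1 hs
        exact ⟨hB, s, i, hi⟩
      · rintro ⟨hB, s, i, hi, hg⟩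
        exact ⟨H.full.hom_mem hB hA g, H.full.opair_mem_cod.2 ⟨rfl, hB, hA⟩, s,
          hγ.mem_left (h.1.mem_iff hi), hP.2 ⟨hB, i, hi, hg⟩⟩
    have hc : Covers A (sep C.ar fun g =>
        M.opair g A.1 ∈ M.elts C.cod ∧ ∃ s ∈ M.elts F, ∃ k ∈ M.elts F', M.opair s k ∈ M.elts η ∧
          M.opair (M.opair u.1 g) k ∈ M.elts e') := by
      -- Locally `u` lifts to a summand of `S`, and restricting that summand's section along the
      -- lift gives a section whose image is the restriction of `u`. Injectivity makes these
      -- sections unique, so they form a matching family.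
      refine (H.jointlyEpi_factor hγ h π u).mono ?_
      rintro B g ⟨hB, s, Z, i, b, hi, hg⟩
      obtain ⟨t, ht, -⟩ := hF.exists_act H.full (h.1.mem_iff hi) b hB
      obtain ⟨j, hj, hij⟩ := hcomp hi ht
      exact hR.2 ⟨hB, t, j, hj, hg.trans hij⟩
    obtain ⟨s, ⟨hs, hs'⟩, -⟩ := H.existsUnique_section hF hS hA
      (H.full.isSieve (fun f hf => (mem_sep.1 hf).2.1) (by
        intro B B' f g hB' hf
        obtain ⟨hB, s, i, hi, hf⟩ := hR.1 hf
        obtain ⟨t, ht, -⟩ := hF.exists_act H.full (h.1.mem_iff hi) g hB'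
        obtain ⟨j, hj, hij⟩ := hcomp hi ht
        exact hR.2 ⟨hB', t, j, hj, by rw [Category.assoc, hf, hij]⟩)) hc
      (fun g s => ∃ k ∈ M.elts F', M.opair s k ∈ M.elts η ∧
        M.opair (M.opair u.1 g) k ∈ M.elts e') (by
        intro B f hf
        obtain ⟨hB, s, i, hi, hf⟩ := hR.1 hf
        refine ⟨s, h.1.mem_iff hi, hP.2 ⟨hB, i, hi, hf⟩, fun t ht => ?_⟩
        obtain ⟨-, j, hj, hf'⟩ := hP.1 ht
        exact hinj _ _ _ ((hη _ _).2 ⟨B, j, hj, rfl⟩)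
          ((hη _ _).2 ⟨B, i, hi, by rw [← hf, hf']⟩)) (by
        intro B B' f g s t _ hs ht
        obtain ⟨hB, i, hi, hf⟩ := hP.1 hs
        obtain ⟨j, hj, hij⟩ := hcomp hi ht
        exact hP.2 ⟨hF.mem_of_proj H.full (h.1.mem_iff hj), j, hj, by rw [Category.assoc, hf, hij]⟩)
    -- The image of the amalgamated section equals `u`, because the two agree on the covering sieve.
    obtain ⟨i, hi⟩ := h.1.exists_inj hγ hs
    refine ⟨s, (hη _ _).2 ⟨A, i, hi, congrArg Subtype.val (hc _ _ _ fun B g hg => ?_)⟩⟩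
    obtain ⟨hB, t, j, hj, hgu⟩ := hR.1 hg
    obtain ⟨j', hj', hij⟩ := hcomp hi (hs' B g t hg (hP.2 ⟨hB, j, hj, hgu⟩))
    rw [hgu, hij, hom_ext (h.1.1.unique hj hj')]
  obtain ⟨θ, hθ, hθ'⟩ := hF.exists_inverse (hX.presheafLaws H.full) htrans hinj hsurj
  exact ⟨X, F', γ', e', η, θ, hX, htrans, hθ, hθ'⟩

omit hF hS in
theorem yoneda_essSurj : H.yoneda.toFunctor.EssSurj where
  mem_essImage Y := by
    obtain ⟨F, γ, e, hY, hF, hS⟩ := SmallCat.sheafCat_isSheaf Y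
    obtain ⟨X, F', γ', e', η, θ, hX, hη, hθ, h⟩ := H.exists_isIso hF hS
    have hX' : (H.yoneda.toFunctor.obj X).1 = M.opair F' (M.opair γ' e') :=
      H.yonedaOb_unique (H.yoneda.obj_spec X) (opair_mem_yonedaOb.2 ⟨_, _, _, rfl, hX⟩)
    rw [← hX', ← hY] at hη hθ
    have := SmallCat.isIso_sheafHom hη hθ h
    exact ⟨X, ⟨(asIso (SmallCat.sheafHom η hη)).symm⟩⟩

end IsGiraudSite

end ClassCat

end MTTModel


/-- Giraud's theorem in Mac Lane type theory, i.e. in every model of MTT. -/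
theorem mainTheorem3 (M : MTTModel.{u, v, w}) (E : M.ClassCat)
    (hsmall : E.IsLocallySmall)
    (hlim : HasFiniteLimits E.Obj)
    (hcoprod : E.HasStableDisjointCoproducts)
    (hquot : E.HasStableQuotients)
    (hgen : E.HasSetOfGenerators) :
    E.IsGrothendieckTopos := by
  obtain ⟨G, hG, hG'⟩ := hgen
  obtain ⟨C, hC⟩ := hsmall G hG
  have H : E.IsGiraud G := ⟨hsmall, hlim, hcoprod, hquot, hG, hG'⟩
  obtain ⟨J, hJ, hJ'⟩ := H.exists_topology hC
  have H' : E.IsGiraudSite G C J := ⟨H, hC, hJ, hJ'⟩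
  have := H'.yoneda_faithful
  have := H'.yoneda_full
  have := H'.yoneda_essSurj
  -- The empty structure instance is the equivalence property, whose three parts are the instances
  -- just obtained.
  exact ⟨C, J, C.sheafCat J, H'.isTopology, C.isSheafCategory_sheafCat J, H'.yoneda, { }⟩
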